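/- Notation. Let $\mathcal D=-i\sum_{k=1}^3\alpha_k\partial_k+\beta$ be the massive Dirac operator (mass $1$) on $\mathbb R^3$, acting on $\mathbb C^4$-valued functions, where $\beta=\mathrm{diag}(1,1,-1,-1)$ and $\alpha_k=\begin{pmatrix}0&\sigma_k\\ \sigma_k&0\end{pmatrix}$ with the Pauli matrices $\sigma_k$. Write $\langle x\rangle=(1+|x|^2)^{1/2}$ and, for $s\ge 0$, $\|f\|_{H^s}=\|(1-\Delta)^{s/2}f\|_{L^2}$. For $T\in(0,\infty]$, $L^p_T$ denotes $L^p$ on the time interval $(-T,T)$. For a family of bounded linear operators $V(t):H^s\to H^s$, $t\in(-T,T)$, put $$\|V\|_{T,s,N}:=\operatorname*{ess\,sup}_{t\in(-T,T)}\big\|\langle x\rangle^N(1-\Delta)^{s/2}V(t)(1-\Delta)^{-s/2}\langle x\rangle^N\big\|_{L^2\to L^2}\in[0,\infty].$$ For $u_0\in H^s$, $S_V(t)u_0$ denotes the solution $u\in C((-T,T);H^s)$ of $i\partial_tu+\mathcal Du+V(t)u=0$, $u(0)=u_0$, where the equation is understood in the sense of tempered distributions on $\mathbb R^3$ for every $t\in(-T,T)$.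 A triple $(p,r,s)$ with $2<p\le\infty$, $1\le r\le\infty$, $s\ge0$ is called Dirac admissible if there is a constant $C$ with $\|e^{it\mathcal D}f\|_{L^p(\mathbb R;L^r(\mathbb R^3))}\le C\|f\|_{H^s}$ for all $f\in H^s$. Proposition 2.4. Let $(p,r,s)$ be a Dirac admissible triple (with $2<p\le\infty$, $1\le r\le\infty$, $s\ge 0$) and let $N>3/2$. There are constants $\varepsilon>0$ and $C<\infty$, depending only on $p,r,s,N$, such that the following holds for every $T\in(0,\infty]$. Let $V_1,V_2\in C((-T,T);\mathcal L(H^s,H^s))$ satisfy $\|V_j\|_{T,s,N}\le\varepsilon$ for $j=1,2$, and let $u_0\in H^s$. Then the solutions $S_{V_1}(t)u_0$ and $S_{V_2}(t)u_0$ exist on $(-T,T)$, and (for all such solutions) $$\|S_{V_1}(t)u_0-S_{V_2}(t)u_0\|_{L^p_TL^r}\le C\,\|V_1-V_2\|_{T,s,N}\,\|u_0\|_{H^s},$$ $$\|S_{V_1}(t)u_0-S_{V_2}(t)u_0\|_{L^\infty_TH^s}\le C\,\|V_1-V_2\|_{T,s,N}\,\|u_0\|_{H^s}.$$ In particular (taking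 $V_1=V_2$) the solutions are unique. -/

import Mathlib

open MeasureTheory Set FourierTransform
open scoped ENNReal NNReal Topology SchwartzMap LineDeriv

noncomputable section

namespace DiracFlow

/-- The physical space `ℝ³`. -/
abbrev E3 : Type := EuclideanSpace ℝ (Fin 3)

/-- The spinor space `ℂ⁴` with its Hermitian norm. -/
abbrev E4 : Type := EuclideanSpace ℂ (Fin 4)

/-- `L²(ℝ³; ℂ⁴)`. -/
abbrev L2 : Type := Lp E4 2 (volume : Measure E3)

/-- The Japanese bracket `⟨y⟩ = (1 + |y|²)^{1/2}`. -/
def jap (y : E3) : ℝ := Real.sqrt (1 + ‖y‖ ^ 2)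

lemma one_le_jap (y : E3) : 1 ≤ jap y := by
  unfold jap
  rw [Real.one_le_sqrt]
  nlinarith [sq_nonneg ‖y‖]

lemma jap_pos (y : E3) : 0 < jap y := lt_of_lt_of_le one_pos (one_le_jap y)

lemma continuous_jap : Continuous jap := by
  unfold jap
  fun_prop

/-! ### The Dirac operator -/

/-- The Pauli matrices `σ₁, σ₂, σ₃`. -/
def pauli : Fin 3 → Matrix (Fin 2) (Fin 2) ℂ :=
  ![!![0, 1; 1, 0], !![0, -Complex.I; Complex.I, 0], !![1, 0; 0, -1]]

/-- The Dirac matrices `α_k`, with off-diagonal `2 × 2` blocks `σ_k`. -/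
def alphaMatrix (k : Fin 3) : Matrix (Fin 4) (Fin 4) ℂ :=
  (Matrix.fromBlocks 0 (pauli k) (pauli k) 0).submatrix
    (finSumFinEquiv (m := 2) (n := 2)).symm (finSumFinEquiv (m := 2) (n := 2)).symm

/-- The Dirac matrix `β = diag(1, 1, -1, -1)`. -/
def betaMatrix : Matrix (Fin 4) (Fin 4) ℂ := Matrix.diagonal ![1, 1, -1, -1]

/-- `α_k` as an operator on `ℂ⁴`. -/
def alpha (k : Fin 3) : E4 →L[ℂ] E4 := Matrix.toEuclideanCLM (𝕜 := ℂ) (alphaMatrix k)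

/-- `β` as an operator on `ℂ⁴`. -/
def beta : E4 →L[ℂ] E4 := Matrix.toEuclideanCLM (𝕜 := ℂ) betaMatrix

/-- The pairing with a test function `φ` of the tempered distribution `𝓓 U`, where
`𝓓 = -i ∑ₖ αₖ ∂ₖ + β` is the Dirac operator of mass `1`. -/
def diracPairing (U : 𝓢'(E3, E4)) (φ : 𝓢(E3, ℂ)) : E4 :=
  -Complex.I • ∑ k : Fin 3, alpha k ((∂_{EuclideanSpace.single k (1 : ℝ)} U) φ) + beta (U φ)

/-- The Fourier symbol `∑ₖ 2π ξₖ αₖ + β` of the Dirac operator. The factor `2π` comes from the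
normalization `f̂(ξ) = ∫ e^{-2πi x·ξ} f(x) dx` of the Fourier transform. -/
def diracSymbol (ξ : E3) : E4 →L[ℂ] E4 :=
  ∑ k : Fin 3, ((2 * Real.pi * ξ k : ℝ) : ℂ) • alpha k + beta

lemma alphaMatrix_isHermitian (k : Fin 3) : (alphaMatrix k).IsHermitian := by
  ext i j
  fin_cases k <;> fin_cases i <;> fin_cases j <;>
    simp [alphaMatrix, pauli, finSumFinEquiv, Fin.addCases, Matrix.fromBlocks]

lemma betaMatrix_isHermitian : betaMatrix.IsHermitian := by
  ext i j
  fin_cases i <;> fin_cases j <;> simp [betaMatrix]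

lemma isSelfAdjoint_diracSymbol (ξ : E3) : IsSelfAdjoint (diracSymbol ξ) := by
  have h (k : Fin 3) : (((2 * Real.pi * ξ k : ℝ) : ℂ) • alphaMatrix k).IsHermitian := by
    rw [Matrix.IsHermitian, Matrix.conjTranspose_smul, (alphaMatrix_isHermitian k).eq]
    congr 1
    exact Complex.conj_ofReal _
  have hM : IsSelfAdjoint
      (∑ k : Fin 3, ((2 * Real.pi * ξ k : ℝ) : ℂ) • alphaMatrix k + betaMatrix) := by
    rw [Fin.sum_univ_three]
    exact (((h 0).add (h 1)).add (h 2)).add betaMatrix_isHermitian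
  have he : diracSymbol ξ = Matrix.toEuclideanCLM (𝕜 := ℂ) (n := Fin 4)
      (∑ k : Fin 3, ((2 * Real.pi * ξ k : ℝ) : ℂ) • alphaMatrix k + betaMatrix) := by
    simp [diracSymbol, alpha, beta, map_sum]
  rw [he]
  exact IsSelfAdjoint.map hM (Matrix.toEuclideanCLM (𝕜 := ℂ) (n := Fin 4))

lemma continuous_diracSymbol : Continuous diracSymbol := by
  unfold diracSymbol
  fun_prop

/-- The matrix `exp(i t (∑ₖ 2π ξₖ αₖ + β))`. -/
def diracExp (t : ℝ) (ξ : E3) : E4 →L[ℂ] E4 :=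
  NormedSpace.exp ((Complex.I * (t : ℂ)) • diracSymbol ξ)

lemma continuous_diracExp (t : ℝ) : Continuous (diracExp t) := by
  unfold diracExp
  let +nondep : NormedAlgebra ℚ (E4 →L[ℂ] E4) := NormedAlgebra.restrictScalars ℚ ℂ _
  exact NormedSpace.exp_continuous.comp (continuous_diracSymbol.const_smul (Complex.I * (t : ℂ)))

lemma norm_diracExp_apply_le (t : ℝ) (ξ : E3) (v : E4) : ‖diracExp t ξ v‖ ≤ ‖v‖ := by
  have h : IsSelfAdjoint ((t : ℂ) • diracSymbol ξ) :=
    IsSelfAdjoint.smul (Complex.conj_ofReal t) (isSelfAdjoint_diracSymbol ξ)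
  have hu : diracExp t ξ = ((selfAdjoint.expUnitary (⟨_, h⟩ : selfAdjoint (E4 →L[ℂ] E4)) :
      unitary (E4 →L[ℂ] E4)) : E4 →L[ℂ] E4) := by
    simp [diracExp, selfAdjoint.expUnitary_coe, smul_smul]
  have hn : ‖diracExp t ξ‖ ≤ 1 := by
    rw [hu]
    exact (CStarRing.norm_coe_unitary _).le
  calc ‖diracExp t ξ v‖ ≤ ‖diracExp t ξ‖ * ‖v‖ := (diracExp t ξ).le_opNorm v
    _ ≤ 1 * ‖v‖ := by gcongr
    _ = ‖v‖ := one_mul _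

lemma memLp_diracExp (t : ℝ) (g : L2) : MemLp (fun ξ => diracExp t ξ (g ξ)) 2 volume := by
  refine (Lp.memLp g).of_le ?_ (Filter.Eventually.of_forall fun ξ => norm_diracExp_apply_le t ξ _)
  have h : Continuous fun q : (E4 →L[ℂ] E4) × E4 => q.1 q.2 := by fun_prop
  exact h.comp_aestronglyMeasurable
    ((continuous_diracExp t).aestronglyMeasurable.prodMk (Lp.aestronglyMeasurable g))

/-- The free Dirac group `e^{it𝓓}` on `L²(ℝ³; ℂ⁴)`: the Fourier multiplier with symbol
`exp(i t (∑ₖ 2π ξₖ αₖ + β))`. -/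
def diracGroup (t : ℝ) (f : L2) : L2 := 𝓕⁻ ((memLp_diracExp t (𝓕 f : L2)).toLp _)

/-! ### The Sobolev spaces `H^s`, `s ≥ 0` -/

/-- `⟨2πξ⟩^s f̂(ξ)`, the Fourier transform of `(1 - Δ)^{s/2} f`. -/
def besselFourier (s : ℝ≥0) (f : L2) (ξ : E3) : E4 :=
  (jap ((2 * Real.pi) • ξ) ^ (s : ℝ)) • (𝓕 f : L2) ξ

lemma besselFourier_add (s : ℝ≥0) (f g : L2) :
    besselFourier s (f + g) =ᵐ[volume] besselFourier s f + besselFourier s g := by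
  have h : (𝓕 (f + g) : L2) = 𝓕 f + 𝓕 g := (Lp.fourierTransformₗᵢ E3 E4).map_add f g
  filter_upwards [Lp.coeFn_add (𝓕 f : L2) (𝓕 g : L2)] with ξ hξ
  simp only [besselFourier, Pi.add_apply, h, hξ, smul_add]

lemma besselFourier_smul (s : ℝ≥0) (c : ℂ) (f : L2) :
    besselFourier s (c • f) =ᵐ[volume] c • besselFourier s f := by
  have h : (𝓕 (c • f) : L2) = c • 𝓕 f := (Lp.fourierTransformₗᵢ E3 E4).map_smul c f
  filter_upwards [Lp.coeFn_smul c (𝓕 f : L2)] with ξ hξ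
  simp only [besselFourier, Pi.smul_apply, h, hξ]
  rw [smul_comm]

/-- `H^s(ℝ³; ℂ⁴)` as a subspace of `L²(ℝ³; ℂ⁴)`. -/
def sobolevSubmodule (s : ℝ≥0) : Submodule ℂ L2 where
  carrier := {f | MemLp (besselFourier s f) 2 volume}
  add_mem' {f g} hf hg := (memLp_congr_ae (besselFourier_add s f g)).2 (hf.add hg)
  zero_mem' := by
    have h := besselFourier_smul s 0 0
    simp only [zero_smul] at h
    exact (memLp_congr_ae h).2 MemLp.zero'
  smul_mem' c f hf := (memLp_congr_ae (besselFourier_smul s c f)).2 (hf.const_smul c)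

/-- The Sobolev space `H^s(ℝ³; ℂ⁴)`, `s ≥ 0`; its norm is `‖(1 - Δ)^{s/2} f‖_{L²}`, see below. -/
def Hs (s : ℝ≥0) : Type := sobolevSubmodule s

instance (s : ℝ≥0) : AddCommGroup (Hs s) := inferInstanceAs (AddCommGroup (sobolevSubmodule s))

instance (s : ℝ≥0) : Module ℂ (Hs s) := inferInstanceAs (Module ℂ (sobolevSubmodule s))

/-- The inclusion of `H^s` into `L²`. -/
def toL2 {s : ℝ≥0} : Hs s →ₗ[ℂ] L2 := (sobolevSubmodule s).subtype

lemma memLp_besselFourier {s : ℝ≥0} (f : Hs s) : MemLp (besselFourier s (toL2 f)) 2 volume :=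
  f.2

/-- The operator `(1 - Δ)^{s/2} : H^s → L²`. -/
def bessel (s : ℝ≥0) : Hs s →ₗ[ℂ] L2 where
  toFun f := 𝓕⁻ ((memLp_besselFourier f).toLp _)
  map_add' f g := by
    refine Eq.trans (congrArg (fun h : L2 => (𝓕⁻ h : L2)) ?_)
      ((Lp.fourierTransformₗᵢ E3 E4).symm.map_add _ _)
    rw [← MemLp.toLp_add, MemLp.toLp_eq_toLp_iff, map_add]
    exact besselFourier_add s _ _
  map_smul' c f := by
    refine Eq.trans (congrArg (fun h : L2 => (𝓕⁻ h : L2)) ?_)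
      ((Lp.fourierTransformₗᵢ E3 E4).symm.map_smul c _)
    rw [← MemLp.toLp_const_smul c (memLp_besselFourier f), MemLp.toLp_eq_toLp_iff, map_smul]
    exact besselFourier_smul s c _

lemma bessel_injective (s : ℝ≥0) : Function.Injective (bessel s) := by
  intro f g h
  have h1 : (memLp_besselFourier f).toLp _ = (memLp_besselFourier g).toLp _ :=
    (Lp.fourierTransformₗᵢ E3 E4).symm.injective h
  rw [MemLp.toLp_eq_toLp_iff] at h1
  have h2 : (𝓕 (toL2 f) : L2) = 𝓕 (toL2 g) := by
    refine Lp.ext ?_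
    filter_upwards [h1] with ξ hξ
    exact smul_right_injective _ (Real.rpow_pos_of_pos (jap_pos _) _).ne' hξ
  exact Subtype.ext ((Lp.fourierTransformₗᵢ E3 E4).injective h2)

lemma bessel_surjective (s : ℝ≥0) : Function.Surjective (bessel s) := by
  intro h
  have hm : MemLp (fun ξ => (jap ((2 * Real.pi) • ξ) ^ (-(s : ℝ))) • (𝓕 h : L2) ξ) 2 volume := by
    have hc : Continuous fun ξ : E3 => jap ((2 * Real.pi) • ξ) ^ (-(s : ℝ)) :=
      (continuous_jap.comp (by fun_prop : Continuous fun ξ : E3 => (2 * Real.pi) • ξ)).rpow_const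
        fun ξ => Or.inl (jap_pos _).ne'
    refine MemLp.of_le (Lp.memLp (𝓕 h : L2))
      (hc.aestronglyMeasurable.smul (Lp.aestronglyMeasurable (𝓕 h : L2)))
      (Filter.Eventually.of_forall fun ξ => ?_)
    · rw [norm_smul, Real.norm_of_nonneg (Real.rpow_nonneg (jap_pos _).le _)]
      refine mul_le_of_le_one_left (norm_nonneg _) ?_
      exact Real.rpow_le_one_of_one_le_of_nonpos (one_le_jap _) (neg_nonpos.2 s.2)
  set f : L2 := 𝓕⁻ (hm.toLp _) with hf
  have hF : (𝓕 f : L2) = hm.toLp _ := (Lp.fourierTransformₗᵢ E3 E4).apply_symm_apply _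
  have hb : besselFourier s f =ᵐ[volume] (𝓕 h : L2) := by
    filter_upwards [hm.coeFn_toLp] with ξ hξ
    rw [besselFourier, hF, hξ, smul_smul, ← Real.rpow_add (jap_pos _), add_neg_cancel,
      Real.rpow_zero, one_smul]
  have hfm : f ∈ sobolevSubmodule s := (memLp_congr_ae hb).2 (Lp.memLp _)
  refine ⟨⟨f, hfm⟩, ?_⟩
  have : (memLp_besselFourier (⟨f, hfm⟩ : Hs s)).toLp _ = (𝓕 h : L2) := by
    rw [← Lp.toLp_coeFn (𝓕 h : L2) (Lp.memLp _), MemLp.toLp_eq_toLp_iff]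
    exact hb
  exact (congrArg (fun h : L2 => (𝓕⁻ h : L2)) this).trans
    ((Lp.fourierTransformₗᵢ E3 E4).symm_apply_apply h)

/-- The norm `‖f‖_{H^s} = ‖(1 - Δ)^{s/2} f‖_{L²}`. -/
instance (s : ℝ≥0) : NormedAddCommGroup (Hs s) :=
  NormedAddCommGroup.induced (Hs s) L2 (bessel s) (bessel_injective s)

instance (s : ℝ≥0) : NormedSpace ℂ (Hs s) := NormedSpace.induced ℂ (Hs s) L2 (bessel s)

/-- The bijection `(1 - Δ)^{s/2} : H^s → L²`; its inverse is `(1 - Δ)^{-s/2}`. -/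
def besselEquiv (s : ℝ≥0) : Hs s ≃ₗ[ℂ] L2 :=
  LinearEquiv.ofBijective (bessel s) ⟨bessel_injective s, bessel_surjective s⟩

/-! ### Norms -/

/-- The time interval `(-T, T)`, `T ∈ [0, ∞]`. -/
def timeInterval (T : ℝ≥0∞) : Set ℝ := {t | ENNReal.ofReal |t| < T}

/-- The mixed norm of `L^p((-T, T); L^r(ℝ³; ℂ⁴))`, equal to `∞` outside that space. -/
def mixedNorm (T p r : ℝ≥0∞) (u : ℝ → L2) : ℝ≥0∞ :=
  eLpNorm (fun t => eLpNorm (u t) r volume) p (volume.restrict (timeInterval T))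

/-- The operator norm on `L²` of `⟨x⟩^N (1 - Δ)^{s/2} A (1 - Δ)^{-s/2} ⟨x⟩^N`, defined on the
(dense) space of the `f ∈ L²` with `⟨x⟩^N f ∈ L²`; it is `∞` if this operator is unbounded or does
not take its values in `L²`. -/
def weightedOpNorm {s : ℝ≥0} (N : ℝ) (A : Hs s →L[ℂ] Hs s) : ℝ≥0∞ :=
  sInf {c : ℝ≥0∞ | ∀ (f : L2) (hf : MemLp (fun x => (jap x ^ N) • f x) 2 volume),
    eLpNorm (fun x => (jap x ^ N) • bessel s (A ((besselEquiv s).symm (hf.toLp _))) x) 2 volume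
      ≤ c * ‖f‖ₑ}

/-- The norm `‖V‖_{T,s,N}`, the essential supremum over `t ∈ (-T, T)` of the norm on `L²` of
`⟨x⟩^N (1 - Δ)^{s/2} V(t) (1 - Δ)^{-s/2} ⟨x⟩^N`. -/
def potentialNorm {s : ℝ≥0} (T : ℝ≥0∞) (N : ℝ) (V : ℝ → (Hs s →L[ℂ] Hs s)) : ℝ≥0∞ :=
  essSup (fun t => weightedOpNorm N (V t)) (volume.restrict (timeInterval T))

/-- Dirac admissible triples: `‖e^{it𝓓} f‖_{L^p(ℝ; L^r)} ≲ ‖f‖_{H^s}`. -/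
def DiracAdmissible (p r : ℝ≥0∞) (s : ℝ≥0) : Prop :=
  ∃ C : ℝ≥0, ∀ f : Hs s, mixedNorm ⊤ p r (fun t => diracGroup t (toL2 f)) ≤ C * ‖f‖ₑ

/-! ### The perturbed flow -/

/-- `u = S_V(t) u₀`: `u` belongs to `C((-T, T); H^s)` and solves `i ∂ₜ u + 𝓓 u + V(t) u = 0`,
`u(0) = u₀`, on `(-T, T)` in the sense of tempered distributions on `ℝ³`. -/
structure IsDiracFlow {s : ℝ≥0} (T : ℝ≥0∞) (V : ℝ → (Hs s →L[ℂ] Hs s)) (u₀ : Hs s)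
    (u : ℝ → Hs s) : Prop where
  continuousOn : ContinuousOn u (timeInterval T)
  initial : u 0 = u₀
  equation : ∀ t ∈ timeInterval T, ∀ φ : 𝓢(E3, ℂ), ∃ w : E4,
    HasDerivAt (fun τ => (toL2 (u τ) : 𝓢'(E3, E4)) φ) w t ∧
      Complex.I • w + diracPairing (toL2 (u t) : 𝓢'(E3, E4)) φ
        + (toL2 (V t (u t)) : 𝓢'(E3, E4)) φ = 0

end DiracFlow

end

open MeasureTheory Set FourierTransform
open scoped ENNReal NNReal Topology SchwartzMap LineDeriv

noncomputable section

namespace DiracFlow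

/-! ### Pointwise operators on `L²` -/

/-! Put y = (1-Δ)^{s/2} u and Q = ⟨x⟩^{-N}. Since 𝓓 commutes with (1-Δ)^{s/2}, y solves in L² the
equation with the conjugated potential W(t) = (1-Δ)^{s/2} V(t) (1-Δ)^{-s/2}, and ‖V‖_{T,s,N} ≤ ε
means that for a.e. t one has W(t)y = Qz with ‖z‖ ≤ ε‖Qy‖ (`exists_japOp_eq`).

The analytic input is local decay, `exists_local_decay`: |⟨e^{it𝓓}Qφ, Qψ⟩| ≤
C(1+|t|)^{-33/32}‖φ‖‖ψ‖. All that matters later is that the kernel k is integrable in time. By TT*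
and Young's inequality this gives Kato smoothing for e^{it𝓓}, its dual estimate ‖∫ e^{-iτ𝓓}Qz dτ‖ ≤
‖k‖₁^{1/2}‖z‖_{L²_t}, and smoothing for the Duhamel term. If ε‖k‖₁ ≤ 1/2 the potential is absorbed,
so ‖Qy‖_{L²_t} ≲ ‖y₀‖. The difference d = y₁ - y₂ has zero data and forcing W₁d + (W₁ - W₂)y₂. The
same absorption shows that this forcing is Qz with ‖z‖_{L²_t} ≲ ‖V₁ - V₂‖ ‖y₀‖
(`exists_forcingBound_sub`), and the dual estimate then bounds d in L^∞_t L².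

For L^p_t L^r, the dual estimate on [s,t] shows that Φ(t) = e^{-it𝓓}d(t) satisfies ‖Φ(t)-Φ(s)‖² ≤
‖k‖₁ ∫_s^t ‖z‖². So Φ has bounded quadratic variation, and a dyadic chaining argument transfers the
free Strichartz estimate to e^{it𝓓}Φ(t) (`exists_quadratic_variation_strichartz`). It plays the role
of the Christ-Kiselev lemma, and the chaining series converges because p > 2.

Local decay is proved on the Fourier side. In polar coordinates the symbol splits into two scalar
phases e^{±it√(1+4π²ρ²)}. One integration by parts along the ray gives |t|^{-1}. A second one is
singular at ρ = 0, so it is done only away from a small neighbourhood of the origin, with a smooth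
cutoff whose width depends on t. The small-frequency remainder is paid with the weight |ξ|^{-5/4},
square integrable near 0, and with the boundedness of the Fourier transform of a function in
⟨x⟩^{-N}L², which is where N > 3/2 enters. The second derivatives in frequency would need ⟨x⟩²;
truncating in space at |x| ≤ |t| avoids asking for that much decay.

Finally, distributional solutions and solutions of Duhamel's formula coincide
(`IsWeakSolution.isDuhamel`, `IsDuhamel.isWeakSolution`). This allows existence to be proved by
Picard iteration and the estimates to be applied to every solution in the class. -/

lemma norm_toLp_le_of_bound {f : L2} {g : E3 → E4} (hg : MemLp g 2 volume) {C : ℝ}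
    (h : ∀ᵐ x, ‖g x‖ ≤ C * ‖f x‖) : ‖hg.toLp g‖ ≤ C * ‖f‖ := by
  refine Lp.norm_le_mul_norm_of_ae_le_mul ?_
  filter_upwards [hg.coeFn_toLp, h] with x hx h'
  rwa [hx]

/-- A bounded measurable field of operators on `ℂ⁴`. -/
structure BddField (m : E3 → E4 →L[ℂ] E4) : Prop where
  meas : AEStronglyMeasurable m volume
  bdd : ∃ C : ℝ, 0 ≤ C ∧ ∀ ξ, ‖m ξ‖ ≤ C

lemma BddField.of_continuous {m : E3 → E4 →L[ℂ] E4} (hm : Continuous m) {C : ℝ}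
    (hC : ∀ ξ, ‖m ξ‖ ≤ C) : BddField m :=
  ⟨hm.aestronglyMeasurable, C, (norm_nonneg _).trans (hC 0), hC⟩

lemma aestronglyMeasurable_apply {m : E3 → E4 →L[ℂ] E4} (hm : AEStronglyMeasurable m volume)
    {f : E3 → E4} (hf : AEStronglyMeasurable f volume) :
    AEStronglyMeasurable (fun ξ => m ξ (f ξ)) volume := by
  have h : Continuous fun q : (E4 →L[ℂ] E4) × E4 => q.1 q.2 := by fun_prop
  exact h.comp_aestronglyMeasurable (hm.prodMk hf)

lemma BddField.memLp {m : E3 → E4 →L[ℂ] E4} (hm : BddField m) (f : L2) :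
    MemLp (fun ξ => m ξ (f ξ)) 2 volume := by
  obtain ⟨C, hC0, hC⟩ := hm.bdd
  refine MemLp.of_le_mul (c := C) (Lp.memLp f)
    (aestronglyMeasurable_apply hm.meas (Lp.aestronglyMeasurable f))
    (Filter.Eventually.of_forall fun ξ => ?_)
  exact (m ξ).le_of_opNorm_le (hC ξ) _

/-- The operator `(m f)(ξ) = m(ξ) f(ξ)` on `L²`. -/
def pointwiseOp {m : E3 → E4 →L[ℂ] E4} (hm : BddField m) : L2 →L[ℂ] L2 :=
  LinearMap.mkContinuousOfExistsBound
    { toFun := fun f => (hm.memLp f).toLp _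
      map_add' := fun f g => by
        rw [← MemLp.toLp_add, MemLp.toLp_eq_toLp_iff]
        filter_upwards [Lp.coeFn_add f g] with ξ h
        rw [h, Pi.add_apply, map_add, Pi.add_apply]
      map_smul' := fun c f => by
        rw [RingHom.id_apply, ← MemLp.toLp_const_smul, MemLp.toLp_eq_toLp_iff]
        filter_upwards [Lp.coeFn_smul c f] with ξ h
        rw [h, Pi.smul_apply, map_smul, Pi.smul_apply] }
    (by
      obtain ⟨C, hC0, hC⟩ := hm.bdd
      exact ⟨C, fun f => norm_toLp_le_of_bound (hm.memLp f)
        (Filter.Eventually.of_forall fun ξ => (m ξ).le_of_opNorm_le (hC ξ) _)⟩)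

lemma pointwiseOp_coeFn {m : E3 → E4 →L[ℂ] E4} (hm : BddField m) (f : L2) :
    pointwiseOp hm f =ᵐ[volume] fun ξ => m ξ (f ξ) :=
  (hm.memLp f).coeFn_toLp

lemma norm_pointwiseOp_le {m : E3 → E4 →L[ℂ] E4} (hm : BddField m) {C : ℝ}
    (h : ∀ ξ, ‖m ξ‖ ≤ C) (f : L2) : ‖pointwiseOp hm f‖ ≤ C * ‖f‖ :=
  norm_toLp_le_of_bound (hm.memLp f)
    (Filter.Eventually.of_forall fun ξ => (m ξ).le_of_opNorm_le (h ξ) _)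

lemma pointwiseOp_ext {m : E3 → E4 →L[ℂ] E4} (hm : BddField m) {f g : L2}
    (h : (fun ξ => m ξ (f ξ)) =ᵐ[volume] g) : pointwiseOp hm f = g :=
  Lp.ext ((pointwiseOp_coeFn hm f).trans h)

lemma pointwiseOp_comp {m n k : E3 → E4 →L[ℂ] E4} (hm : BddField m) (hn : BddField n)
    (hk : BddField k) (h : ∀ ξ v, m ξ (n ξ v) = k ξ v) (f : L2) :
    pointwiseOp hm (pointwiseOp hn f) = pointwiseOp hk f := by
  refine pointwiseOp_ext hm ?_
  filter_upwards [pointwiseOp_coeFn hn f, pointwiseOp_coeFn hk f] with ξ h1 h2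
  rw [h1, h2, h]

lemma pointwiseOp_id {m : E3 → E4 →L[ℂ] E4} (hm : BddField m) (h : ∀ ξ v, m ξ v = v) (f : L2) :
    pointwiseOp hm f = f :=
  pointwiseOp_ext hm (Filter.Eventually.of_forall fun _ => h _ _)

lemma inner_pointwiseOp_left {m n : E3 → E4 →L[ℂ] E4} (hm : BddField m) (hn : BddField n)
    (h : ∀ ξ v w, inner ℂ (m ξ v) w = inner ℂ v (n ξ w)) (f g : L2) :
    inner ℂ (pointwiseOp hm f) g = inner ℂ f (pointwiseOp hn g) := by
  rw [L2.inner_def, L2.inner_def]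
  refine integral_congr_ae ?_
  filter_upwards [pointwiseOp_coeFn hm f, pointwiseOp_coeFn hn g] with ξ h1 h2
  rw [h1, h2, h]

/-- The field of scalar operators `w(ξ) · id`. -/
def scalarField (w : E3 → ℝ) (ξ : E3) : E4 →L[ℂ] E4 := ((w ξ : ℝ) : ℂ) • ContinuousLinearMap.id ℂ E4

lemma scalarField_apply (w : E3 → ℝ) (ξ : E3) (v : E4) : scalarField w ξ v = w ξ • v := by
  simp [scalarField]

lemma norm_scalarField_le (w : E3 → ℝ) (ξ : E3) : ‖scalarField w ξ‖ ≤ |w ξ| := by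
  refine ContinuousLinearMap.opNorm_le_bound _ (abs_nonneg _) fun v => ?_
  rw [scalarField_apply, norm_smul, Real.norm_eq_abs]

lemma BddField.scalar {w : E3 → ℝ} (hw : Measurable w) {C : ℝ} (hC : ∀ ξ, |w ξ| ≤ C) :
    BddField (scalarField w) := by
  refine ⟨?_, C, (abs_nonneg _).trans (hC 0), fun ξ => (norm_scalarField_le w ξ).trans (hC ξ)⟩
  exact ((Complex.measurable_ofReal.comp hw).aestronglyMeasurable).smul_const _

lemma pointwiseOp_scalar_coeFn {w : E3 → ℝ} (hw : BddField (scalarField w)) (f : L2) :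
    pointwiseOp hw f =ᵐ[volume] fun ξ => w ξ • f ξ := by
  filter_upwards [pointwiseOp_coeFn hw f] with ξ h
  rw [h, scalarField_apply]

/-! ### The free group -/

lemma diracExp_zero (ξ : E3) : diracExp 0 ξ = 1 := by
  unfold diracExp
  rw [Complex.ofReal_zero, mul_zero, show (0 : ℂ) • diracSymbol ξ = 0 from ContinuousLinearMap.ext fun v => by simp,
    NormedSpace.exp_zero]

lemma diracExp_add (s t : ℝ) (ξ : E3) : diracExp (s + t) ξ = diracExp s ξ * diracExp t ξ := by
  let +nondep : NormedAlgebra ℚ (E4 →L[ℂ] E4) := NormedAlgebra.restrictScalars ℚ ℂ _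
  unfold diracExp
  rw [← NormedSpace.exp_add_of_commute]
  · congr 1
    push_cast
    rw [mul_add]
    exact ContinuousLinearMap.ext fun v => by simp [add_smul]
  · exact (Commute.refl _).smul_left _ |>.smul_right _

lemma diracExp_neg_apply (t : ℝ) (ξ : E3) (v : E4) : diracExp (-t) ξ (diracExp t ξ v) = v := by
  have h := diracExp_add (-t) t ξ
  rw [neg_add_cancel, diracExp_zero] at h
  exact (DFunLike.congr_fun h v).symm

lemma norm_diracExp_le (t : ℝ) (ξ : E3) : ‖diracExp t ξ‖ ≤ 1 :=
  ContinuousLinearMap.opNorm_le_bound _ zero_le_one fun v => by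
    rw [one_mul]; exact norm_diracExp_apply_le t ξ v

lemma norm_diracExp_apply (t : ℝ) (ξ : E3) (v : E4) : ‖diracExp t ξ v‖ = ‖v‖ := by
  refine le_antisymm (norm_diracExp_apply_le t ξ v) ?_
  have := norm_diracExp_apply_le (-t) ξ (diracExp t ξ v)
  rwa [diracExp_neg_apply] at this

/-- `diracExp t ξ` as a linear isometry. -/
def diracExpIso (t : ℝ) (ξ : E3) : E4 →ₗᵢ[ℂ] E4 :=
  ⟨(diracExp t ξ).toLinearMap, norm_diracExp_apply t ξ⟩

lemma inner_diracExp (t : ℝ) (ξ : E3) (v w : E4) :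
    inner ℂ (diracExp t ξ v) w = inner ℂ v (diracExp (-t) ξ w) := by
  have h := (diracExpIso t ξ).inner_map_map v (diracExp (-t) ξ w)
  have h2 : diracExp t ξ (diracExp (-t) ξ w) = w := by
    have := diracExp_neg_apply (-t) ξ w
    rwa [neg_neg] at this
  rw [← h]
  change _ = inner ℂ (diracExp t ξ v) (diracExp t ξ (diracExp (-t) ξ w))
  rw [h2]

lemma bddField_diracExp (t : ℝ) : BddField (diracExp t) :=
  .of_continuous (continuous_diracExp t) (norm_diracExp_le t)

lemma hasDerivAt_diracExp (t : ℝ) (ξ : E3) :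
    HasDerivAt (fun τ : ℝ => diracExp τ ξ) ((Complex.I • diracSymbol ξ) * diracExp t ξ) t := by
  have h := hasDerivAt_exp_smul_const' (𝕂 := ℂ) (Complex.I • diracSymbol ξ) (t : ℂ)
  have h2 := h.scomp t (Complex.ofRealCLM.hasDerivAt (x := t))
  have he : ∀ τ : ℝ, (τ : ℂ) • (Complex.I • diracSymbol ξ)
      = (Complex.I * (τ : ℂ)) • diracSymbol ξ := fun τ => by
    rw [smul_smul, mul_comm]
  have he2 : (fun u : ℂ => NormedSpace.exp (u • (Complex.I • diracSymbol ξ))) ∘ Complex.ofReal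
      = fun τ : ℝ => diracExp τ ξ := funext fun τ => congrArg NormedSpace.exp (he τ)
  rw [he2, he t] at h2
  simpa [diracExp] using h2

/-- The free group on the Fourier side. -/
def fourierGroup (t : ℝ) : L2 →L[ℂ] L2 := pointwiseOp (bddField_diracExp t)

lemma fourierGroup_coeFn (t : ℝ) (f : L2) :
    fourierGroup t f =ᵐ[volume] fun ξ => diracExp t ξ (f ξ) := pointwiseOp_coeFn _ f

lemma fourierGroup_zero (f : L2) : fourierGroup 0 f = f :=
  pointwiseOp_id _ (fun ξ v => by rw [diracExp_zero]; rfl) f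

lemma fourierGroup_add (s t : ℝ) (f : L2) :
    fourierGroup (s + t) f = fourierGroup s (fourierGroup t f) :=
  (pointwiseOp_comp _ _ _ (fun ξ v => by rw [diracExp_add]; rfl) f).symm

lemma inner_fourierGroup (t : ℝ) (f g : L2) :
    inner ℂ (fourierGroup t f) g = inner ℂ f (fourierGroup (-t) g) :=
  inner_pointwiseOp_left _ _ (inner_diracExp t) f g

lemma norm_fourierGroup (t : ℝ) (f : L2) : ‖fourierGroup t f‖ = ‖f‖ := by
  have h : inner ℂ (fourierGroup t f) (fourierGroup t f) = inner ℂ f f := by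
    rw [inner_fourierGroup, ← fourierGroup_add, neg_add_cancel, fourierGroup_zero]
  rw [inner_self_eq_norm_sq_to_K, inner_self_eq_norm_sq_to_K] at h
  have h' : ‖fourierGroup t f‖ ^ 2 = ‖f‖ ^ 2 := by exact_mod_cast h
  exact (pow_left_inj₀ (norm_nonneg _) (norm_nonneg _) two_ne_zero).1 h'

/-- Dominated convergence in `L²`, for families given by pointwise representatives. -/
lemma tendsto_zero_of_dominated {ι : Type*} {l : Filter ι} [l.IsCountablyGenerated]
    {F : ι → L2} {φ : ι → E3 → E4} {G : L2} (hF : ∀ i, F i =ᵐ[volume] φ i)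
    (hb : ∀ᶠ i in l, ∀ᵐ x, ‖φ i x‖ ≤ ‖G x‖)
    (hlim : ∀ᵐ x, Filter.Tendsto (fun i => φ i x) l (𝓝 0)) :
    Filter.Tendsto F l (𝓝 0) := by
  rw [tendsto_zero_iff_norm_tendsto_zero]
  have h : Filter.Tendsto (fun i => ∫ x, ‖φ i x‖ ^ 2) l (𝓝 (∫ _ : E3, (0 : ℝ))) := by
    refine tendsto_integral_filter_of_dominated_convergence (fun x => ‖G x‖ ^ 2) ?_ ?_ ?_ ?_
    · exact Filter.Eventually.of_forall fun i =>
        ((Lp.aestronglyMeasurable (F i)).congr (hF i)).norm.pow 2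
    · filter_upwards [hb] with i hi
      filter_upwards [hi] with x hx
      rw [Real.norm_of_nonneg (by positivity)]
      gcongr
    · exact (memLp_two_iff_integrable_sq_norm (Lp.aestronglyMeasurable G)).1 (Lp.memLp G)
    · filter_upwards [hlim] with x hx
      simpa using (hx.norm.pow 2)
  have h2 : ∀ i, ∫ x, ‖φ i x‖ ^ 2 = ‖F i‖ ^ 2 := fun i => by
    have := L2.inner_def (𝕜 := ℂ) (F i) (F i)
    simp only [inner_self_eq_norm_sq_to_K] at this
    have h3 : ((‖F i‖ ^ 2 : ℝ) : ℂ) = ((∫ x, ‖F i x‖ ^ 2 : ℝ) : ℂ) := by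
      rw [← integral_complex_ofReal]
      push_cast
      exact this
    rw [Complex.ofReal_inj.1 h3]
    refine integral_congr_ae ?_
    filter_upwards [hF i] with x hx
    rw [hx]
  simp only [h2, integral_zero] at h
  have h4 := h.sqrt
  simpa [Real.sqrt_sq] using h4

/-- Continuity at t = 0 is dominated convergence with majorant 2|f|; the group law transports it to
every t. -/
lemma continuous_fourierGroup (f : L2) : Continuous fun t => fourierGroup t f := by
  have h0 : Filter.Tendsto (fun t => fourierGroup t f - f) (𝓝 0) (𝓝 0) := by
    refine tendsto_zero_of_dominated (φ := fun t ξ => diracExp t ξ (f ξ) - f ξ)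
      (G := (2 : ℂ) • f) (fun t => ?_) ?_ ?_
    · filter_upwards [fourierGroup_coeFn t f, Lp.coeFn_sub (fourierGroup t f) f] with ξ h1 h2
      rw [h2, Pi.sub_apply, h1]
    · refine Filter.Eventually.of_forall fun t => ?_
      filter_upwards [Lp.coeFn_smul (2 : ℂ) f] with ξ h3
      rw [h3, Pi.smul_apply, norm_smul]
      refine (norm_sub_le _ _).trans ?_
      rw [norm_diracExp_apply]
      simp [two_mul]
    · refine Filter.Eventually.of_forall fun ξ => ?_
      have h := ((hasDerivAt_diracExp 0 ξ).continuousAt.clm_apply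
        (continuousAt_const (y := f ξ))).tendsto.sub_const (f ξ)
      simpa [diracExp_zero] using h
  rw [continuous_iff_continuousAt]
  intro t
  have h1 : (fun τ => fourierGroup τ f) = fun τ =>
      fourierGroup t (fourierGroup (τ - t) f - f) + fourierGroup t f := by
    funext τ
    rw [map_sub, ← fourierGroup_add, add_sub_cancel, sub_add_cancel]
  unfold ContinuousAt
  rw [h1]
  have h2 : Filter.Tendsto (fun τ => τ - t) (𝓝 t) (𝓝 0) := by
    have : ContinuousAt (fun τ : ℝ => τ - t) t := by fun_prop
    simpa [ContinuousAt] using this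
  have h3 := (((fourierGroup t).continuous.tendsto 0).comp (h0.comp h2)).add_const
    (fourierGroup t f)
  simpa [fourierGroup_zero] using h3

/-- The Fourier transform of `L²` as an isometry. -/
def fourierIso : L2 ≃ₗᵢ[ℂ] L2 := Lp.fourierTransformₗᵢ E3 E4

/-- The free Dirac group as a family of bounded operators. -/
def freeGroup (t : ℝ) : L2 →L[ℂ] L2 :=
  (fourierIso.symm.toContinuousLinearEquiv : L2 →L[ℂ] L2) ∘L fourierGroup t ∘L
    (fourierIso.toContinuousLinearEquiv : L2 →L[ℂ] L2)

lemma freeGroup_apply (t : ℝ) (f : L2) :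
    freeGroup t f = fourierIso.symm (fourierGroup t (fourierIso f)) := rfl

lemma freeGroup_eq_diracGroup (t : ℝ) (f : L2) : freeGroup t f = diracGroup t f := rfl

lemma fourierIso_freeGroup (t : ℝ) (f : L2) :
    fourierIso (freeGroup t f) = fourierGroup t (fourierIso f) := by
  rw [freeGroup_apply, LinearIsometryEquiv.apply_symm_apply]

lemma freeGroup_zero (f : L2) : freeGroup 0 f = f := by
  rw [freeGroup_apply, fourierGroup_zero, LinearIsometryEquiv.symm_apply_apply]

lemma freeGroup_add (s t : ℝ) (f : L2) : freeGroup (s + t) f = freeGroup s (freeGroup t f) := by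
  rw [freeGroup_apply, freeGroup_apply s, fourierIso_freeGroup, fourierGroup_add]

lemma norm_freeGroup (t : ℝ) (f : L2) : ‖freeGroup t f‖ = ‖f‖ := by
  rw [freeGroup_apply, LinearIsometryEquiv.norm_map, norm_fourierGroup,
    LinearIsometryEquiv.norm_map]

lemma inner_freeGroup (t : ℝ) (f g : L2) :
    inner ℂ (freeGroup t f) g = inner ℂ f (freeGroup (-t) g) := by
  rw [← fourierIso.inner_map_map, fourierIso_freeGroup, inner_fourierGroup,
    ← fourierIso_freeGroup, fourierIso.inner_map_map]

lemma continuous_freeGroup (f : L2) : Continuous fun t => freeGroup t f :=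
  fourierIso.symm.continuous.comp (continuous_fourierGroup _)

/-! ### Oscillatory integrals along rays -/

lemma integrableOn_of_norm_le_one_add_pow {u : ℝ → ℂ} (hu : Continuous u) {B : ℝ}
    (hB : ∀ ρ, 0 < ρ → (1 + ρ) ^ 2 * ‖u ρ‖ ≤ B) : IntegrableOn u (Ioi 0) := by
  have h : Integrable (fun x : ℝ => (1 + ‖x‖) ^ (-(2 : ℝ))) :=
    integrable_one_add_norm (by simp)
  refine Integrable.mono' (h.const_mul B).integrableOn hu.aestronglyMeasurable.restrict ?_
  filter_upwards [ae_restrict_mem measurableSet_Ioi] with ρ hρ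
  have hρ' : (0 : ℝ) < ρ := hρ
  rw [Real.norm_of_nonneg hρ'.le, Real.rpow_neg (by positivity), ← div_eq_mul_inv,
    le_div_iff₀ (by positivity), mul_comm]
  exact_mod_cast hB ρ hρ'

lemma tendsto_zero_of_norm_le_one_add {u : ℝ → ℂ} {B : ℝ}
    (hB : ∀ ρ, 0 < ρ → (1 + ρ) * ‖u ρ‖ ≤ B) : Filter.Tendsto u Filter.atTop (𝓝 0) := by
  have h : Filter.Tendsto (fun ρ : ℝ => B / (1 + ρ)) Filter.atTop (𝓝 0) :=
    Filter.Tendsto.const_div_atTop (Filter.tendsto_atTop_add_const_left _ _ Filter.tendsto_id) B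
  refine squeeze_zero_norm' ?_ h
  filter_upwards [Filter.eventually_gt_atTop 0] with ρ hρ
  rw [le_div_iff₀ (by positivity), mul_comm]
  exact hB ρ hρ

lemma integral_Ioi_deriv_eq_zero {h h' : ℝ → ℂ} (hd : ∀ ρ, HasDerivAt h (h' ρ) ρ)
    (h0 : h 0 = 0) (hi : IntegrableOn h' (Ioi 0)) (hl : Filter.Tendsto h Filter.atTop (𝓝 0)) :
    ∫ ρ in Ioi (0 : ℝ), h' ρ = 0 := by
  rw [integral_Ioi_of_hasDerivAt_of_tendsto (hd 0).continuousAt.continuousWithinAt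
    (fun x _ => hd x) hi hl, h0, sub_zero]

/-- The dispersion relation `√(1 + c²ρ²)`. -/
def dispersion (c ρ : ℝ) : ℝ := Real.sqrt (1 + (c * ρ) ^ 2)

lemma one_le_dispersion (c ρ : ℝ) : 1 ≤ dispersion c ρ := by
  rw [dispersion, Real.one_le_sqrt]
  nlinarith [sq_nonneg (c * ρ)]

lemma dispersion_pos (c ρ : ℝ) : 0 < dispersion c ρ := one_pos.trans_le (one_le_dispersion c ρ)

lemma dispersion_sq (c ρ : ℝ) : dispersion c ρ ^ 2 = 1 + (c * ρ) ^ 2 :=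
  Real.sq_sqrt (by positivity)

lemma mul_le_dispersion (c ρ : ℝ) : c * ρ ≤ dispersion c ρ :=
  Real.le_sqrt_of_sq_le (by linarith)

lemma continuous_dispersion (c : ℝ) : Continuous (dispersion c) := by
  unfold dispersion; fun_prop

lemma hasDerivAt_dispersion (c ρ : ℝ) :
    HasDerivAt (dispersion c) (c ^ 2 * ρ / dispersion c ρ) ρ := by
  have h1 : HasDerivAt (fun ρ : ℝ => 1 + (c * ρ) ^ 2) (2 * (c * ρ) * c) ρ := by
    have := (((hasDerivAt_id ρ).const_mul c).pow 2).const_add 1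
    simpa using this
  have h2 := h1.sqrt (by positivity)
  refine h2.congr_deriv ?_
  rw [dispersion]
  field_simp

section Ray

variable {c η τ : ℝ}

/-- `ρ √(1 + c²ρ²)`. -/
def rayP (c ρ : ℝ) : ℝ := dispersion c ρ * ρ
/-- The derivative of `rayP`. -/
def rayP₁ (c ρ : ℝ) : ℝ := c ^ 2 * ρ / dispersion c ρ * ρ + dispersion c ρ
/-- The second derivative of `rayP`. -/
def rayP₂ (c ρ : ℝ) : ℝ :=
  3 * (c ^ 2 * ρ / dispersion c ρ) - c ^ 2 * ρ * ρ * (c ^ 2 * ρ / dispersion c ρ) / dispersion c ρ ^ 2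
/-- The regularized `ρ⁻²`. -/
def rayK (η ρ : ℝ) : ℝ := (ρ ^ 2 + η ^ 2)⁻¹

lemma hasDerivAt_rayP (c ρ : ℝ) : HasDerivAt (rayP c) (rayP₁ c ρ) ρ := by
  have h : HasDerivAt (rayP c) _ ρ := (hasDerivAt_dispersion c ρ).mul (hasDerivAt_id ρ)
  exact h.congr_deriv (by simp [rayP₁])

lemma hasDerivAt_rayP₁ (c ρ : ℝ) : HasDerivAt (rayP₁ c) (rayP₂ c ρ) ρ := by
  have h0 := hasDerivAt_dispersion c ρ
  have h1 := ((((hasDerivAt_id ρ).const_mul (c ^ 2)).div h0 (dispersion_pos c ρ).ne').mul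
    (hasDerivAt_id ρ)).add h0
  refine h1.congr_deriv ?_
  have := (dispersion_pos c ρ).ne'
  simp only [rayP₂, id, Pi.div_apply]
  field_simp
  ring

lemma hasDerivAt_rayK (hη : 0 < η) (ρ : ℝ) : HasDerivAt (rayK η) (-(2 * ρ * rayK η ρ ^ 2)) ρ := by
  have h1 : HasDerivAt (fun ρ : ℝ => ρ ^ 2 + η ^ 2) (2 * ρ) ρ := by
    simpa using ((hasDerivAt_id ρ).pow 2).add_const (η ^ 2)
  refine (h1.inv (by positivity)).congr_deriv ?_
  simp only [rayK]
  field_simp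

lemma rayK_pos (hη : 0 < η) (ρ : ℝ) : 0 < rayK η ρ := by unfold rayK; positivity

lemma sq_mul_rayK_le_one (hη : 0 < η) (ρ : ℝ) : ρ ^ 2 * rayK η ρ ≤ 1 := by
  unfold rayK
  rw [← div_eq_mul_inv, div_le_one (by positivity)]
  nlinarith [sq_nonneg η]

lemma continuous_rayP (c : ℝ) : Continuous (rayP c) :=
  (continuous_dispersion c).mul continuous_id

lemma continuous_rayP₁ (c : ℝ) : Continuous (rayP₁ c) := by
  have h := continuous_dispersion c
  have h2 := fun ρ => (dispersion_pos c ρ).ne'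
  unfold rayP₁
  fun_prop (disch := assumption)

lemma continuous_rayP₂ (c : ℝ) : Continuous (rayP₂ c) := by
  have h := continuous_dispersion c
  have h2 := fun ρ => (dispersion_pos c ρ).ne'
  have h3 := fun ρ => pow_ne_zero 2 (dispersion_pos c ρ).ne'
  unfold rayP₂
  fun_prop (disch := assumption)

lemma continuous_rayK (hη : 0 < η) : Continuous (rayK η) := by
  unfold rayK
  exact Continuous.inv₀ (by fun_prop) fun ρ => by positivity

lemma dispersion_le (hc : 1 ≤ c) {ρ : ℝ} (hρ : 0 ≤ ρ) : dispersion c ρ ≤ c * (1 + ρ) := by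
  unfold dispersion
  rw [Real.sqrt_le_left (by positivity)]
  nlinarith [mul_nonneg (sq_nonneg c) hρ, mul_nonneg (by linarith : (0:ℝ) ≤ c - 1) (by linarith : (0:ℝ) ≤ c)]

lemma velocity_le (hc : 1 ≤ c) (ρ : ℝ) : c ^ 2 * ρ / dispersion c ρ ≤ c := by
  rw [div_le_iff₀ (dispersion_pos c ρ)]
  nlinarith [mul_le_dispersion c ρ]

lemma velocity_nonneg (hc : 1 ≤ c) {ρ : ℝ} (hρ : 0 ≤ ρ) : 0 ≤ c ^ 2 * ρ / dispersion c ρ := by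
  have := dispersion_pos c ρ
  positivity

lemma abs_rayP_le (hc : 1 ≤ c) {ρ : ℝ} (hρ : 0 ≤ ρ) : |rayP c ρ| ≤ c * (1 + ρ) * ρ := by
  have := dispersion_pos c ρ
  unfold rayP
  rw [abs_of_nonneg (by positivity)]
  gcongr
  exact dispersion_le hc hρ

lemma abs_rayP₁_le (hc : 1 ≤ c) {ρ : ℝ} (hρ : 0 ≤ ρ) : |rayP₁ c ρ| ≤ 2 * c * (1 + ρ) := by
  have h1 := velocity_le hc ρ
  have h2 := velocity_nonneg hc hρ
  have h3 := dispersion_le hc hρ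
  have h4 := dispersion_pos c ρ
  unfold rayP₁
  rw [abs_of_nonneg (by positivity)]
  nlinarith [mul_le_mul_of_nonneg_right h1 hρ]

lemma abs_rayP₂_le (hc : 1 ≤ c) {ρ : ℝ} (hρ : 0 ≤ ρ) : |rayP₂ c ρ| ≤ 4 * c := by
  have h1 := velocity_le hc ρ
  have h2 := velocity_nonneg hc hρ
  have h4 := dispersion_pos c ρ
  unfold rayP₂
  set v := c ^ 2 * ρ / dispersion c ρ with hv
  have h5 : c ^ 2 * ρ * ρ * v / dispersion c ρ ^ 2 ≤ v := by
    rw [div_le_iff₀ (by positivity), mul_comm]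
    gcongr
    rw [dispersion_sq]
    nlinarith
  have h6 : 0 ≤ c ^ 2 * ρ * ρ * v / dispersion c ρ ^ 2 := by positivity
  rw [abs_le]
  constructor <;> linarith

/-- The oscillating factor `e^{iτ√(1 + c²ρ²)}`. -/
def rayE (c τ ρ : ℝ) : ℂ := Complex.exp (Complex.I * ((τ * dispersion c ρ : ℝ) : ℂ))

lemma norm_rayE (c τ ρ : ℝ) : ‖rayE c τ ρ‖ = 1 := by
  rw [rayE, mul_comm]
  exact Complex.norm_exp_ofReal_mul_I _

lemma hasDerivAt_rayE (c τ ρ : ℝ) : HasDerivAt (rayE c τ)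
    (Complex.I * ((τ * (c ^ 2 * ρ / dispersion c ρ) : ℝ) : ℂ) * rayE c τ ρ) ρ := by
  have h := ((((hasDerivAt_dispersion c ρ).const_mul τ).ofReal_comp).const_mul Complex.I).cexp
  refine h.congr_deriv ?_
  rw [mul_comm]
  rfl

lemma continuous_rayE (c τ : ℝ) : Continuous (rayE c τ) := by
  have := continuous_dispersion c
  unfold rayE
  fun_prop

/-- The pointwise majorant in `norm_ray_integral_le`. -/
def rayMajorant (η τ ρ : ℝ) (f f₁ f₂ : ℝ) : ℝ :=
  12 / |τ| * (rayK η ρ * (1 + ρ) ^ 2 * (η ^ 2 * (f + ρ * f₁) + |τ|⁻¹ * (f + ρ * f₁ + ρ ^ 2 * f₂)))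

/-- Two integrations by parts against the phase τω, where ω = √(1+c²ρ²) and ω' = c²ρ/ω. The Jacobian
ρ² makes the first one free of singularities, because ρ² = ω'·(ωρ)/c². The second would divide by
ω', which vanishes at ρ = 0, so it is applied only to the part ρ²/(ρ²+η²) of the integrand; the rest
carries η²/(ρ²+η²) and is left with a single factor 1/|τ|. The decay hypothesis with bound `B` only
ensures integrability and vanishing boundary terms; the estimate itself does not involve `B`. -/
lemma enorm_ray_integral_le (hc : 1 ≤ c) (hη : 0 < η) (hτ : τ ≠ 0) {f f₁ f₂ : ℝ → ℂ}
    (hf : ∀ ρ, HasDerivAt f (f₁ ρ) ρ) (hf₁ : ∀ ρ, HasDerivAt f₁ (f₂ ρ) ρ) (hf₂ : Continuous f₂)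
    {B : ℝ} (hB : ∀ ρ, 0 < ρ → (1 + ρ) ^ 6 * (‖f ρ‖ + ‖f₁ ρ‖ + ‖f₂ ρ‖) ≤ B) :
    IntegrableOn (fun ρ => rayE c τ ρ * f ρ * ((ρ ^ 2 : ℝ) : ℂ)) (Ioi 0) ∧
    ‖∫ ρ in Ioi (0 : ℝ), rayE c τ ρ * f ρ * ((ρ ^ 2 : ℝ) : ℂ)‖ₑ ≤
      ∫⁻ ρ in Ioi (0 : ℝ), ENNReal.ofReal (rayMajorant η τ ρ ‖f ρ‖ ‖f₁ ρ‖ ‖f₂ ρ‖) := by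
  have cf : Continuous f := continuous_iff_continuousAt.2 fun ρ => (hf ρ).continuousAt
  have cf₁ : Continuous f₁ := continuous_iff_continuousAt.2 fun ρ => (hf₁ ρ).continuousAt
  have cP := continuous_rayP c
  have cP₁ := continuous_rayP₁ c
  have cP₂ := continuous_rayP₂ c
  have cK := continuous_rayK hη
  have cE := continuous_rayE c τ
  -- `g` is the derivative of ωρf, the amplitude left by the first integration by parts, and `g₁` is
  -- its derivative.
  set g : ℝ → ℂ := fun ρ => (rayP₁ c ρ : ℂ) * f ρ + (rayP c ρ : ℂ) * f₁ ρ with hg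
  set g₁ : ℝ → ℂ := fun ρ => (rayP₂ c ρ : ℂ) * f ρ + 2 * (rayP₁ c ρ : ℂ) * f₁ ρ
    + (rayP c ρ : ℂ) * f₂ ρ with hg₁
  have cg : Continuous g := by fun_prop
  have cg₁ : Continuous g₁ := by fun_prop
  have dg : ∀ ρ, HasDerivAt g (g₁ ρ) ρ := fun ρ => by
    refine (((hasDerivAt_rayP₁ c ρ).ofReal_comp.mul (hf ρ)).add
      ((hasDerivAt_rayP c ρ).ofReal_comp.mul (hf₁ ρ))).congr_deriv ?_
    simp only [hg₁]; ring
  -- Chosen so that ω'R = c²ρ²/(ρ²+η²): the regularization cancels the zero of ω'.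
  set R : ℝ → ℝ := fun ρ => rayP c ρ * rayK η ρ with hR
  set R₁ : ℝ → ℝ := fun ρ => rayP₁ c ρ * rayK η ρ + rayP c ρ * -(2 * ρ * rayK η ρ ^ 2) with hR₁
  have cR : Continuous R := by fun_prop
  have cR₁ : Continuous R₁ := by fun_prop
  have dR : ∀ ρ, HasDerivAt R (R₁ ρ) ρ := fun ρ =>
    (hasDerivAt_rayP c ρ).mul (hasDerivAt_rayK hη ρ)
  have hE : ∀ ρ, HasDerivAt (rayE c τ)
    (Complex.I * ((τ * (c ^ 2 * ρ / dispersion c ρ) : ℝ) : ℂ) * rayE c τ ρ) ρ :=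
    hasDerivAt_rayE c τ
  -- bounds
  have bg : ∀ ρ, 0 < ρ → ‖g ρ‖ ≤ 2 * c * (1 + ρ) * (‖f ρ‖ + ρ * ‖f₁ ρ‖) := fun ρ hρ => by
    have h1 := abs_rayP_le hc hρ.le
    have h2 := abs_rayP₁_le hc hρ.le
    calc ‖g ρ‖ ≤ |rayP₁ c ρ| * ‖f ρ‖ + |rayP c ρ| * ‖f₁ ρ‖ := by
          refine (norm_add_le _ _).trans_eq ?_
          simp only [norm_mul, Complex.norm_real, Real.norm_eq_abs]
      _ ≤ 2 * c * (1 + ρ) * ‖f ρ‖ + c * (1 + ρ) * ρ * ‖f₁ ρ‖ := by gcongr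
      _ ≤ _ := by
          have : 0 ≤ c * (1 + ρ) * ρ * ‖f₁ ρ‖ := by positivity
          nlinarith
  have bg₁ : ∀ ρ, 0 < ρ → ‖g₁ ρ‖ ≤
      4 * c * ‖f ρ‖ + 4 * c * (1 + ρ) * ‖f₁ ρ‖ + c * (1 + ρ) * ρ * ‖f₂ ρ‖ := fun ρ hρ => by
    have h1 := abs_rayP_le hc hρ.le
    have h2 := abs_rayP₁_le hc hρ.le
    have h3 := abs_rayP₂_le hc hρ.le
    calc ‖g₁ ρ‖ ≤ |rayP₂ c ρ| * ‖f ρ‖ + 2 * |rayP₁ c ρ| * ‖f₁ ρ‖ + |rayP c ρ| * ‖f₂ ρ‖ := by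
          refine (norm_add₃_le).trans_eq ?_
          simp only [norm_mul, Complex.norm_real, Real.norm_eq_abs, Complex.norm_ofNat]
      _ ≤ 4 * c * ‖f ρ‖ + 2 * (2 * c * (1 + ρ)) * ‖f₁ ρ‖ + c * (1 + ρ) * ρ * ‖f₂ ρ‖ := by gcongr
      _ = _ := by ring
  have bR : ∀ ρ, 0 < ρ → |R ρ| ≤ c * (1 + ρ) * ρ * rayK η ρ := fun ρ hρ => by
    rw [hR, abs_mul, abs_of_pos (rayK_pos hη ρ)]
    gcongr
    · exact (rayK_pos hη ρ).le
    · exact abs_rayP_le hc hρ.le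
  have bR₁ : ∀ ρ, 0 < ρ → |R₁ ρ| ≤ 4 * c * (1 + ρ) * rayK η ρ := fun ρ hρ => by
    have h1 := abs_rayP_le hc hρ.le
    have h2 := abs_rayP₁_le hc hρ.le
    have h3 := sq_mul_rayK_le_one hη ρ
    have h4 := rayK_pos hη ρ
    calc |R₁ ρ| ≤ |rayP₁ c ρ| * rayK η ρ + |rayP c ρ| * (2 * ρ * rayK η ρ ^ 2) := by
          refine (abs_add_le _ _).trans_eq ?_
          rw [abs_mul, abs_mul, abs_neg, abs_of_pos h4,
            abs_of_nonneg (by positivity : 0 ≤ 2 * ρ * rayK η ρ ^ 2)]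
      _ ≤ 2 * c * (1 + ρ) * rayK η ρ + c * (1 + ρ) * ρ * (2 * ρ * rayK η ρ ^ 2) := by gcongr
      _ = 2 * c * (1 + ρ) * rayK η ρ + 2 * c * (1 + ρ) * rayK η ρ * (ρ ^ 2 * rayK η ρ) := by ring
      _ ≤ 2 * c * (1 + ρ) * rayK η ρ + 2 * c * (1 + ρ) * rayK η ρ * 1 := by gcongr
      _ = _ := by ring
  have bRg : ∀ ρ, 0 < ρ → ‖(R₁ ρ : ℂ) * g ρ + (R ρ : ℂ) * g₁ ρ‖ ≤
      12 * c ^ 2 * (rayK η ρ * (1 + ρ) ^ 2 * (‖f ρ‖ + ρ * ‖f₁ ρ‖ + ρ ^ 2 * ‖f₂ ρ‖)) := fun ρ hρ => by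
    have h4 := rayK_pos hη ρ
    calc ‖(R₁ ρ : ℂ) * g ρ + (R ρ : ℂ) * g₁ ρ‖ ≤ |R₁ ρ| * ‖g ρ‖ + |R ρ| * ‖g₁ ρ‖ := by
          refine (norm_add_le _ _).trans_eq ?_
          simp only [norm_mul, Complex.norm_real, Real.norm_eq_abs]
      _ ≤ (4 * c * (1 + ρ) * rayK η ρ) * (2 * c * (1 + ρ) * (‖f ρ‖ + ρ * ‖f₁ ρ‖))
          + (c * (1 + ρ) * ρ * rayK η ρ) *
            (4 * c * ‖f ρ‖ + 4 * c * (1 + ρ) * ‖f₁ ρ‖ + c * (1 + ρ) * ρ * ‖f₂ ρ‖) := by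
          gcongr
          · exact bR₁ ρ hρ
          · exact bg ρ hρ
          · exact bR ρ hρ
          · exact bg₁ ρ hρ
      _ = c ^ 2 * (rayK η ρ * (1 + ρ)) * (8 * (1 + ρ) * (‖f ρ‖ + ρ * ‖f₁ ρ‖) +
          (4 * ρ * ‖f ρ‖ + 4 * (1 + ρ) * (ρ * ‖f₁ ρ‖) + (1 + ρ) * (ρ ^ 2 * ‖f₂ ρ‖))) := by ring
      _ ≤ c ^ 2 * (rayK η ρ * (1 + ρ)) *
          (12 * (1 + ρ) * (‖f ρ‖ + ρ * ‖f₁ ρ‖ + ρ ^ 2 * ‖f₂ ρ‖)) := by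
          gcongr
          have h5 := norm_nonneg (f ρ)
          have h6 : 0 ≤ (1 + ρ) * (ρ ^ 2 * ‖f₂ ρ‖) := by positivity
          nlinarith
      _ = _ := by ring
  have hK : ∀ ρ, rayK η ρ ≤ (η ^ 2)⁻¹ := fun ρ => by
    unfold rayK
    gcongr
    nlinarith [sq_nonneg ρ]
  have hsum : ∀ ρ, 0 < ρ → ‖f ρ‖ + ρ * ‖f₁ ρ‖ + ρ ^ 2 * ‖f₂ ρ‖ ≤
      (1 + ρ) ^ 2 * (‖f ρ‖ + ‖f₁ ρ‖ + ‖f₂ ρ‖) := fun ρ hρ => by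
    have h1 : 1 ≤ (1 + ρ) ^ 2 := by nlinarith
    have h2 : ρ ≤ (1 + ρ) ^ 2 := by nlinarith
    have h3 : ρ ^ 2 ≤ (1 + ρ) ^ 2 := by nlinarith
    have := norm_nonneg (f ρ)
    calc _ ≤ (1 + ρ) ^ 2 * ‖f ρ‖ + (1 + ρ) ^ 2 * ‖f₁ ρ‖ + (1 + ρ) ^ 2 * ‖f₂ ρ‖ := by
          gcongr
          nlinarith
      _ = _ := by ring
  have hsum₁ : ∀ ρ, 0 < ρ → ‖f ρ‖ + ρ * ‖f₁ ρ‖ ≤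
      (1 + ρ) ^ 2 * (‖f ρ‖ + ‖f₁ ρ‖ + ‖f₂ ρ‖) := fun ρ hρ =>
    le_trans (le_add_of_nonneg_right (by positivity)) (hsum ρ hρ)
  have bg' : ∀ ρ, 0 < ρ → (1 + ρ) ^ 3 * ‖g ρ‖ ≤ 2 * c * B := fun ρ hρ => by
    calc (1 + ρ) ^ 3 * ‖g ρ‖ ≤ (1 + ρ) ^ 3 * (2 * c * (1 + ρ) *
          ((1 + ρ) ^ 2 * (‖f ρ‖ + ‖f₁ ρ‖ + ‖f₂ ρ‖))) := by
          gcongr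
          refine (bg ρ hρ).trans ?_
          gcongr
          exact hsum₁ ρ hρ
      _ = 2 * c * ((1 + ρ) ^ 6 * (‖f ρ‖ + ‖f₁ ρ‖ + ‖f₂ ρ‖)) := by ring
      _ ≤ 2 * c * B := by gcongr; exact hB ρ hρ
  have bf' : ∀ ρ, 0 < ρ → (1 + ρ) ^ 6 * ‖f ρ‖ ≤ B := fun ρ hρ => by
    refine le_trans ?_ (hB ρ hρ)
    gcongr
    have := norm_nonneg (f₁ ρ)
    have := norm_nonneg (f₂ ρ)
    linarith
  have hpow : ∀ {ρ : ℝ}, 0 < ρ → ∀ {m n : ℕ}, m ≤ n → (1 + ρ) ^ m ≤ (1 + ρ) ^ n :=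
    fun hρ _ _ hmn => pow_le_pow_right₀ (by linarith) hmn
  -- integrability
  have i₁ : IntegrableOn (fun ρ => rayE c τ ρ * f ρ * ((ρ ^ 2 : ℝ) : ℂ)) (Ioi 0) := by
    refine integrableOn_of_norm_le_one_add_pow (by fun_prop) (B := B) fun ρ hρ => ?_
    rw [norm_mul, norm_mul, norm_rayE, one_mul, Complex.norm_real, Real.norm_of_nonneg (by positivity)]
    calc (1 + ρ) ^ 2 * (‖f ρ‖ * ρ ^ 2) ≤ (1 + ρ) ^ 2 * (‖f ρ‖ * (1 + ρ) ^ 2) := by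
          gcongr; linarith
      _ = (1 + ρ) ^ 4 * ‖f ρ‖ := by ring
      _ ≤ (1 + ρ) ^ 6 * ‖f ρ‖ := by
          gcongr ?_ * _
          exact hpow hρ (by norm_num)
      _ ≤ B := bf' ρ hρ
  have i₂ : IntegrableOn (fun ρ => rayE c τ ρ * g ρ) (Ioi 0) := by
    refine integrableOn_of_norm_le_one_add_pow (by fun_prop) (B := 2 * c * B) fun ρ hρ => ?_
    rw [norm_mul, norm_rayE, one_mul]
    refine le_trans ?_ (bg' ρ hρ)
    gcongr ?_ * _
    exact hpow hρ (by norm_num)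
  have i₃ : IntegrableOn (fun ρ => rayE c τ ρ * (((ρ ^ 2 * rayK η ρ : ℝ) : ℂ) * g ρ)) (Ioi 0) := by
    refine Integrable.mono i₂ (by fun_prop) (Filter.Eventually.of_forall fun ρ => ?_)
    rw [norm_mul, norm_mul, norm_mul, Complex.norm_real,
      Real.norm_of_nonneg (mul_nonneg (sq_nonneg ρ) (rayK_pos hη ρ).le)]
    gcongr
    exact mul_le_of_le_one_left (norm_nonneg _) (sq_mul_rayK_le_one hη ρ)
  have i₄ : IntegrableOn (fun ρ => rayE c τ ρ * ((R₁ ρ : ℂ) * g ρ + (R ρ : ℂ) * g₁ ρ)) (Ioi 0) := by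
    refine integrableOn_of_norm_le_one_add_pow (by fun_prop) (B := 12 * c ^ 2 * ((η ^ 2)⁻¹ * B))
      fun ρ hρ => ?_
    rw [norm_mul, norm_rayE, one_mul]
    calc (1 + ρ) ^ 2 * ‖(R₁ ρ : ℂ) * g ρ + (R ρ : ℂ) * g₁ ρ‖
        ≤ (1 + ρ) ^ 2 * (12 * c ^ 2 * ((η ^ 2)⁻¹ * (1 + ρ) ^ 2 *
          ((1 + ρ) ^ 2 * (‖f ρ‖ + ‖f₁ ρ‖ + ‖f₂ ρ‖)))) := by
          gcongr
          refine (bRg ρ hρ).trans ?_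
          gcongr
          · exact hK ρ
          · exact hsum ρ hρ
      _ = 12 * c ^ 2 * ((η ^ 2)⁻¹ * ((1 + ρ) ^ 6 * (‖f ρ‖ + ‖f₁ ρ‖ + ‖f₂ ρ‖))) := by ring
      _ ≤ _ := by gcongr; exact hB ρ hρ
  -- first integration by parts
  have e₁ : (Complex.I * τ * c ^ 2) * (∫ ρ in Ioi (0 : ℝ), rayE c τ ρ * f ρ * ((ρ ^ 2 : ℝ) : ℂ))
      + ∫ ρ in Ioi (0 : ℝ), rayE c τ ρ * g ρ = 0 := by
    rw [← integral_const_mul, ← integral_add (i₁.const_mul _) i₂]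
    refine integral_Ioi_deriv_eq_zero (h := fun ρ => rayE c τ ρ * ((rayP c ρ : ℂ) * f ρ))
      (fun ρ => ?_) (by simp [rayP]) ((i₁.const_mul _).add i₂) ?_
    · refine ((hE ρ).mul (((hasDerivAt_rayP c ρ).ofReal_comp).mul (hf ρ))).congr_deriv ?_
      have hd : (dispersion c ρ : ℂ) ≠ 0 := by exact_mod_cast (dispersion_pos c ρ).ne'
      simp only [hg, rayP, Pi.mul_apply]
      push_cast
      field_simp
    · refine tendsto_zero_of_norm_le_one_add (B := c * B) fun ρ hρ => ?_
      rw [norm_mul, norm_rayE, one_mul, norm_mul, Complex.norm_real, Real.norm_eq_abs]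
      calc (1 + ρ) * (|rayP c ρ| * ‖f ρ‖) ≤ (1 + ρ) * (c * (1 + ρ) * (1 + ρ) * ‖f ρ‖) := by
            gcongr
            refine (abs_rayP_le hc hρ.le).trans ?_
            gcongr
            linarith
        _ = c * ((1 + ρ) ^ 3 * ‖f ρ‖) := by ring
        _ ≤ c * ((1 + ρ) ^ 6 * ‖f ρ‖) := by
            gcongr c * (?_ * _)
            exact hpow hρ (by norm_num)
        _ ≤ c * B := by gcongr; exact bf' ρ hρ
  -- Second integration by parts, restricted to the part of `g` that carries the factor ρ²/(ρ²+η²).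
  have e₂ : (Complex.I * τ * c ^ 2) *
        (∫ ρ in Ioi (0 : ℝ), rayE c τ ρ * (((ρ ^ 2 * rayK η ρ : ℝ) : ℂ) * g ρ))
      + ∫ ρ in Ioi (0 : ℝ), rayE c τ ρ * ((R₁ ρ : ℂ) * g ρ + (R ρ : ℂ) * g₁ ρ) = 0 := by
    rw [← integral_const_mul, ← integral_add (i₃.const_mul _) i₄]
    refine integral_Ioi_deriv_eq_zero (h := fun ρ => rayE c τ ρ * ((R ρ : ℂ) * g ρ))
      (fun ρ => ?_) (by simp [hR, rayP]) ((i₃.const_mul _).add i₄) ?_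
    · refine ((hE ρ).mul (((dR ρ).ofReal_comp).mul (dg ρ))).congr_deriv ?_
      have hd : (dispersion c ρ : ℂ) ≠ 0 := by exact_mod_cast (dispersion_pos c ρ).ne'
      simp only [hR, rayP, Pi.mul_apply]
      push_cast
      field_simp
    · refine tendsto_zero_of_norm_le_one_add (B := c * (η ^ 2)⁻¹ * (2 * c * B)) fun ρ hρ => ?_
      rw [norm_mul, norm_rayE, one_mul, norm_mul, Complex.norm_real, Real.norm_eq_abs]
      calc (1 + ρ) * (|R ρ| * ‖g ρ‖) ≤ (1 + ρ) * (c * (1 + ρ) * (1 + ρ) * (η ^ 2)⁻¹ * ‖g ρ‖) := by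
            gcongr
            refine (bR ρ hρ).trans ?_
            gcongr
            · exact (rayK_pos hη ρ).le
            · linarith
            · exact hK ρ
        _ = c * (η ^ 2)⁻¹ * ((1 + ρ) ^ 3 * ‖g ρ‖) := by ring
        _ ≤ _ := mul_le_mul_of_nonneg_left (bg' ρ hρ) (by positivity)
  set z : ℂ := Complex.I * τ * c ^ 2 with hz
  have hz0 : z ≠ 0 := by
    have : (c : ℂ) ≠ 0 := by exact_mod_cast (by linarith : c ≠ 0)
    have : (τ : ℂ) ≠ 0 := by exact_mod_cast hτ
    simp [*]
  have hzn : ‖z‖ = |τ| * c ^ 2 := by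
    simp [hz]
  -- Everything is put under one integral before norms are taken, so that the bound holds pointwise
  -- in ρ and can be integrated over the sphere.
  have key : ∫ ρ in Ioi (0 : ℝ), rayE c τ ρ * f ρ * ((ρ ^ 2 : ℝ) : ℂ) =
      ∫ ρ in Ioi (0 : ℝ), (-z⁻¹) * ((rayE c τ ρ * g ρ -
        rayE c τ ρ * (((ρ ^ 2 * rayK η ρ : ℝ) : ℂ) * g ρ)) -
        z⁻¹ * (rayE c τ ρ * ((R₁ ρ : ℂ) * g ρ + (R ρ : ℂ) * g₁ ρ))) := by
    have h₂₃ : IntegrableOn (fun ρ => rayE c τ ρ * g ρ -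
        rayE c τ ρ * (((ρ ^ 2 * rayK η ρ : ℝ) : ℂ) * g ρ)) (Ioi 0) := i₂.sub i₃
    rw [integral_const_mul, integral_sub h₂₃ (i₄.const_mul _), integral_sub i₂ i₃,
      integral_const_mul]
    rw [eq_neg_of_add_eq_zero_right e₁, eq_neg_of_add_eq_zero_right e₂]
    field_simp
    ring
  refine ⟨i₁, ?_⟩
  rw [key]
  refine (enorm_integral_le_lintegral_enorm _).trans (setLIntegral_mono' measurableSet_Ioi ?_)
  intro ρ hρ'
  have hρ : 0 < ρ := hρ'
  rw [← ofReal_norm]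
  refine ENNReal.ofReal_le_ofReal ?_
  have h4 := rayK_pos hη ρ
  have h7 : (1 : ℂ) - ((ρ ^ 2 * rayK η ρ : ℝ) : ℂ) = ((η ^ 2 * rayK η ρ : ℝ) : ℂ) := by
    rw [← Complex.ofReal_one, ← Complex.ofReal_sub]
    congr 1
    unfold rayK
    field_simp
    ring
  have h8 : rayE c τ ρ * g ρ - rayE c τ ρ * (((ρ ^ 2 * rayK η ρ : ℝ) : ℂ) * g ρ)
      = rayE c τ ρ * (((η ^ 2 * rayK η ρ : ℝ) : ℂ) * g ρ) := by
    rw [← h7]; ring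
  rw [h8, norm_mul, norm_neg, norm_inv, hzn]
  have hτ' : 0 < |τ| := abs_pos.2 hτ
  have hc2 : c ≤ c ^ 2 := by nlinarith
  calc (|τ| * c ^ 2)⁻¹ * ‖rayE c τ ρ * (((η ^ 2 * rayK η ρ : ℝ) : ℂ) * g ρ)
        - z⁻¹ * (rayE c τ ρ * ((R₁ ρ : ℂ) * g ρ + (R ρ : ℂ) * g₁ ρ))‖
      ≤ (|τ| * c ^ 2)⁻¹ * (η ^ 2 * rayK η ρ * ‖g ρ‖ +
        (|τ| * c ^ 2)⁻¹ * ‖(R₁ ρ : ℂ) * g ρ + (R ρ : ℂ) * g₁ ρ‖) := by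
        gcongr
        refine (norm_sub_le _ _).trans_eq ?_
        rw [norm_mul, norm_mul, norm_mul, norm_mul, norm_rayE, norm_inv, hzn, Complex.norm_real,
          Real.norm_of_nonneg (by positivity), one_mul, one_mul]
    -- The bounds on `g` and its derivative contribute c²; the outer factor 1/c² cancels it, and the
    -- inner one is discarded using c ≥ 1. The final majorant is free of c.
    _ ≤ (|τ| * c ^ 2)⁻¹ * (η ^ 2 * rayK η ρ * (12 * c ^ 2 * (1 + ρ) ^ 2 * (‖f ρ‖ + ρ * ‖f₁ ρ‖)) +
        (|τ| * 1)⁻¹ * (12 * c ^ 2 *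
          (rayK η ρ * (1 + ρ) ^ 2 * (‖f ρ‖ + ρ * ‖f₁ ρ‖ + ρ ^ 2 * ‖f₂ ρ‖)))) := by
        gcongr
        · refine (bg ρ hρ).trans ?_
          gcongr ?_ * _
          nlinarith [mul_nonneg hρ.le (by linarith : (0:ℝ) ≤ c), mul_nonneg hρ.le (sq_nonneg c)]
        · nlinarith
        · exact bRg ρ hρ
    _ = rayMajorant η τ ρ ‖f ρ‖ ‖f₁ ρ‖ ‖f₂ ρ‖ := by
        unfold rayMajorant
        field_simp

end Ray

/-! ### Spectral decomposition of the Dirac symbol -/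

/-- The Clifford relations, checked entry by entry: distinct Dirac matrices anticommute and each
squares to 1, so only the diagonal terms survive in the square. -/
lemma diracSymbol_matrix_sq (x : Fin 3 → ℂ) :
    (∑ k, x k • alphaMatrix k + betaMatrix) * (∑ k, x k • alphaMatrix k + betaMatrix)
      = (1 + ∑ k, x k ^ 2) • (1 : Matrix (Fin 4) (Fin 4) ℂ) := by
  have hI : Complex.I ^ 2 = -1 := Complex.I_sq
  ext i j
  fin_cases i <;> fin_cases j <;>
    simp [alphaMatrix, betaMatrix, pauli, finSumFinEquiv, Fin.addCases, Matrix.fromBlocks,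
      Matrix.mul_apply, Fin.sum_univ_succ, Matrix.diagonal] <;>
    ring_nf <;> simp only [hI] <;> ring

lemma diracSymbol_eq_toEuclideanCLM (ξ : E3) : diracSymbol ξ =
    Matrix.toEuclideanCLM (𝕜 := ℂ) (n := Fin 4)
      (∑ k : Fin 3, ((2 * Real.pi * ξ k : ℝ) : ℂ) • alphaMatrix k + betaMatrix) := by
  simp [diracSymbol, alpha, beta, map_sum]

lemma diracSymbol_sq_apply (ξ : E3) (v : E4) : diracSymbol ξ (diracSymbol ξ v) =
    ((dispersion (2 * Real.pi) ‖ξ‖ ^ 2 : ℝ) : ℂ) • v := by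
  have h : diracSymbol ξ * diracSymbol ξ =
      ((dispersion (2 * Real.pi) ‖ξ‖ ^ 2 : ℝ) : ℂ) • (1 : E4 →L[ℂ] E4) := by
    rw [diracSymbol_eq_toEuclideanCLM, ← map_mul, diracSymbol_matrix_sq, map_smul, map_one]
    congr 1
    rw [dispersion_sq, mul_pow, EuclideanSpace.norm_sq_eq]
    push_cast
    rw [Finset.mul_sum]
    congr 1
    refine Finset.sum_congr rfl fun k _ => ?_
    rw [← Complex.ofReal_pow ‖ξ.ofLp k‖, Real.norm_eq_abs, sq_abs]
    push_cast
    ring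
  exact DFunLike.congr_fun h v

/-- `diracSymbol` on a ray, divided by the dispersion relation. -/
def rayJ (θ : E3) (ρ : ℝ) : E4 →L[ℂ] E4 :=
  (((dispersion (2 * Real.pi) ρ)⁻¹ : ℝ) : ℂ) • diracSymbol (ρ • θ)

/-- The spectral projections `(1 ± J) / 2`, `ε = ± 1`. -/
def rayProj (ε : ℝ) (θ : E3) (ρ : ℝ) : E4 →L[ℂ] E4 :=
  (2⁻¹ : ℂ) • (ContinuousLinearMap.id ℂ E4 + (ε : ℂ) • rayJ θ ρ)

/-- The symbol commutes with its exponential. Having it on the right lets it act first on an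
eigenvector. -/
lemma hasDerivAt_diracExp' (t : ℝ) (ξ : E3) :
    HasDerivAt (fun τ : ℝ => diracExp τ ξ) (diracExp t ξ * (Complex.I • diracSymbol ξ)) t := by
  refine (hasDerivAt_diracExp t ξ).congr_deriv ?_
  have : Commute (Complex.I • diracSymbol ξ) (diracExp t ξ) := by
    unfold diracExp
    refine Commute.exp_right ?_
    exact ((Commute.refl (diracSymbol ξ)).smul_left _).smul_right _
  exact this

/-- The curve e^{-iτl}e^{iτA}v has zero derivative when Av = lv, hence is constant. -/
lemma diracExp_apply_of_eigen {ξ : E3} {v : E4} {l : ℝ} (hv : diracSymbol ξ v = (l : ℂ) • v)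
    (t : ℝ) : diracExp t ξ v = Complex.exp (Complex.I * ((t * l : ℝ) : ℂ)) • v := by
  have hd : ∀ τ : ℝ, HasDerivAt (fun τ : ℝ => Complex.exp (-(Complex.I * ((τ * l : ℝ) : ℂ))) •
      diracExp τ ξ v) 0 τ := fun τ => by
    have h1 : HasDerivAt (fun τ : ℝ => diracExp τ ξ v)
        ((Complex.I * l) • diracExp τ ξ v) τ := by
      have h := ((ContinuousLinearMap.apply ℂ E4 v).restrictScalars ℝ).hasFDerivAt.comp_hasDerivAt τ
        (hasDerivAt_diracExp' τ ξ)
      refine h.congr_deriv ?_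
      simp [hv, mul_smul]
    have h2 : HasDerivAt (fun τ : ℝ => Complex.exp (-(Complex.I * ((τ * l : ℝ) : ℂ))))
        (Complex.exp (-(Complex.I * ((τ * l : ℝ) : ℂ))) * -(Complex.I * (l : ℂ))) τ := by
      refine HasDerivAt.cexp ?_
      have h : HasDerivAt (fun τ : ℝ => -(Complex.I * ((τ * l : ℝ) : ℂ))) _ τ :=
        (((hasDerivAt_id τ).mul_const l).ofReal_comp.const_mul Complex.I).neg
      exact h.congr_deriv (by simp)
    refine (h2.smul h1).congr_deriv ?_
    rw [smul_smul, ← add_smul]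
    convert zero_smul ℂ _ using 2
    ring
  have hc := is_const_of_deriv_eq_zero (fun τ => (hd τ).differentiableAt)
    (fun τ => (hd τ).deriv) t 0
  simp only [zero_mul, Complex.ofReal_zero, mul_zero, neg_zero, Complex.exp_zero, one_smul,
    diracExp_zero, one_apply_eq_self] at hc
  conv_rhs => rw [← hc]
  rw [smul_smul, ← Complex.exp_add, add_neg_cancel, Complex.exp_zero, one_smul]

lemma rayJ_sq {θ : E3} (hθ : ‖θ‖ = 1) {ρ : ℝ} (hρ : 0 ≤ ρ) (v : E4) :
    rayJ θ ρ (rayJ θ ρ v) = v := by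
  have hn : ‖ρ • θ‖ = ρ := by rw [norm_smul, hθ, mul_one, Real.norm_of_nonneg hρ]
  have hd : (dispersion (2 * Real.pi) ρ : ℂ) ≠ 0 := by
    exact_mod_cast (dispersion_pos (2 * Real.pi) ρ).ne'
  simp only [rayJ, smul_apply, map_smul, diracSymbol_sq_apply, hn, smul_smul]
  convert one_smul ℂ v
  push_cast
  field_simp

lemma diracSymbol_eq_rayJ (θ : E3) (ρ : ℝ) (v : E4) :
    diracSymbol (ρ • θ) v = (dispersion (2 * Real.pi) ρ : ℂ) • rayJ θ ρ v := by
  have hd : (dispersion (2 * Real.pi) ρ : ℂ) ≠ 0 := by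
    exact_mod_cast (dispersion_pos (2 * Real.pi) ρ).ne'
  simp only [rayJ, smul_apply, smul_smul]
  push_cast
  rw [mul_inv_cancel₀ hd, one_smul]

/-- The normalized symbol J satisfies J² = 1, so (1 ± J)/2 map into its ±1-eigenspaces. On those the
symbol is multiplication by ±ω, and the matrix exponential reduces to two scalar phases. -/
lemma diracExp_ray {θ : E3} (hθ : ‖θ‖ = 1) {ρ : ℝ} (hρ : 0 ≤ ρ) (t : ℝ) (v : E4) :
    diracExp t (ρ • θ) v = rayE (2 * Real.pi) t ρ • rayProj 1 θ ρ v
      + rayE (2 * Real.pi) (-t) ρ • rayProj (-1) θ ρ v := by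
  have h1 : ∀ ε : ℝ, ε ^ 2 = 1 → diracSymbol (ρ • θ) (rayProj ε θ ρ v) =
      ((ε * dispersion (2 * Real.pi) ρ : ℝ) : ℂ) • rayProj ε θ ρ v := fun ε hε => by
    have hε' : (ε : ℂ) * ε = 1 := by rw [← sq]; exact_mod_cast hε
    rw [diracSymbol_eq_rayJ]
    simp only [rayProj, smul_apply, add_apply, map_smul,
      map_add, rayJ_sq hθ hρ, ContinuousLinearMap.id_apply]
    push_cast
    simp only [smul_add, smul_smul]
    rw [add_comm]
    congr 2
    · ring
    · linear_combination (-(dispersion (2 * Real.pi) ρ : ℂ) * 2⁻¹) * hε'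
  have hv : v = rayProj 1 θ ρ v + rayProj (-1) θ ρ v := by
    simp only [rayProj, smul_apply, add_apply,
      ContinuousLinearMap.id_apply, Complex.ofReal_one, Complex.ofReal_neg]
    module
  conv_lhs => rw [hv]
  rw [map_add, diracExp_apply_of_eigen (h1 1 (by norm_num)),
    diracExp_apply_of_eigen (h1 (-1) (by norm_num))]
  simp only [rayE]
  congr 4
  · simp
  · simp

/-- A bound for the Dirac symbol without mass on the unit sphere, and for `β`. -/
lemma exists_norm_diracSymbol_le : ∃ C : ℝ, 0 ≤ C ∧ ‖beta‖ ≤ C ∧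
    ∀ θ : E3, ‖θ‖ = 1 → ‖diracSymbol θ - beta‖ ≤ C := by
  obtain ⟨C, hC⟩ := (isCompact_sphere (0 : E3) 1).exists_bound_of_continuousOn
    (f := fun θ => diracSymbol θ - beta) (by
      have := continuous_diracSymbol
      fun_prop)
  refine ⟨max ‖beta‖ C, (norm_nonneg _).trans (le_max_left _ _), le_max_left _ _, fun θ hθ => ?_⟩
  exact (hC θ (by simpa using hθ)).trans (le_max_right _ _)

lemma diracSymbol_smul (ρ : ℝ) (θ : E3) :
    diracSymbol (ρ • θ) = (ρ : ℂ) • (diracSymbol θ - beta) + beta := by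
  simp only [diracSymbol, add_sub_cancel_right, Finset.smul_sum, smul_smul]
  congr 1
  refine Finset.sum_congr rfl fun k _ => ?_
  congr 1
  simp
  ring

/-! ### Amplitudes on rays -/

/-- `ρ / √(1 + c²ρ²)` and its first two derivatives. -/
lemma hasDerivAt_inv_dispersion (c ρ : ℝ) :
    HasDerivAt (fun ρ => (dispersion c ρ)⁻¹) (-(c ^ 2 * ρ) / dispersion c ρ ^ 3) ρ := by
  refine ((hasDerivAt_dispersion c ρ).inv (dispersion_pos c ρ).ne').congr_deriv ?_
  have := (dispersion_pos c ρ).ne'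
  field_simp

lemma hasDerivAt_inv_dispersion_pow (c ρ : ℝ) :
    HasDerivAt (fun ρ => (dispersion c ρ ^ 3)⁻¹) (-(3 * c ^ 2 * ρ) / dispersion c ρ ^ 5) ρ := by
  refine (((hasDerivAt_dispersion c ρ).pow 3).inv (pow_ne_zero _ (dispersion_pos c ρ).ne')).congr_deriv ?_
  have := (dispersion_pos c ρ).ne'
  simp only [Pi.pow_apply]
  field_simp
  ring

lemma hasDerivAt_mul_inv_dispersion (c ρ : ℝ) :
    HasDerivAt (fun ρ => ρ * (dispersion c ρ)⁻¹) ((dispersion c ρ ^ 3)⁻¹) ρ := by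
  refine ((hasDerivAt_id ρ).mul (hasDerivAt_inv_dispersion c ρ)).congr_deriv ?_
  have h := (dispersion_pos c ρ).ne'
  have h2 := dispersion_sq c ρ
  simp only [id]
  field_simp
  linear_combination h2

lemma hasDerivAt_deriv_inv_dispersion (c ρ : ℝ) :
    HasDerivAt (fun ρ => -(c ^ 2 * ρ) / dispersion c ρ ^ 3)
      (-c ^ 2 / dispersion c ρ ^ 3 + 3 * c ^ 4 * ρ ^ 2 / dispersion c ρ ^ 5) ρ := by
  have h : HasDerivAt (fun ρ => -(c ^ 2 * ρ) * (dispersion c ρ ^ 3)⁻¹) _ ρ :=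
    (((hasDerivAt_id ρ).const_mul (c ^ 2)).neg).mul (hasDerivAt_inv_dispersion_pow c ρ)
  simp only [← div_eq_mul_inv] at h
  refine h.congr_deriv ?_
  have := (dispersion_pos c ρ).ne'
  simp
  field_simp

section Amplitude

variable {a b : ℝ → E4} {a₁ b₁ : ℝ → E4} {a₂ b₂ : ℝ → E4}

lemma hasDerivAt_inner_clm (M : E4 →L[ℂ] E4) {a b : ℝ → E4} {a' b' : E4} {ρ : ℝ}
    (ha : HasDerivAt a a' ρ) (hb : HasDerivAt b b' ρ) :
    HasDerivAt (fun ρ => inner ℂ (M (a ρ)) (b ρ)) (inner ℂ (M a') (b ρ) + inner ℂ (M (a ρ)) b') ρ := by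
  have h1 : HasDerivAt (fun ρ => M (a ρ)) (M a') ρ :=
    (M.restrictScalars ℝ).hasFDerivAt.comp_hasDerivAt ρ ha
  exact (h1.inner ℂ hb).congr_deriv (add_comm _ _)

/-- The amplitude `s ⟨M a, b⟩` has two derivatives, with the natural bounds. -/
lemma exists_amplitude (M : E4 →L[ℂ] E4) {C : ℝ} (hM : ‖M‖ ≤ C)
    (ha : ∀ ρ, HasDerivAt a (a₁ ρ) ρ) (ha₁ : ∀ ρ, HasDerivAt a₁ (a₂ ρ) ρ) (ha₂ : Continuous a₂)
    (hb : ∀ ρ, HasDerivAt b (b₁ ρ) ρ) (hb₁ : ∀ ρ, HasDerivAt b₁ (b₂ ρ) ρ) (hb₂ : Continuous b₂)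
    {s s₁ s₂ : ℝ → ℝ} (hs : ∀ ρ, HasDerivAt s (s₁ ρ) ρ) (hs₁ : ∀ ρ, HasDerivAt s₁ (s₂ ρ) ρ)
    (hs₂ : Continuous s₂) {D : ℝ} (hD : ∀ ρ, 0 < ρ → |s ρ| ≤ D ∧ |s₁ ρ| ≤ D ∧ |s₂ ρ| ≤ D) :
    ∃ f₁ f₂ : ℝ → ℂ, (∀ ρ, HasDerivAt (fun ρ => (s ρ : ℂ) * inner ℂ (M (a ρ)) (b ρ)) (f₁ ρ) ρ) ∧
      (∀ ρ, HasDerivAt f₁ (f₂ ρ) ρ) ∧ Continuous f₂ ∧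
      ∀ ρ, 0 < ρ →
        ‖(s ρ : ℂ) * inner ℂ (M (a ρ)) (b ρ)‖ ≤ D * C * (‖a ρ‖ * ‖b ρ‖) ∧
        ‖f₁ ρ‖ ≤ D * C * (‖a ρ‖ * ‖b ρ‖ + (‖a₁ ρ‖ * ‖b ρ‖ + ‖a ρ‖ * ‖b₁ ρ‖)) ∧
        ‖f₂ ρ‖ ≤ 2 * (D * C * (‖a ρ‖ * ‖b ρ‖ + (‖a₁ ρ‖ * ‖b ρ‖ + ‖a ρ‖ * ‖b₁ ρ‖) +
          (‖a₂ ρ‖ * ‖b ρ‖ + ‖a₁ ρ‖ * ‖b₁ ρ‖ + ‖a ρ‖ * ‖b₂ ρ‖))) := by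
  have hC : 0 ≤ C := (norm_nonneg _).trans hM
  set p : ℝ → ℂ := fun ρ => inner ℂ (M (a ρ)) (b ρ) with hp
  set p₁ : ℝ → ℂ := fun ρ => inner ℂ (M (a₁ ρ)) (b ρ) + inner ℂ (M (a ρ)) (b₁ ρ) with hp₁
  set p₂ : ℝ → ℂ := fun ρ => (inner ℂ (M (a₂ ρ)) (b ρ) + inner ℂ (M (a₁ ρ)) (b₁ ρ)) +
    (inner ℂ (M (a₁ ρ)) (b₁ ρ) + inner ℂ (M (a ρ)) (b₂ ρ)) with hp₂
  have dp : ∀ ρ, HasDerivAt p (p₁ ρ) ρ := fun ρ => hasDerivAt_inner_clm M (ha ρ) (hb ρ)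
  have dp₁ : ∀ ρ, HasDerivAt p₁ (p₂ ρ) ρ := fun ρ =>
    (hasDerivAt_inner_clm M (ha₁ ρ) (hb ρ)).add (hasDerivAt_inner_clm M (ha ρ) (hb₁ ρ))
  have ca : Continuous a := continuous_iff_continuousAt.2 fun ρ => (ha ρ).continuousAt
  have ca₁ : Continuous a₁ := continuous_iff_continuousAt.2 fun ρ => (ha₁ ρ).continuousAt
  have cb : Continuous b := continuous_iff_continuousAt.2 fun ρ => (hb ρ).continuousAt
  have cb₁ : Continuous b₁ := continuous_iff_continuousAt.2 fun ρ => (hb₁ ρ).continuousAt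
  have cs : Continuous s := continuous_iff_continuousAt.2 fun ρ => (hs ρ).continuousAt
  have cs₁ : Continuous s₁ := continuous_iff_continuousAt.2 fun ρ => (hs₁ ρ).continuousAt
  have cp : Continuous p := continuous_iff_continuousAt.2 fun ρ => (dp ρ).continuousAt
  have cp₁ : Continuous p₁ := continuous_iff_continuousAt.2 fun ρ => (dp₁ ρ).continuousAt
  have cp₂ : Continuous p₂ := by fun_prop
  have bM : ∀ v w : E4, ‖(inner ℂ (M v) w : ℂ)‖ ≤ C * (‖v‖ * ‖w‖) := fun v w => by
    refine (norm_inner_le_norm _ _).trans ?_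
    rw [← mul_assoc]
    gcongr
    exact M.le_of_opNorm_le hM v
  have bp₁ : ∀ ρ, ‖p₁ ρ‖ ≤ C * (‖a₁ ρ‖ * ‖b ρ‖ + ‖a ρ‖ * ‖b₁ ρ‖) := fun ρ => by
    refine (norm_add_le _ _).trans ?_
    rw [mul_add]
    exact add_le_add (bM _ _) (bM _ _)
  have bp₂ : ∀ ρ, ‖p₂ ρ‖ ≤ 2 * (C * (‖a₂ ρ‖ * ‖b ρ‖ + ‖a₁ ρ‖ * ‖b₁ ρ‖ + ‖a ρ‖ * ‖b₂ ρ‖)) :=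
    fun ρ => by
    have h1 := bM (a₂ ρ) (b ρ)
    have h2 := bM (a₁ ρ) (b₁ ρ)
    have h3 := bM (a ρ) (b₂ ρ)
    have h4 : 0 ≤ C * (‖a₂ ρ‖ * ‖b ρ‖) := by positivity
    have h5 : 0 ≤ C * (‖a ρ‖ * ‖b₂ ρ‖) := by positivity
    refine ((norm_add_le _ _).trans (add_le_add (norm_add_le _ _) (norm_add_le _ _))).trans ?_
    linarith
  refine ⟨fun ρ => (s₁ ρ : ℂ) * p ρ + (s ρ : ℂ) * p₁ ρ, fun ρ =>
    ((s₂ ρ : ℂ) * p ρ + (s₁ ρ : ℂ) * p₁ ρ) + ((s₁ ρ : ℂ) * p₁ ρ + (s ρ : ℂ) * p₂ ρ), fun ρ => ?_,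
    fun ρ => ?_, by fun_prop, fun ρ hρ => ⟨?_, ?_, ?_⟩⟩
  · exact (hs ρ).ofReal_comp.mul (dp ρ)
  · exact ((hs₁ ρ).ofReal_comp.mul (dp ρ)).add ((hs ρ).ofReal_comp.mul (dp₁ ρ))
  all_goals
    obtain ⟨d0, d1, d2⟩ := hD ρ hρ
    have hD0 : 0 ≤ D := (abs_nonneg _).trans d0
    have q0 := bM (a ρ) (b ρ)
    have q1 := bp₁ ρ
    have q2 := bp₂ ρ
  · rw [norm_mul, Complex.norm_real, Real.norm_eq_abs, mul_assoc]
    gcongr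
  · calc _ ≤ |s₁ ρ| * ‖p ρ‖ + |s ρ| * ‖p₁ ρ‖ := by
          refine (norm_add_le _ _).trans_eq ?_
          simp only [norm_mul, Complex.norm_real, Real.norm_eq_abs]
      _ ≤ D * (C * (‖a ρ‖ * ‖b ρ‖)) + D * (C * (‖a₁ ρ‖ * ‖b ρ‖ + ‖a ρ‖ * ‖b₁ ρ‖)) := by gcongr
      _ = _ := by ring
  · calc _ ≤ (|s₂ ρ| * ‖p ρ‖ + |s₁ ρ| * ‖p₁ ρ‖) + (|s₁ ρ| * ‖p₁ ρ‖ + |s ρ| * ‖p₂ ρ‖) := by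
          refine (norm_add_le _ _).trans (add_le_add ?_ ?_)
          all_goals
            refine (norm_add_le _ _).trans_eq ?_
            simp only [norm_mul, Complex.norm_real, Real.norm_eq_abs]
      _ ≤ (D * (C * (‖a ρ‖ * ‖b ρ‖)) + D * (C * (‖a₁ ρ‖ * ‖b ρ‖ + ‖a ρ‖ * ‖b₁ ρ‖))) +
          (D * (C * (‖a₁ ρ‖ * ‖b ρ‖ + ‖a ρ‖ * ‖b₁ ρ‖)) + D * (2 * (C * (‖a₂ ρ‖ * ‖b ρ‖ +
            ‖a₁ ρ‖ * ‖b₁ ρ‖ + ‖a ρ‖ * ‖b₂ ρ‖)))) := by gcongr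
      _ ≤ _ := by
          have : 0 ≤ D * (C * (‖a ρ‖ * ‖b ρ‖)) := by positivity
          linarith

end Amplitude

lemma rayProj_apply (ε : ℝ) (θ : E3) (ρ : ℝ) (v : E4) : rayProj ε θ ρ v =
    ((1 / 2 : ℝ) : ℂ) • ContinuousLinearMap.id ℂ E4 v +
    ((ε / 2 * (ρ * (dispersion (2 * Real.pi) ρ)⁻¹) : ℝ) : ℂ) • (diracSymbol θ - beta) v +
    ((ε / 2 * (dispersion (2 * Real.pi) ρ)⁻¹ : ℝ) : ℂ) • beta v := by
  simp only [rayProj, rayJ, diracSymbol_smul, smul_apply, add_apply]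
  push_cast
  module

/-- Along a ray the spectral projection is a combination of three fixed matrices, the identity, the
massless symbol at θ and β, with coefficients 1/2, ±ρ/(2ω) and ±1/(2ω). These have two bounded
derivatives and the matrices are bounded uniformly over the unit sphere, so `exists_amplitude`
applies to each term with a constant independent of θ. -/
lemma exists_ray_amplitude : ∃ C : ℝ, 0 < C ∧ ∀ (θ : E3) (ε : ℝ), ‖θ‖ = 1 → |ε| = 1 →
    ∀ a b a₁ b₁ a₂ b₂ : ℝ → E4,
    (∀ ρ, HasDerivAt a (a₁ ρ) ρ) → (∀ ρ, HasDerivAt a₁ (a₂ ρ) ρ) → Continuous a₂ →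
    (∀ ρ, HasDerivAt b (b₁ ρ) ρ) → (∀ ρ, HasDerivAt b₁ (b₂ ρ) ρ) → Continuous b₂ →
    ∃ f₁ f₂ : ℝ → ℂ, (∀ ρ, HasDerivAt (fun ρ => inner ℂ (rayProj ε θ ρ (a ρ)) (b ρ)) (f₁ ρ) ρ) ∧
      (∀ ρ, HasDerivAt f₁ (f₂ ρ) ρ) ∧ Continuous f₂ ∧
      ∀ ρ, 0 < ρ →
        ‖(inner ℂ (rayProj ε θ ρ (a ρ)) (b ρ) : ℂ)‖ ≤ C * (‖a ρ‖ * ‖b ρ‖) ∧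
        ‖f₁ ρ‖ ≤ C * (‖a ρ‖ * ‖b ρ‖ + (‖a₁ ρ‖ * ‖b ρ‖ + ‖a ρ‖ * ‖b₁ ρ‖)) ∧
        ‖f₂ ρ‖ ≤ C * (‖a ρ‖ * ‖b ρ‖ + (‖a₁ ρ‖ * ‖b ρ‖ + ‖a ρ‖ * ‖b₁ ρ‖) +
          (‖a₂ ρ‖ * ‖b ρ‖ + ‖a₁ ρ‖ * ‖b₁ ρ‖ + ‖a ρ‖ * ‖b₂ ρ‖)) := by
  obtain ⟨C₀, hC₀, hβ, hα⟩ := exists_norm_diracSymbol_le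
  set c : ℝ := 2 * Real.pi with hc
  have hc1 : 1 ≤ c := by have := Real.pi_gt_three; linarith
  set C₁ := max C₀ 1 with hC₁
  have hC₁1 : 1 ≤ C₁ := le_max_right _ _
  -- 4c² = c² + 3c² bounds the two terms in the second derivative of 1/ω; all the other coefficients
  -- and derivatives are smaller.
  set D : ℝ := 4 * c ^ 2 with hD
  have hD1 : 1 ≤ D := by nlinarith
  -- Three matrices, times the factor 2 in the second-derivative bound of `exists_amplitude`.
  refine ⟨6 * (D * C₁), by positivity, fun θ ε hθ hε a b a₁ b₁ a₂ b₂ ha ha₁ ha₂ hb hb₁ hb₂ => ?_⟩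
  have hω := fun ρ => one_le_dispersion c ρ
  have hω0 := fun ρ => dispersion_pos c ρ
  have hωc := continuous_dispersion c
  have hne : ∀ ρ, dispersion c ρ ≠ 0 := fun ρ => (hω0 ρ).ne'
  have hne3 : ∀ ρ, dispersion c ρ ^ 3 ≠ 0 := fun ρ => pow_ne_zero _ (hne ρ)
  have hne5 : ∀ ρ, dispersion c ρ ^ 5 ≠ 0 := fun ρ => pow_ne_zero _ (hne ρ)
  have hε2 : |ε / 2| ≤ 1 := by rw [abs_div, hε]; norm_num
  have hmul : ∀ x : ℝ, |x| ≤ D → |ε / 2 * x| ≤ D := fun x hx => by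
    rw [abs_mul]
    exact (mul_le_of_le_one_left (abs_nonneg x) hε2).trans hx
  obtain ⟨f₁, f₂, hf₁, hf₂, hf₃, hf⟩ := exists_amplitude (ContinuousLinearMap.id ℂ E4) (C := C₁)
    (ContinuousLinearMap.norm_id_le.trans hC₁1) ha ha₁ ha₂ hb hb₁ hb₂
    (s := fun _ => 1 / 2) (s₁ := fun _ => 0) (s₂ := fun _ => 0) (D := D)
    (fun ρ => hasDerivAt_const _ _) (fun ρ => hasDerivAt_const _ _) continuous_const
    (fun ρ _ => ⟨by rw [abs_of_pos] <;> linarith, by simp; linarith, by simp; linarith⟩)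
  obtain ⟨g₁, g₂, hg₁, hg₂, hg₃, hg⟩ := exists_amplitude (diracSymbol θ - beta) (C := C₁)
    ((hα θ hθ).trans (le_max_left _ _)) ha ha₁ ha₂ hb hb₁ hb₂
    (s := fun ρ => ε / 2 * (ρ * (dispersion c ρ)⁻¹)) (s₁ := fun ρ => ε / 2 * ((dispersion c ρ ^ 3)⁻¹))
    (s₂ := fun ρ => ε / 2 * (-(3 * c ^ 2 * ρ) / dispersion c ρ ^ 5)) (D := D)
    (fun ρ => (hasDerivAt_mul_inv_dispersion c ρ).const_mul _)
    (fun ρ => (hasDerivAt_inv_dispersion_pow c ρ).const_mul _)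
    (by fun_prop (disch := assumption))
    (fun ρ hρ => by
      have h1 := hω ρ
      have h2 := mul_le_dispersion c ρ
      have h3 : 1 ≤ dispersion c ρ ^ 3 := one_le_pow₀ h1
      have h4 : 1 ≤ dispersion c ρ ^ 4 := one_le_pow₀ h1
      refine ⟨hmul _ ?_, hmul _ ?_, hmul _ ?_⟩
      · rw [← div_eq_mul_inv, abs_of_nonneg (by positivity), div_le_iff₀ (hω0 ρ)]
        nlinarith
      · rw [abs_of_nonneg (by positivity)]
        exact (inv_le_one_of_one_le₀ h3).trans hD1
      · rw [abs_div, abs_neg, abs_of_nonneg (by positivity), abs_of_nonneg (by positivity),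
          div_le_iff₀ (by positivity)]
        have h6 : ρ ≤ dispersion c ρ := by nlinarith
        have h7 : dispersion c ρ ≤ dispersion c ρ ^ 5 := le_self_pow₀ h1 (by norm_num)
        calc 3 * c ^ 2 * ρ ≤ 4 * c ^ 2 * dispersion c ρ ^ 5 := by
              gcongr
              · norm_num
              · exact h6.trans h7
          _ = _ := rfl)
  obtain ⟨k₁, k₂, hk₁, hk₂, hk₃, hk⟩ := exists_amplitude beta (C := C₁)
    (hβ.trans (le_max_left _ _)) ha ha₁ ha₂ hb hb₁ hb₂
    (s := fun ρ => ε / 2 * (dispersion c ρ)⁻¹)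
    (s₁ := fun ρ => ε / 2 * (-(c ^ 2 * ρ) / dispersion c ρ ^ 3))
    (s₂ := fun ρ => ε / 2 * (-c ^ 2 / dispersion c ρ ^ 3 + 3 * c ^ 4 * ρ ^ 2 / dispersion c ρ ^ 5))
    (D := D)
    (fun ρ => (hasDerivAt_inv_dispersion c ρ).const_mul _)
    (fun ρ => (hasDerivAt_deriv_inv_dispersion c ρ).const_mul _)
    (by fun_prop (disch := assumption))
    (fun ρ hρ => by
      have h1 := hω ρ
      have h2 := mul_le_dispersion c ρ
      have h3 : 1 ≤ dispersion c ρ ^ 3 := one_le_pow₀ h1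
      refine ⟨hmul _ ?_, hmul _ ?_, hmul _ ?_⟩
      · rw [abs_of_nonneg (by have := hω0 ρ; positivity)]
        exact (inv_le_one_of_one_le₀ h1).trans hD1
      · rw [abs_div, abs_neg, abs_of_nonneg (by positivity), abs_of_nonneg (by positivity),
          div_le_iff₀ (by positivity)]
        have h6 : ρ ≤ dispersion c ρ := by nlinarith
        have h7 : dispersion c ρ ≤ dispersion c ρ ^ 3 := le_self_pow₀ h1 (by norm_num)
        calc c ^ 2 * ρ ≤ 4 * c ^ 2 * dispersion c ρ ^ 3 := by
              gcongr
              · nlinarith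
              · exact h6.trans h7
          _ = _ := rfl
      · have h5 : |(-c ^ 2 / dispersion c ρ ^ 3)| ≤ c ^ 2 := by
          rw [abs_div, abs_neg, abs_of_nonneg (by positivity), abs_of_nonneg (by positivity)]
          exact div_le_self (by positivity) h3
        have h6 : |3 * c ^ 4 * ρ ^ 2 / dispersion c ρ ^ 5| ≤ 3 * c ^ 2 := by
          rw [abs_of_nonneg (by positivity), div_le_iff₀ (by positivity)]
          have h8 : (c * ρ) ^ 2 ≤ dispersion c ρ ^ 2 := by rw [dispersion_sq]; linarith
          have h9 : dispersion c ρ ^ 2 ≤ dispersion c ρ ^ 5 := pow_le_pow_right₀ h1 (by norm_num)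
          calc 3 * c ^ 4 * ρ ^ 2 = 3 * c ^ 2 * (c * ρ) ^ 2 := by ring
            _ ≤ 3 * c ^ 2 * dispersion c ρ ^ 5 := by gcongr; exact h8.trans h9
        refine (abs_add_le _ _).trans ?_
        linarith)
  have he : (fun ρ => (inner ℂ (rayProj ε θ ρ (a ρ)) (b ρ) : ℂ)) = fun ρ =>
      ((1 / 2 : ℝ) : ℂ) * inner ℂ (ContinuousLinearMap.id ℂ E4 (a ρ)) (b ρ) +
      ((ε / 2 * (ρ * (dispersion c ρ)⁻¹) : ℝ) : ℂ) * inner ℂ ((diracSymbol θ - beta) (a ρ)) (b ρ) +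
      ((ε / 2 * (dispersion c ρ)⁻¹ : ℝ) : ℂ) * inner ℂ (beta (a ρ)) (b ρ) := by
    funext ρ
    rw [rayProj_apply, inner_add_left, inner_add_left, inner_smul_left, inner_smul_left,
      inner_smul_left, Complex.conj_ofReal, Complex.conj_ofReal, Complex.conj_ofReal]
  refine ⟨fun ρ => f₁ ρ + g₁ ρ + k₁ ρ, fun ρ => f₂ ρ + g₂ ρ + k₂ ρ, fun ρ => ?_,
    fun ρ => ((hf₂ ρ).add (hg₂ ρ)).add (hk₂ ρ), by fun_prop, fun ρ hρ => ?_⟩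
  · rw [he]
    exact ((hf₁ ρ).add (hg₁ ρ)).add (hk₁ ρ)
  · obtain ⟨x0, x1, x2⟩ := hf ρ hρ
    obtain ⟨y0, y1, y2⟩ := hg ρ hρ
    obtain ⟨z0, z1, z2⟩ := hk ρ hρ
    refine ⟨?_, ?_, ?_⟩
    · rw [congrFun he ρ]
      refine norm_add₃_le.trans ((add_le_add (add_le_add x0 y0) z0).trans ?_)
      have : 0 ≤ D * C₁ * (‖a ρ‖ * ‖b ρ‖) := by positivity
      linarith
    · refine norm_add₃_le.trans ((add_le_add (add_le_add x1 y1) z1).trans ?_)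
      have : 0 ≤ D * C₁ * (‖a ρ‖ * ‖b ρ‖ + (‖a₁ ρ‖ * ‖b ρ‖ + ‖a ρ‖ * ‖b₁ ρ‖)) := by positivity
      linarith
    · refine norm_add₃_le.trans ((add_le_add (add_le_add x2 y2) z2).trans ?_)
      linarith

/-! ### Polar coordinates in `ℝ³` -/

lemma finrank_E3_sub_one : Module.finrank ℝ E3 - 1 = 2 := by simp

lemma homeomorphUnitSphereProd_smul (x : ({(0 : E3)}ᶜ : Set E3)) :
    ((homeomorphUnitSphereProd E3 x).2 : ℝ) • ((homeomorphUnitSphereProd E3 x).1 : E3) = x := by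
  have hx : ‖(x : E3)‖ ≠ 0 := norm_ne_zero_iff.2 x.2
  simp [smul_smul, hx]

lemma lintegral_polar {h : E3 → ℝ≥0∞} (hh : Measurable h) :
    ∫⁻ ξ, h ξ = ∫⁻ θ : Metric.sphere (0 : E3) 1, ∫⁻ ρ in Ioi (0 : ℝ),
      ENNReal.ofReal (ρ ^ 2) * h (ρ • (θ : E3)) ∂volume ∂(volume : Measure E3).toSphere := by
  have hm : Measurable fun y : Metric.sphere (0 : E3) 1 × Ioi (0 : ℝ) =>
      h ((y.2 : ℝ) • (y.1 : E3)) := hh.comp (by fun_prop)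
  calc ∫⁻ ξ, h ξ = ∫⁻ x : ({(0 : E3)}ᶜ : Set E3), h (x : E3) ∂(volume.comap Subtype.val) := by
        rw [lintegral_subtype_comap (measurableSet_singleton _).compl, restrict_compl_singleton]
    _ = ∫⁻ y, h ((y.2 : ℝ) • (y.1 : E3))
        ∂(volume : Measure E3).toSphere.prod (.volumeIoiPow (Module.finrank ℝ E3 - 1)) := by
        rw [← (Measure.measurePreserving_homeomorphUnitSphereProd
          (volume : Measure E3)).lintegral_comp hm]
        simp only [homeomorphUnitSphereProd_smul]
    _ = ∫⁻ θ : Metric.sphere (0 : E3) 1, ∫⁻ ρ : Ioi (0 : ℝ), h ((ρ : ℝ) • (θ : E3))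
          ∂(.volumeIoiPow (Module.finrank ℝ E3 - 1)) ∂(volume : Measure E3).toSphere :=
        lintegral_prod _ hm.aemeasurable
    _ = _ := by
        refine lintegral_congr fun θ => ?_
        rw [finrank_E3_sub_one, Measure.volumeIoiPow, lintegral_withDensity_eq_lintegral_mul]
        · exact lintegral_subtype_comap measurableSet_Ioi fun a : ℝ =>
            ENNReal.ofReal (a ^ 2) * h (a • (θ : E3))
        · fun_prop
        · exact hh.comp (by fun_prop)

lemma integral_polar {h : E3 → ℂ} (hh : Integrable h) :
    ∫ ξ, h ξ = ∫ θ : Metric.sphere (0 : E3) 1, ∫ ρ in Ioi (0 : ℝ),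
      (h (ρ • (θ : E3))) * ((ρ ^ 2 : ℝ) : ℂ) ∂volume ∂(volume : Measure E3).toSphere := by
  have mp := Measure.measurePreserving_homeomorphUnitSphereProd (volume : Measure E3)
  have me := (homeomorphUnitSphereProd E3).measurableEmbedding
  set H : Metric.sphere (0 : E3) 1 × Ioi (0 : ℝ) → ℂ := fun y => h ((y.2 : ℝ) • (y.1 : E3)) with hH
  have hcomp : H ∘ homeomorphUnitSphereProd E3 =
      fun x : ({(0 : E3)}ᶜ : Set E3) => h (x : E3) := by
    funext x
    simp only [hH, Function.comp, homeomorphUnitSphereProd_smul]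
  have hi : Integrable H
      ((volume : Measure E3).toSphere.prod (.volumeIoiPow (Module.finrank ℝ E3 - 1))) := by
    rw [← mp.integrable_comp_emb me, hcomp]
    have h2 : IntegrableOn h ({(0 : E3)}ᶜ) := hh.integrableOn
    exact (integrableOn_iff_comap_subtypeVal (measurableSet_singleton _).compl).1 h2
  calc ∫ ξ, h ξ = ∫ x : ({(0 : E3)}ᶜ : Set E3), h (x : E3) ∂(volume.comap Subtype.val) := by
        rw [integral_subtype_comap (measurableSet_singleton _).compl, restrict_compl_singleton]
    _ = ∫ y, H y
        ∂(volume : Measure E3).toSphere.prod (.volumeIoiPow (Module.finrank ℝ E3 - 1)) := by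
        rw [← mp.integral_comp me]
        exact congrArg (fun f : ({(0 : E3)}ᶜ : Set E3) → ℂ => ∫ x, f x ∂(volume.comap Subtype.val))
          hcomp.symm
    _ = ∫ θ : Metric.sphere (0 : E3) 1, ∫ ρ : Ioi (0 : ℝ), h ((ρ : ℝ) • (θ : E3))
          ∂(.volumeIoiPow (Module.finrank ℝ E3 - 1)) ∂(volume : Measure E3).toSphere :=
        integral_prod _ hi
    _ = _ := by
        refine integral_congr_ae (Filter.Eventually.of_forall fun θ => ?_)
        simp only
        rw [finrank_E3_sub_one, Measure.volumeIoiPow]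
        simp only [ENNReal.ofReal]
        rw [integral_withDensity_eq_integral_smul (by fun_prop),
          integral_subtype_comap measurableSet_Ioi fun a : ℝ =>
            Real.toNNReal (a ^ 2) • h (a • (θ : E3))]
        refine setIntegral_congr_fun measurableSet_Ioi fun x hx => ?_
        simp only [NNReal.smul_def]
        rw [Real.coe_toNNReal _ (sq_nonneg x), Complex.real_smul, mul_comm]

/-! ### Schwartz functions on rays -/

lemma hasDerivAt_schwartz_ray (a : 𝓢(E3, E4)) (θ : E3) (ρ : ℝ) :
    HasDerivAt (fun ρ : ℝ => a (ρ • θ)) ((∂_{θ} a) (ρ • θ)) ρ := by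
  have h1 : HasDerivAt (fun ρ : ℝ => ρ • θ) θ ρ := by
    simpa using (hasDerivAt_id ρ).smul_const θ
  have h2 := (a.differentiableAt (x := ρ • θ)).hasFDerivAt.comp_hasDerivAt ρ h1
  rw [SchwartzMap.lineDerivOp_apply_eq_fderiv]
  exact h2

/-- The standard basis vector. -/
abbrev stdVec (k : Fin 3) : E3 := EuclideanSpace.single k (1 : ℝ)

lemma eq_sum_stdVec (θ : E3) : θ = ∑ k, θ k • stdVec k := by
  ext i
  simp [Finset.sum_apply, Pi.single_apply]

/-- The sum of the norms of the first partial derivatives. -/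
def firstNorm (a : 𝓢(E3, E4)) (ξ : E3) : ℝ := ∑ k, ‖(∂_{stdVec k} a) ξ‖

/-- The sum of the norms of the second partial derivatives. -/
def secondNorm (a : 𝓢(E3, E4)) (ξ : E3) : ℝ := ∑ k, firstNorm (∂_{stdVec k} a) ξ

lemma firstNorm_nonneg (a : 𝓢(E3, E4)) (ξ : E3) : 0 ≤ firstNorm a ξ :=
  Finset.sum_nonneg fun _ _ => norm_nonneg _

lemma secondNorm_nonneg (a : 𝓢(E3, E4)) (ξ : E3) : 0 ≤ secondNorm a ξ :=
  Finset.sum_nonneg fun _ _ => firstNorm_nonneg _ _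

lemma lineDeriv_apply_eq_sum (a : 𝓢(E3, E4)) (θ ξ : E3) :
    (∂_{θ} a) ξ = ∑ k, θ k • (∂_{stdVec k} a) ξ := by
  simp only [SchwartzMap.lineDerivOp_apply_eq_fderiv]
  conv_lhs => rw [eq_sum_stdVec θ]
  rw [map_sum]
  simp only [map_smul]

lemma abs_coord_le {θ : E3} (hθ : ‖θ‖ = 1) (k : Fin 3) : |θ k| ≤ 1 := by
  rw [← hθ]
  exact PiLp.norm_apply_le θ k

lemma norm_lineDeriv_le (a : 𝓢(E3, E4)) {θ : E3} (hθ : ‖θ‖ = 1) (ξ : E3) :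
    ‖(∂_{θ} a) ξ‖ ≤ firstNorm a ξ := by
  rw [lineDeriv_apply_eq_sum]
  refine (norm_sum_le _ _).trans (Finset.sum_le_sum fun k _ => ?_)
  rw [norm_smul]
  exact mul_le_of_le_one_left (norm_nonneg _) (abs_coord_le hθ k)

lemma norm_lineDeriv_lineDeriv_le (a : 𝓢(E3, E4)) {θ : E3} (hθ : ‖θ‖ = 1) (ξ : E3) :
    ‖(∂_{θ} (∂_{θ} a)) ξ‖ ≤ secondNorm a ξ := by
  have h1 : ∂_{θ} a = ∑ k, θ k • ∂_{stdVec k} a := by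
    ext1 x
    rw [lineDeriv_apply_eq_sum, sum_apply]
    rfl
  have h2 : ∂_{θ} (∂_{θ} a) = ∑ k, θ k • ∂_{θ} (∂_{stdVec k} a) := by
    conv_lhs => rw [h1]
    rw [LineDeriv.lineDerivOp_sum]
    simp only [LineDeriv.lineDerivOp_smul]
  rw [h2, sum_apply]
  refine (norm_sum_le _ _).trans (Finset.sum_le_sum fun k _ => ?_)
  rw [smul_apply, norm_smul]
  exact (mul_le_of_le_one_left (norm_nonneg _) (abs_coord_le hθ k)).trans
    (norm_lineDeriv_le _ hθ _)

/-- The sixth power is the decay required along rays by `enorm_ray_integral_le`. -/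
lemma exists_schwartz_decay (a : 𝓢(E3, E4)) :
    ∃ B : ℝ, 0 ≤ B ∧ ∀ ξ, (1 + ‖ξ‖) ^ 6 * ‖a ξ‖ ≤ B := by
  have h := fun ξ => SchwartzMap.one_add_le_sup_seminorm_apply (𝕜 := ℂ) (m := (6, 0)) (k := 6)
    (n := 0) le_rfl le_rfl a ξ
  simp only [norm_iteratedFDeriv_zero] at h
  exact ⟨_, le_trans (by positivity) (h 0), h⟩

/-! ### Weights -/

/-- The singular weight `1 + |q|^{-5/4}`. -/
def singWeight (q : ℝ) : ℝ := 1 + (Real.sqrt (Real.sqrt q))⁻¹ ^ 5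

lemma one_le_singWeight (q : ℝ) : 1 ≤ singWeight q := by
  unfold singWeight
  have : 0 ≤ (Real.sqrt (Real.sqrt q))⁻¹ ^ 5 := by positivity
  linarith

lemma measurable_singWeight : Measurable singWeight := by
  unfold singWeight
  fun_prop

/-- With z = ρ^{1/4} and η = h⁴ the factor η²/(ρ²+η²) is h⁸/(z⁸+h⁸). One power of h is extracted
from it at the price of a mild singularity z⁻¹ = ρ^{-1/4}: for z ≤ h the factor is at most 1 ≤ h/z,
for h ≤ z ≤ 1 it is at most h⁸/z⁸ ≤ h/z, and for z ≥ 1 the power h⁸ alone is enough. -/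
lemma regularized_ratio_le {h z : ℝ} (hh : 0 < h) (hh1 : h ≤ 1) (hz : 0 < z) :
    (1 + z ^ 8) * h ^ 8 ≤ 2 * h * (1 + z⁻¹) * (z ^ 8 + h ^ 8) := by
  have h8 : h ^ 8 ≤ h := pow_le_of_le_one hh.le hh1 (by norm_num)
  have hzi : 0 < z⁻¹ := inv_pos.2 hz
  rcases le_total 1 z with h1 | h1
  · have : 1 ≤ z ^ 8 := one_le_pow₀ h1
    calc (1 + z ^ 8) * h ^ 8 ≤ (z ^ 8 + z ^ 8) * h := by gcongr
      _ = 2 * h * 1 * (z ^ 8 + 0) := by ring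
      _ ≤ _ := by gcongr <;> [linarith; positivity]
  · have hz8 : z ^ 8 ≤ 1 := pow_le_one₀ hz.le h1
    rcases le_total z h with h2 | h2
    · have : 1 ≤ h * z⁻¹ := by rw [← div_eq_mul_inv, one_le_div hz]; exact h2
      calc (1 + z ^ 8) * h ^ 8 ≤ 2 * 1 * (0 + h ^ 8) := by nlinarith [pow_pos hh 8]
        _ ≤ 2 * (h * z⁻¹) * (z ^ 8 + h ^ 8) := by gcongr; positivity
        _ ≤ 2 * (h * (1 + z⁻¹)) * (z ^ 8 + h ^ 8) := by gcongr; linarith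
        _ = _ := by ring
    · have h3 : h ^ 7 ≤ z ^ 7 := pow_le_pow_left₀ hh.le h2 7
      calc (1 + z ^ 8) * h ^ 8 ≤ 2 * (h * h ^ 7) := by nlinarith [pow_pos hh 8]
        _ ≤ 2 * (h * z ^ 7) := by gcongr
        _ = 2 * h * (0 + z⁻¹) * (z ^ 8 + 0) := by field_simp; ring
        _ ≤ _ := by gcongr <;> [norm_num; positivity]

/-- Turns the one-dimensional majorant into ρ² times a density, ready for polar coordinates. Here x,
x₁, x₂ and y, y₁, y₂ stand for the sizes of the two Schwartz functions and of their first and second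
derivatives at a point at distance q from the origin. The first-order part receives the small factor
h and is symmetric in the two functions. The second derivatives appear only with the factor |τ|⁻¹h⁻⁸
and without singular weight, because they already come with q². -/
lemma rayMajorant_le {h τ q x y x₁ y₁ x₂ y₂ C : ℝ} (hh : 0 < h) (hh1 : h ≤ 1) (hq : 0 < q)
    (hτ : τ ≠ 0) (hC : 0 ≤ C) (hx : 0 ≤ x) (hy : 0 ≤ y) (hx₁ : 0 ≤ x₁) (hy₁ : 0 ≤ y₁)
    (hx₂ : 0 ≤ x₂) (hy₂ : 0 ≤ y₂) {F F₁ F₂ : ℝ} (hF : F ≤ C * (x * y))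
    (hF₁ : F₁ ≤ C * (x * y + (x₁ * y + x * y₁)))
    (hF₂ : F₂ ≤ C * (x * y + (x₁ * y + x * y₁) + (x₂ * y + x₁ * y₁ + x * y₂))) :
    rayMajorant (h ^ 4) τ q F F₁ F₂ ≤ q ^ 2 * (12 * C / |τ| *
      ((16 * h + 6 * (|τ|⁻¹ * (h ^ 8)⁻¹)) *
        ((singWeight q * x + x₁) * (singWeight q * y + y₁)) +
        2 * (|τ|⁻¹ * (h ^ 8)⁻¹) * (x₂ * y + x * y₂))) := by
  -- Passing to the fourth root makes every exponent an integer.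
  obtain ⟨z, hz, rfl⟩ : ∃ z : ℝ, 0 < z ∧ q = z ^ 4 := by
    refine ⟨Real.sqrt (Real.sqrt q), by positivity, ?_⟩
    rw [show (4 : ℕ) = 2 * 2 from rfl, pow_mul, Real.sq_sqrt (Real.sqrt_nonneg _), Real.sq_sqrt hq.le]
  have hP : singWeight (z ^ 4) = 1 + z⁻¹ ^ 5 := by
    unfold singWeight
    rw [show z ^ 4 = (z ^ 2) ^ 2 by ring, Real.sqrt_sq (by positivity), Real.sqrt_sq hz.le]
  have hτ' : 0 < |τ| := abs_pos.2 hτ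
  set P := singWeight (z ^ 4) with hPdef
  have hP1 : 1 ≤ P := one_le_singWeight _
  have hzi : 0 < z⁻¹ := inv_pos.2 hz
  have hzz : z * z⁻¹ = 1 := mul_inv_cancel₀ hz.ne'
  set K := rayK (h ^ 4) (z ^ 4) with hK
  have hK0 : 0 < K := rayK_pos (by positivity) _
  have hK1 : K * (z ^ 8 + h ^ 8) = 1 := by
    rw [hK, rayK, show (z ^ 4) ^ 2 + (h ^ 4) ^ 2 = z ^ 8 + h ^ 8 by ring]
    exact inv_mul_cancel₀ (by positivity)
  have hq2 : (1 + z ^ 4) ^ 2 ≤ 2 * (1 + z ^ 8) := by nlinarith [sq_nonneg (1 - z ^ 4)]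
  -- the two weights
  have w1 : K * (1 + z ^ 4) ^ 2 * (h ^ 4) ^ 2 ≤ 4 * h * (1 + z⁻¹) := by
    have := regularized_ratio_le hh hh1 hz
    calc K * (1 + z ^ 4) ^ 2 * (h ^ 4) ^ 2 ≤ K * (2 * (1 + z ^ 8)) * (h ^ 4) ^ 2 := by gcongr
      _ = 2 * K * ((1 + z ^ 8) * h ^ 8) := by ring
      _ ≤ 2 * K * (2 * h * (1 + z⁻¹) * (z ^ 8 + h ^ 8)) := by gcongr
      _ = 4 * h * (1 + z⁻¹) * (K * (z ^ 8 + h ^ 8)) := by ring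
      _ = _ := by rw [hK1, mul_one]
  have h81 : h ^ 8 ≤ 1 := pow_le_one₀ hh.le hh1
  have w2 : K * (1 + z ^ 4) ^ 2 ≤ 2 * (h ^ 8)⁻¹ := by
    rw [← div_eq_mul_inv, le_div_iff₀ (by positivity)]
    calc K * (1 + z ^ 4) ^ 2 * h ^ 8 ≤ K * (2 * (1 + z ^ 8)) * h ^ 8 := by gcongr
      _ = 2 * K * (z ^ 8 * h ^ 8 + h ^ 8) := by ring
      _ ≤ 2 * K * (z ^ 8 * 1 + h ^ 8) := by gcongr
      _ = 2 * (K * (z ^ 8 + h ^ 8)) := by ring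
      _ = 2 := by rw [hK1, mul_one]
  -- comparison of the powers of `z`
  have hzP : z ^ 4 * P = z ^ 4 + z⁻¹ := by
    rw [hP]; field_simp
  have p1 : 1 + z⁻¹ ≤ 2 * (z ^ 4 * P) := by
    rw [hzP]
    rcases le_total 1 z with h1 | h1
    · have := one_le_pow₀ h1 (n := 4); linarith
    · have := one_le_inv₀ hz |>.2 h1
      have : 0 < z ^ 4 := by positivity
      linarith
  have p0 : 1 ≤ z ^ 4 * P := by
    rw [hzP]
    rcases le_total 1 z with h1 | h1
    · have := one_le_pow₀ h1 (n := 4); linarith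
    · have := one_le_inv₀ hz |>.2 h1
      have : 0 < z ^ 4 := by positivity
      linarith
  set q := z ^ 4 with hqdef
  set g := C * (x * y + (x₁ * y + x * y₁)) with hg
  set f := C * (x * y) with hf
  set k := C * (x * y + (x₁ * y + x * y₁) + (x₂ * y + x₁ * y₁ + x * y₂)) with hk
  have hf0 : 0 ≤ f := by positivity
  have hg0 : 0 ≤ g := by positivity
  set U := (P * x + x₁) * (P * y + y₁) with hU
  -- The weight P² is shared between the two functions, one P each, as Cauchy-Schwarz will require.
  have e1 : P ^ 2 * f + P * g ≤ 2 * (C * U) := by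
    have i1 : P * (x * y) ≤ P * (P * (x * y)) :=
      mul_le_mul_of_nonneg_left (le_mul_of_one_le_left (by positivity) hP1) (by positivity)
    have i2 : 0 ≤ P * (x₁ * y + x * y₁) + 2 * (x₁ * y₁) := by positivity
    calc P ^ 2 * f + P * g = C * (P * (P * (x * y)) + P * (x * y) + P * (x₁ * y + x * y₁)) := by
          rw [hf, hg]; ring
      _ ≤ C * (2 * U) := by
          gcongr
          rw [hU]
          linarith [show (P * x + x₁) * (P * y + y₁) =
            P * (P * (x * y)) + P * (x₁ * y + x * y₁) + x₁ * y₁ by ring]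
      _ = _ := by ring
  have e2 : k ≤ C * (U + (x₂ * y + x * y₂)) := by
    have i3 : (x + x₁) * (y + y₁) ≤ U := by
      rw [hU]
      gcongr
      · exact le_mul_of_one_le_left hx hP1
      · exact le_mul_of_one_le_left hy hP1
    rw [hk]
    refine mul_le_mul_of_nonneg_left ?_ hC
    linarith [show (x + x₁) * (y + y₁) = x * y + (x₁ * y + x * y₁) + x₁ * y₁ by ring]
  -- Since qP ≥ 1, powers of qP can be inserted until the Jacobian q² appears.
  have s1 : f + q * g ≤ q ^ 2 * (P ^ 2 * f + P * g) := by
    have j1 : 1 ≤ (q * P) ^ 2 := one_le_pow₀ p0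
    calc f + q * g ≤ (q * P) ^ 2 * f + q * g * (q * P) :=
          add_le_add (le_mul_of_one_le_left hf0 j1) (le_mul_of_one_le_right (by positivity) p0)
      _ = _ := by ring
  have s2 : (1 + z⁻¹) * (f + q * g) ≤ 2 * (q ^ 2 * (P ^ 2 * f + P * g)) := by
    have j1 : q * P ≤ (q * P) ^ 2 := le_self_pow₀ p0 two_ne_zero
    calc (1 + z⁻¹) * (f + q * g) ≤ 2 * (q * P) * (f + q * g) := by gcongr
      _ = 2 * ((q * P) * f + q * g * (q * P)) := by ring
      _ ≤ 2 * ((q * P) ^ 2 * f + q * g * (q * P)) := by gcongr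
      _ = _ := by ring
  have hFF : F + q * F₁ ≤ f + q * g := by gcongr
  have hFFF : F + q * F₁ + q ^ 2 * F₂ ≤ f + q * g + q ^ 2 * k := by gcongr
  calc rayMajorant (h ^ 4) τ q F F₁ F₂
      = 12 / |τ| * (K * (1 + q) ^ 2 * (h ^ 4) ^ 2 * (F + q * F₁) +
          |τ|⁻¹ * (K * (1 + q) ^ 2 * (F + q * F₁ + q ^ 2 * F₂))) := by
        unfold rayMajorant; ring
    _ ≤ 12 / |τ| * (K * (1 + q) ^ 2 * (h ^ 4) ^ 2 * (f + q * g) +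
          |τ|⁻¹ * (K * (1 + q) ^ 2 * (f + q * g + q ^ 2 * k))) := by gcongr
    _ ≤ 12 / |τ| * (4 * h * (1 + z⁻¹) * (f + q * g) +
          |τ|⁻¹ * (2 * (h ^ 8)⁻¹ * (f + q * g + q ^ 2 * k))) := by
        have : 0 ≤ k := by positivity
        gcongr
    _ = 12 / |τ| * (4 * h * ((1 + z⁻¹) * (f + q * g)) +
          |τ|⁻¹ * (2 * (h ^ 8)⁻¹ * (f + q * g + q ^ 2 * k))) := by ring
    _ ≤ 12 / |τ| * (4 * h * (2 * (q ^ 2 * (2 * (C * U)))) +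
          |τ|⁻¹ * (2 * (h ^ 8)⁻¹ * (q ^ 2 * (2 * (C * U)) +
            q ^ 2 * (C * (U + (x₂ * y + x * y₂)))))) := by
        gcongr 12 / |τ| * (4 * h * ?_ + |τ|⁻¹ * (2 * (h ^ 8)⁻¹ * (?_ + q ^ 2 * ?_)))
        · exact s2.trans (by gcongr)
        · exact s1.trans (by gcongr)
    _ = _ := by ring

/-! ### The dispersive estimate for Schwartz functions -/

/-- The amplitude `(1 + |ξ|^{-5/4}) |a(ξ)| + |∇a(ξ)|`. -/
def weightedNorm (a : 𝓢(E3, E4)) (ξ : E3) : ℝ := singWeight ‖ξ‖ * ‖a ξ‖ + firstNorm a ξ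

/-- The pointwise majorant in the dispersive estimate. -/
def dispMajorant (h τ : ℝ) (a b : 𝓢(E3, E4)) (ξ : E3) : ℝ :=
  (16 * h + 6 * (|τ|⁻¹ * (h ^ 8)⁻¹)) * (weightedNorm a ξ * weightedNorm b ξ) +
    2 * (|τ|⁻¹ * (h ^ 8)⁻¹) * (secondNorm a ξ * ‖b ξ‖ + ‖a ξ‖ * secondNorm b ξ)

lemma continuous_firstNorm (a : 𝓢(E3, E4)) : Continuous (firstNorm a) :=
  continuous_finsetSum _ fun _ _ => (SchwartzMap.continuous _).norm

lemma continuous_secondNorm (a : 𝓢(E3, E4)) : Continuous (secondNorm a) :=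
  continuous_finsetSum _ fun _ _ => continuous_firstNorm _

lemma measurable_weightedNorm (a : 𝓢(E3, E4)) : Measurable (weightedNorm a) :=
  ((measurable_singWeight.comp measurable_norm).mul a.continuous.norm.measurable).add
    (continuous_firstNorm a).measurable

lemma measurable_dispMajorant (h τ : ℝ) (a b : 𝓢(E3, E4)) : Measurable (dispMajorant h τ a b) := by
  have h1 := measurable_weightedNorm a
  have h2 := measurable_weightedNorm b
  have h3 := (continuous_secondNorm a).measurable
  have h4 := (continuous_secondNorm b).measurable
  have h5 := a.continuous.measurable
  have h6 := b.continuous.measurable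
  unfold dispMajorant
  fun_prop

lemma integrable_inner_diracExp (t : ℝ) (a b : 𝓢(E3, E4)) :
    Integrable fun ξ => (inner ℂ (diracExp t ξ (a ξ)) (b ξ) : ℂ) := by
  obtain ⟨B, hB0, hB⟩ := exists_schwartz_decay a
  refine Integrable.mono' (b.integrable.norm.const_mul B) ?_ (Filter.Eventually.of_forall fun ξ => ?_)
  · have h : Continuous fun ξ => diracExp t ξ (a ξ) := (continuous_diracExp t).clm_apply a.continuous
    exact (h.inner b.continuous).aestronglyMeasurable
  · refine (norm_inner_le_norm _ _).trans ?_
    rw [norm_diracExp_apply]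
    gcongr
    refine le_trans (le_mul_of_one_le_left (norm_nonneg _) ?_) (hB ξ)
    exact one_le_pow₀ (by linarith [norm_nonneg ξ])

/-- The oscillatory integral along one ray, for one of the two spectral components. -/
lemma exists_ray_bound : ∃ C : ℝ, 0 < C ∧ ∀ (a b : 𝓢(E3, E4)) (θ : E3) (ε τ h : ℝ), ‖θ‖ = 1 →
    |ε| = 1 → τ ≠ 0 → 0 < h → h ≤ 1 →
    IntegrableOn (fun ρ => rayE (2 * Real.pi) τ ρ *
      inner ℂ (rayProj ε θ ρ (a (ρ • θ))) (b (ρ • θ)) * ((ρ ^ 2 : ℝ) : ℂ)) (Ioi 0) ∧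
    ‖∫ ρ in Ioi (0 : ℝ), rayE (2 * Real.pi) τ ρ *
      inner ℂ (rayProj ε θ ρ (a (ρ • θ))) (b (ρ • θ)) * ((ρ ^ 2 : ℝ) : ℂ)‖ₑ ≤
      ∫⁻ ρ in Ioi (0 : ℝ), ENNReal.ofReal (ρ ^ 2) *
        ENNReal.ofReal (C / |τ| * dispMajorant h τ a b (ρ • θ)) := by
  obtain ⟨C, hC, hamp⟩ := exists_ray_amplitude
  refine ⟨12 * C, by positivity, fun a b θ ε τ h hθ hε hτ hh hh1 => ?_⟩
  obtain ⟨f₁, f₂, hf, hf₁, hf₂, hbd⟩ := hamp θ ε hθ hε (fun ρ => a (ρ • θ)) (fun ρ => b (ρ • θ))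
    (fun ρ => (∂_{θ} a) (ρ • θ)) (fun ρ => (∂_{θ} b) (ρ • θ))
    (fun ρ => (∂_{θ} (∂_{θ} a)) (ρ • θ)) (fun ρ => (∂_{θ} (∂_{θ} b)) (ρ • θ))
    (hasDerivAt_schwartz_ray a θ) (hasDerivAt_schwartz_ray _ θ)
    ((SchwartzMap.continuous _).comp (by fun_prop))
    (hasDerivAt_schwartz_ray b θ) (hasDerivAt_schwartz_ray _ θ)
    ((SchwartzMap.continuous _).comp (by fun_prop))
  have hnorm : ∀ ρ, 0 < ρ → ‖ρ • θ‖ = ρ := fun ρ hρ => by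
    rw [norm_smul, hθ, mul_one, Real.norm_of_nonneg hρ.le]
  -- Only the existence of `B` matters: it depends on `a`, `b` and θ but does not enter the
  -- estimate.
  have hdec : ∃ B, ∀ ρ, 0 < ρ → (1 + ρ) ^ 6 * (‖(inner ℂ (rayProj ε θ ρ (a (ρ • θ))) (b (ρ • θ)) : ℂ)‖
      + ‖f₁ ρ‖ + ‖f₂ ρ‖) ≤ B := by
    obtain ⟨A₀, hA₀, ha₀⟩ := exists_schwartz_decay a
    obtain ⟨A₁, hA₁, ha₁⟩ := exists_schwartz_decay (∂_{θ} a)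
    obtain ⟨A₂, hA₂, ha₂⟩ := exists_schwartz_decay (∂_{θ} (∂_{θ} a))
    obtain ⟨B₀, hB₀, hb₀⟩ := exists_schwartz_decay b
    obtain ⟨B₁, hB₁, hb₁⟩ := exists_schwartz_decay (∂_{θ} b)
    obtain ⟨B₂, hB₂, hb₂⟩ := exists_schwartz_decay (∂_{θ} (∂_{θ} b))
    refine ⟨C * (A₀ * B₀) + C * (A₀ * B₀ + (A₁ * B₀ + A₀ * B₁)) +
      C * (A₀ * B₀ + (A₁ * B₀ + A₀ * B₁) + (A₂ * B₀ + A₁ * B₁ + A₀ * B₂)), fun ρ hρ => ?_⟩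
    have hone : 1 ≤ (1 + ρ) ^ 6 := one_le_pow₀ (by linarith)
    have hmul : ∀ {x y X Y : ℝ}, 0 ≤ x → 0 ≤ y → 0 ≤ X → (1 + ρ) ^ 6 * x ≤ X → (1 + ρ) ^ 6 * y ≤ Y →
        (1 + ρ) ^ 6 * (x * y) ≤ X * Y := fun {x y X Y} hx hy hX h1 h2 => by
      have h3 : y ≤ Y := le_trans (le_mul_of_one_le_left hy hone) h2
      rw [← mul_assoc]
      gcongr
    obtain ⟨b0, b1, b2⟩ := hbd ρ hρ
    have da₀ := ha₀ (ρ • θ); have da₁ := ha₁ (ρ • θ); have da₂ := ha₂ (ρ • θ)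
    have db₀ := hb₀ (ρ • θ); have db₁ := hb₁ (ρ • θ); have db₂ := hb₂ (ρ • θ)
    rw [hnorm ρ hρ] at da₀ da₁ da₂ db₀ db₁ db₂
    have m00 := hmul (norm_nonneg _) (norm_nonneg _) hA₀ da₀ db₀
    have m10 := hmul (norm_nonneg _) (norm_nonneg _) hA₁ da₁ db₀
    have m01 := hmul (norm_nonneg _) (norm_nonneg _) hA₀ da₀ db₁
    have m20 := hmul (norm_nonneg _) (norm_nonneg _) hA₂ da₂ db₀
    have m11 := hmul (norm_nonneg _) (norm_nonneg _) hA₁ da₁ db₁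
    have m02 := hmul (norm_nonneg _) (norm_nonneg _) hA₀ da₀ db₂
    rw [mul_add, mul_add]
    refine add_le_add (add_le_add ?_ ?_) ?_
    · refine (mul_le_mul_of_nonneg_left b0 (by positivity)).trans ?_
      rw [mul_left_comm]
      exact mul_le_mul_of_nonneg_left m00 hC.le
    · refine (mul_le_mul_of_nonneg_left b1 (by positivity)).trans ?_
      rw [mul_left_comm]
      refine mul_le_mul_of_nonneg_left ?_ hC.le
      linarith
    · refine (mul_le_mul_of_nonneg_left b2 (by positivity)).trans ?_
      rw [mul_left_comm]
      refine mul_le_mul_of_nonneg_left ?_ hC.le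
      linarith
  obtain ⟨B, hB⟩ := hdec
  have hc1 : (1 : ℝ) ≤ 2 * Real.pi := by have := Real.pi_gt_three; linarith
  obtain ⟨hi, hle⟩ := enorm_ray_integral_le hc1 (η := h ^ 4) (by positivity) hτ hf hf₁ hf₂ hB
  refine ⟨hi, hle.trans (setLIntegral_mono' measurableSet_Ioi fun ρ hρ' => ?_)⟩
  have hρ : 0 < ρ := hρ'
  rw [← ENNReal.ofReal_mul (sq_nonneg _)]
  refine ENNReal.ofReal_le_ofReal ?_
  obtain ⟨b0, b1, b2⟩ := hbd ρ hρ
  have da₁ := norm_lineDeriv_le a hθ (ρ • θ)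
  have db₁ := norm_lineDeriv_le b hθ (ρ • θ)
  have da₂ := norm_lineDeriv_lineDeriv_le a hθ (ρ • θ)
  have db₂ := norm_lineDeriv_lineDeriv_le b hθ (ρ • θ)
  have fa := firstNorm_nonneg a (ρ • θ)
  have fb := firstNorm_nonneg b (ρ • θ)
  have sa := secondNorm_nonneg a (ρ • θ)
  have sb := secondNorm_nonneg b (ρ • θ)
  have key := rayMajorant_le (h := h) (τ := τ) (q := ρ) (x := ‖a (ρ • θ)‖) (y := ‖b (ρ • θ)‖)
    (x₁ := firstNorm a (ρ • θ)) (y₁ := firstNorm b (ρ • θ)) (x₂ := secondNorm a (ρ • θ))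
    (y₂ := secondNorm b (ρ • θ)) hh hh1 hρ hτ hC.le (norm_nonneg _) (norm_nonneg _) fa fb sa sb
    b0 (b1.trans (by gcongr)) (b2.trans (by gcongr))
  refine key.trans_eq ?_
  simp only [dispMajorant, weightedNorm, hnorm ρ hρ]

lemma conj_rayE (c τ ρ : ℝ) : (starRingEnd ℂ) (rayE c τ ρ) = rayE c (-τ) ρ := by
  rw [rayE, rayE, ← Complex.exp_conj]
  congr 1
  simp

/-- Integrates the ray estimate over the sphere. The factor 2 accounts for the two spectral
components. -/
lemma exists_dispersive_bound : ∃ C : ℝ, 0 < C ∧ ∀ (a b : 𝓢(E3, E4)) (t h : ℝ), t ≠ 0 → 0 < h →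
    h ≤ 1 → ‖∫ ξ, (inner ℂ (diracExp t ξ (a ξ)) (b ξ) : ℂ)‖ₑ ≤
      ∫⁻ ξ, ENNReal.ofReal (C / |t| * dispMajorant h t a b ξ) := by
  obtain ⟨C, hC, hray⟩ := exists_ray_bound
  refine ⟨2 * C, by positivity, fun a b t h ht hh hh1 => ?_⟩
  have hmeas : Measurable fun ξ => ENNReal.ofReal (2 * C / |t| * dispMajorant h t a b ξ) :=
    ((measurable_dispMajorant h t a b).const_mul _).ennreal_ofReal
  rw [integral_polar (integrable_inner_diracExp t a b), lintegral_polar hmeas]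
  refine (enorm_integral_le_lintegral_enorm _).trans (lintegral_mono fun θ => ?_)
  have hθ : ‖(θ : E3)‖ = 1 := by simp
  obtain ⟨i1, l1⟩ := hray a b θ 1 (-t) h hθ (by simp) (neg_ne_zero.2 ht) hh hh1
  obtain ⟨i2, l2⟩ := hray a b θ (-1) t h hθ (by simp) ht hh hh1
  -- The inner product is conjugate linear in its first slot, which reverses the sign of time in
  -- both phases. This is harmless because the majorant is even in time.
  have heq : ∀ ρ ∈ Ioi (0 : ℝ),
      (inner ℂ (diracExp t (ρ • (θ : E3)) (a (ρ • (θ : E3)))) (b (ρ • (θ : E3))) : ℂ)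
        * ((ρ ^ 2 : ℝ) : ℂ) =
      rayE (2 * Real.pi) (-t) ρ *
        inner ℂ (rayProj 1 θ ρ (a (ρ • (θ : E3)))) (b (ρ • (θ : E3))) * ((ρ ^ 2 : ℝ) : ℂ) +
      rayE (2 * Real.pi) t ρ *
        inner ℂ (rayProj (-1) θ ρ (a (ρ • (θ : E3)))) (b (ρ • (θ : E3))) * ((ρ ^ 2 : ℝ) : ℂ) :=
    fun ρ hρ => by
      rw [diracExp_ray hθ (le_of_lt hρ), inner_add_left, inner_smul_left, inner_smul_left,
        conj_rayE, conj_rayE, neg_neg, add_mul]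
  rw [setIntegral_congr_fun measurableSet_Ioi heq, integral_add i1 i2]
  refine (enorm_add_le _ _).trans ((add_le_add l1 l2).trans_eq ?_)
  rw [← lintegral_add_left]
  · refine setLIntegral_congr_fun measurableSet_Ioi fun ρ _ => ?_
    have hd : dispMajorant h (-t) a b = dispMajorant h t a b := by
      funext ξ; simp only [dispMajorant, abs_neg]
    rw [hd, abs_neg, ← two_mul, mul_left_comm, mul_div_assoc, mul_assoc,
      ENNReal.ofReal_mul (p := 2) (by norm_num), ENNReal.ofReal_ofNat]
  · have h3 : Measurable fun ρ : ℝ => dispMajorant h (-t) a b (ρ • (θ : E3)) :=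
      (measurable_dispMajorant h (-t) a b).comp (by fun_prop)
    fun_prop

/-! ### Decay in time, in terms of norms of the Fourier transform -/

lemma lintegral_ofReal_mul_le {f g : E3 → ℝ} (hf : Measurable f) (hg : Measurable g) :
    ∫⁻ ξ, ENNReal.ofReal (f ξ * g ξ) ≤ eLpNorm f 2 volume * eLpNorm g 2 volume := by
  have h := eLpNorm_smul_le_mul_eLpNorm (p := 2) (q := 2) (r := 1) (μ := volume)
    hg.aestronglyMeasurable hf.aestronglyMeasurable
  rw [eLpNorm_one_eq_lintegral_enorm] at h
  refine le_trans (lintegral_mono fun ξ => ?_) h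
  rw [Pi.smul_apply', smul_eq_mul, ← ofReal_norm]
  exact ENNReal.ofReal_le_ofReal (Real.le_norm_self _)

/-- The choice h = |t|^{-1/32} gives |t|⁻¹h = |t|^{-33/32}, just integrable, while |t|⁻²h⁻⁸ =
|t|^{-7/4} multiplies the second derivatives. The latter rate leaves room to lose |t|^{1/2} when
truncating in space. Cauchy-Schwarz in frequency does the rest. -/
lemma exists_decay_large_time : ∃ C : ℝ, 0 < C ∧ ∀ (a b : 𝓢(E3, E4)) (t : ℝ), 1 ≤ |t| →
    ‖∫ ξ, (inner ℂ (diracExp t ξ (a ξ)) (b ξ) : ℂ)‖ₑ ≤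
      ENNReal.ofReal (C * |t| ^ (-(33 / 32) : ℝ)) *
        (eLpNorm (weightedNorm a) 2 volume * eLpNorm (weightedNorm b) 2 volume) +
      ENNReal.ofReal (C * |t| ^ (-(7 / 4) : ℝ)) *
        (eLpNorm (secondNorm a) 2 volume * eLpNorm (fun ξ => ‖b ξ‖) 2 volume +
          eLpNorm (fun ξ => ‖a ξ‖) 2 volume * eLpNorm (secondNorm b) 2 volume) := by
  obtain ⟨C, hC, hmain⟩ := exists_dispersive_bound
  refine ⟨22 * C, by positivity, fun a b t ht => ?_⟩
  have ht0 : 0 < |t| := by linarith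
  set h : ℝ := |t| ^ (-(1 / 32) : ℝ) with hh
  have h0 : 0 < h := Real.rpow_pos_of_pos ht0 _
  have h1 : h ≤ 1 := Real.rpow_le_one_of_one_le_of_nonpos ht (by norm_num)
  have h8 : |t|⁻¹ * (h ^ 8)⁻¹ = |t| ^ (-(3 / 4) : ℝ) := by
    rw [hh, ← Real.rpow_natCast, ← Real.rpow_mul ht0.le, ← Real.rpow_neg ht0.le,
      ← Real.rpow_neg_one, ← Real.rpow_add ht0]
    norm_num
  have h8' : |t|⁻¹ * (h ^ 8)⁻¹ ≤ h := by
    rw [h8, hh]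
    exact Real.rpow_le_rpow_of_exponent_le ht (by norm_num)
  have e1 : C / |t| * (22 * h) = 22 * C * |t| ^ (-(33 / 32) : ℝ) := by
    rw [show (-(33 / 32) : ℝ) = -1 + -(1 / 32) by norm_num, Real.rpow_add ht0, ← hh,
      Real.rpow_neg_one]
    ring
  have e2 : C / |t| * (2 * (|t|⁻¹ * (h ^ 8)⁻¹)) ≤ 22 * C * |t| ^ (-(7 / 4) : ℝ) := by
    rw [h8, show (-(7 / 4) : ℝ) = -1 + -(3 / 4) by norm_num, Real.rpow_add ht0,
      Real.rpow_neg_one]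
    have : 0 < |t| ^ (-(3 / 4) : ℝ) := Real.rpow_pos_of_pos ht0 _
    have h3 : 0 < C * (|t|⁻¹ * |t| ^ (-(3 / 4) : ℝ)) := by positivity
    calc C / |t| * (2 * |t| ^ (-(3 / 4) : ℝ)) = 2 * (C * (|t|⁻¹ * |t| ^ (-(3 / 4) : ℝ))) := by ring
      _ ≤ 22 * (C * (|t|⁻¹ * |t| ^ (-(3 / 4) : ℝ))) := by linarith
      _ = _ := by ring
  have ma := measurable_weightedNorm a
  have mb := measurable_weightedNorm b
  have na : Measurable fun ξ => ‖a ξ‖ := a.continuous.norm.measurable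
  have nb : Measurable fun ξ => ‖b ξ‖ := b.continuous.norm.measurable
  have sa := (continuous_secondNorm a).measurable
  have sb := (continuous_secondNorm b).measurable
  have wn : ∀ (c : 𝓢(E3, E4)) ξ, 0 ≤ weightedNorm c ξ := fun c ξ =>
    add_nonneg (mul_nonneg (zero_le_one.trans (one_le_singWeight _)) (norm_nonneg _))
      (firstNorm_nonneg _ _)
  calc ‖∫ ξ, (inner ℂ (diracExp t ξ (a ξ)) (b ξ) : ℂ)‖ₑ
      ≤ ∫⁻ ξ, ENNReal.ofReal (C / |t| * dispMajorant h t a b ξ) :=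
        hmain a b t h (by intro h; simp [h] at ht0) h0 h1
    _ ≤ ∫⁻ ξ, (ENNReal.ofReal (22 * C * |t| ^ (-(33 / 32) : ℝ)) *
          ENNReal.ofReal (weightedNorm a ξ * weightedNorm b ξ) +
        ENNReal.ofReal (22 * C * |t| ^ (-(7 / 4) : ℝ)) *
          (ENNReal.ofReal (secondNorm a ξ * ‖b ξ‖) + ENNReal.ofReal (‖a ξ‖ * secondNorm b ξ))) := by
        refine lintegral_mono fun ξ => ?_
        have p1 := mul_nonneg (wn a ξ) (wn b ξ)
        have p2 : 0 ≤ secondNorm a ξ * ‖b ξ‖ := mul_nonneg (secondNorm_nonneg _ _) (norm_nonneg _)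
        have p3 : 0 ≤ ‖a ξ‖ * secondNorm b ξ := mul_nonneg (norm_nonneg _) (secondNorm_nonneg _ _)
        rw [← ENNReal.ofReal_add p2 p3, ← ENNReal.ofReal_mul (by positivity),
          ← ENNReal.ofReal_mul (by positivity), ← ENNReal.ofReal_add (by positivity)
          (mul_nonneg (by positivity) (add_nonneg p2 p3))]
        refine ENNReal.ofReal_le_ofReal ?_
        unfold dispMajorant
        rw [mul_add, ← mul_assoc (C / |t|), ← mul_assoc (C / |t|), ← e1]
        refine add_le_add (mul_le_mul_of_nonneg_right ?_ p1)
          (mul_le_mul_of_nonneg_right e2 (add_nonneg p2 p3))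
        exact mul_le_mul_of_nonneg_left (by linarith) (by positivity)
    _ = ENNReal.ofReal (22 * C * |t| ^ (-(33 / 32) : ℝ)) *
          (∫⁻ ξ, ENNReal.ofReal (weightedNorm a ξ * weightedNorm b ξ)) +
        ENNReal.ofReal (22 * C * |t| ^ (-(7 / 4) : ℝ)) *
          ((∫⁻ ξ, ENNReal.ofReal (secondNorm a ξ * ‖b ξ‖)) +
            ∫⁻ ξ, ENNReal.ofReal (‖a ξ‖ * secondNorm b ξ)) := by
        have q1 : Measurable fun ξ => ENNReal.ofReal (weightedNorm a ξ * weightedNorm b ξ) :=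
          (ma.mul mb).ennreal_ofReal
        have q2 : Measurable fun ξ => ENNReal.ofReal (secondNorm a ξ * ‖b ξ‖) :=
          (sa.mul nb).ennreal_ofReal
        have q3 : Measurable fun ξ => ENNReal.ofReal (‖a ξ‖ * secondNorm b ξ) :=
          (na.mul sb).ennreal_ofReal
        rw [lintegral_add_left (q1.const_mul _), lintegral_const_mul _ q1,
          lintegral_const_mul (μ := volume) (f := fun ξ => ENNReal.ofReal (secondNorm a ξ * ‖b ξ‖) +
            ENNReal.ofReal (‖a ξ‖ * secondNorm b ξ)) _ (q2.add q3), lintegral_add_left q2]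
    _ ≤ _ := by
        exact add_le_add (mul_le_mul_right (lintegral_ofReal_mul_le ma mb) _)
          (mul_le_mul_right (add_le_add (lintegral_ofReal_mul_le sa nb)
            (lintegral_ofReal_mul_le na sb)) _)

/-! ### The singular weight is locally square integrable -/

/-- The part of the singular weight in the unit ball. -/
def singWeightIn (ξ : E3) : ℝ := (Metric.ball (0 : E3) 1).indicator (fun ξ => singWeight ‖ξ‖) ξ

lemma measurable_singWeightIn : Measurable singWeightIn :=
  (measurable_singWeight.comp measurable_norm).indicator measurableSet_ball

/-- In polar coordinates ρ²·(ρ^{-5/4})² = ρ^{-1/2} is integrable at 0; the exponent 5/4 is below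
3/2, half the dimension. -/
lemma eLpNorm_singWeightIn_lt_top : eLpNorm singWeightIn 2 volume < ∞ := by
  rw [eLpNorm_lt_top_iff_lintegral_rpow_enorm_lt_top (by norm_num) (by norm_num)]
  have hm : Measurable fun ξ => ‖singWeightIn ξ‖ₑ ^ (2 : ℝ≥0∞).toReal :=
    measurable_singWeightIn.enorm.pow_const _
  rw [lintegral_polar hm]
  have hb : ∀ θ : Metric.sphere (0 : E3) 1, ∫⁻ ρ in Ioi (0 : ℝ), ENNReal.ofReal (ρ ^ 2) *
      ‖singWeightIn (ρ • (θ : E3))‖ₑ ^ (2 : ℝ≥0∞).toReal ≤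
      ∫⁻ ρ in Ioc (0 : ℝ) 1, ENNReal.ofReal (4 * ρ ^ (-(1 / 2) : ℝ)) := by
    intro θ
    have hθ : ‖(θ : E3)‖ = 1 := by simp
    rw [← lintegral_indicator measurableSet_Ioi, ← lintegral_indicator measurableSet_Ioc]
    refine lintegral_mono fun ρ => ?_
    by_cases hρ : 0 < ρ
    · have hn : ‖ρ • (θ : E3)‖ = ρ := by rw [norm_smul, hθ, mul_one, Real.norm_of_nonneg hρ.le]
      rw [indicator_of_mem (show ρ ∈ Ioi (0 : ℝ) from hρ)]
      by_cases h1 : ρ < 1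
      · rw [indicator_of_mem (show ρ ∈ Ioc (0 : ℝ) 1 from ⟨hρ, h1.le⟩), singWeightIn,
          indicator_of_mem (by simpa [hn] using h1), hn, ← ofReal_norm,
          ENNReal.ofReal_rpow_of_nonneg (norm_nonneg _) (by norm_num),
          ← ENNReal.ofReal_mul (by positivity)]
        refine ENNReal.ofReal_le_ofReal ?_
        obtain ⟨z, hz, rfl⟩ : ∃ z : ℝ, 0 < z ∧ z ^ 4 = ρ := ⟨Real.sqrt (Real.sqrt ρ), by positivity, by
          rw [show (4 : ℕ) = 2 * 2 from rfl, pow_mul, Real.sq_sqrt (by positivity), Real.sq_sqrt hρ.le]⟩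
        have hz1 : z ≤ 1 := by
          by_contra hc
          push Not at hc
          linarith [one_le_pow₀ (n := 4) hc.le]
        have hs : singWeight (z ^ 4) = 1 + z⁻¹ ^ 5 := by
          unfold singWeight
          rw [show z ^ 4 = (z ^ 2) ^ 2 by ring, Real.sqrt_sq (by positivity), Real.sqrt_sq hz.le]
        have hr : (z ^ 4) ^ (-(1 / 2) : ℝ) = z⁻¹ ^ 2 := by
          rw [Real.rpow_neg (by positivity), ← Real.sqrt_eq_rpow, show z ^ 4 = (z ^ 2) ^ 2 by ring,
            Real.sqrt_sq (by positivity), inv_pow]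
        rw [hs, hr, Real.norm_of_nonneg (by positivity)]
        have h5 : 1 + z⁻¹ ^ 5 ≤ 2 * z⁻¹ ^ 5 := by
          linarith [one_le_pow₀ (n := 5) ((one_le_inv₀ hz).2 hz1)]
        calc (z ^ 4) ^ 2 * (1 + z⁻¹ ^ 5) ^ (2 : ℝ≥0∞).toReal
            = (z ^ 4) ^ 2 * (1 + z⁻¹ ^ 5) ^ 2 := by
              rw [ENNReal.toReal_ofNat]; norm_cast
          _ ≤ (z ^ 4) ^ 2 * (2 * z⁻¹ ^ 5) ^ 2 := by gcongr
          _ = 4 * z⁻¹ ^ 2 := by field_simp; norm_num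
      · rw [singWeightIn, indicator_of_notMem (by simpa [hn] using h1)]
        simp
    · rw [indicator_of_notMem (by simpa using hρ)]
      exact bot_le
  have hfin : ∫⁻ ρ in Ioc (0 : ℝ) 1, ENNReal.ofReal (4 * ρ ^ (-(1 / 2) : ℝ)) < ∞ := by
    have hi : IntervalIntegrable (fun ρ : ℝ => 4 * ρ ^ (-(1 / 2) : ℝ)) volume 0 1 :=
      (intervalIntegral.intervalIntegrable_rpow' (by norm_num)).const_mul 4
    rw [intervalIntegrable_iff_integrableOn_Ioc_of_le zero_le_one] at hi
    exact hi.lintegral_lt_top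
  refine (lintegral_mono hb).trans_lt ?_
  rw [lintegral_const]
  exact ENNReal.mul_lt_top hfin (measure_lt_top _ _)

/-- Inside the unit ball the singular weight is kept and the function replaced by its supremum;
outside, the weight is at most 2. -/
lemma weightedNorm_le (a : 𝓢(E3, E4)) {M : ℝ} (hM : ∀ ξ, ‖a ξ‖ ≤ M) (ξ : E3) :
    weightedNorm a ξ ≤ M * singWeightIn ξ + (2 * ‖a ξ‖ + firstNorm a ξ) := by
  unfold weightedNorm
  rw [← add_assoc]
  gcongr
  have h0 := norm_nonneg (a ξ)
  by_cases h : ‖ξ‖ < 1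
  · rw [singWeightIn, indicator_of_mem (by simpa using h), mul_comm]
    have := mul_le_mul_of_nonneg_right (hM ξ) (zero_le_one.trans (one_le_singWeight ‖ξ‖))
    linarith
  · rw [singWeightIn, indicator_of_notMem (by simpa using h), mul_zero, zero_add]
    gcongr
    unfold singWeight
    have h1 : 1 ≤ Real.sqrt (Real.sqrt ‖ξ‖) := by
      rw [Real.one_le_sqrt, Real.one_le_sqrt]; exact not_lt.1 h
    linarith [pow_le_one₀ (n := 5) (by positivity) (inv_le_one_of_one_le₀ h1)]

lemma eLpNorm_weightedNorm_le (a : 𝓢(E3, E4)) {M : ℝ} (hM : ∀ ξ, ‖a ξ‖ ≤ M) :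
    eLpNorm (weightedNorm a) 2 volume ≤ ENNReal.ofReal M * eLpNorm singWeightIn 2 volume +
      (2 * eLpNorm (fun ξ => ‖a ξ‖) 2 volume + eLpNorm (firstNorm a) 2 volume) := by
  have m1 := measurable_singWeightIn
  have m2 := a.continuous.norm.measurable
  have m3 := (continuous_firstNorm a).measurable
  have h0 : 0 ≤ M := (norm_nonneg _).trans (hM 0)
  calc eLpNorm (weightedNorm a) 2 volume
      ≤ eLpNorm ((M • singWeightIn) + ((2 : ℝ) • (fun ξ => ‖a ξ‖) + firstNorm a)) 2 volume := by
        refine eLpNorm_mono_real fun ξ => ?_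
        rw [Real.norm_of_nonneg (r := weightedNorm a ξ) (add_nonneg (mul_nonneg (zero_le_one.trans (one_le_singWeight _))
          (norm_nonneg _)) (firstNorm_nonneg _ _))]
        exact weightedNorm_le a hM ξ
    _ ≤ eLpNorm (M • singWeightIn) 2 volume + (eLpNorm ((2 : ℝ) • (fun ξ => ‖a ξ‖)) 2 volume +
          eLpNorm (firstNorm a) 2 volume) := by
        refine (eLpNorm_add_le (m1.const_smul M).aestronglyMeasurable
          ((m2.const_smul (2 : ℝ)).add m3).aestronglyMeasurable one_le_two).trans ?_
        gcongr
        exact eLpNorm_add_le (m2.const_smul (2 : ℝ)).aestronglyMeasurable m3.aestronglyMeasurable one_le_two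
    _ = _ := by
        rw [eLpNorm_const_smul, eLpNorm_const_smul, ← ofReal_norm, ← ofReal_norm,
          Real.norm_of_nonneg h0, Real.norm_of_nonneg zero_le_two, ENNReal.ofReal_ofNat]

/-! ### Weighted norms and the Fourier transform of Schwartz functions -/

lemma jap_rpow (x : E3) (k : ℝ) : jap x ^ k = (1 + ‖x‖ ^ 2) ^ (k / 2) := by
  rw [jap, Real.sqrt_eq_rpow, ← Real.rpow_mul (by positivity)]
  ring_nf

lemma norm_le_jap (x : E3) : ‖x‖ ≤ jap x := by
  unfold jap
  exact Real.le_sqrt_of_sq_le (by linarith)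

lemma continuous_jap_rpow (k : ℝ) : Continuous fun x => jap x ^ k :=
  continuous_jap.rpow_const fun x => Or.inl (jap_pos x).ne'

/-- The norm `‖⟨x⟩^k F‖_{L²}`. -/
def bracketNorm (k : ℝ) (F : E3 → E4) : ℝ≥0∞ := eLpNorm (fun x => jap x ^ k * ‖F x‖) 2 volume

lemma bracketNorm_mono {k l : ℝ} (h : k ≤ l) (F : E3 → E4) : bracketNorm k F ≤ bracketNorm l F := by
  refine eLpNorm_mono_real fun x => ?_
  have := Real.rpow_nonneg (jap_pos x).le k
  rw [Real.norm_of_nonneg (by positivity)]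
  gcongr
  exact one_le_jap x

lemma bracketNorm_zero (F : E3 → E4) : bracketNorm 0 F = eLpNorm F 2 volume := by
  simp only [bracketNorm, Real.rpow_zero, one_mul, eLpNorm_norm]

lemma eLpNorm_fourier (F : 𝓢(E3, E4)) :
    eLpNorm (fun ξ => ‖(𝓕 F : 𝓢(E3, E4)) ξ‖) 2 volume = bracketNorm 0 F := by
  rw [eLpNorm_norm, bracketNorm_zero]
  have h := SchwartzMap.norm_fourier_toL2_eq F
  rw [SchwartzMap.norm_toLp, SchwartzMap.norm_toLp] at h
  exact (ENNReal.toReal_eq_toReal_iff' ((𝓕 F : 𝓢(E3, E4)).memLp 2 volume).eLpNorm_ne_top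
    (F.memLp 2 volume).eLpNorm_ne_top).1 h

/-- Multiplication by `-2πi x_k`, which the Fourier transform turns into `∂_k`. -/
def coordMul (k : Fin 3) (F : 𝓢(E3, E4)) : 𝓢(E3, E4) :=
  -(2 * Real.pi * Complex.I) • SchwartzMap.smulLeftCLM E4 (fun x : E3 => inner ℝ x (stdVec k)) F

lemma lineDeriv_fourier (k : Fin 3) (F : 𝓢(E3, E4)) :
    ∂_{stdVec k} (𝓕 F : 𝓢(E3, E4)) = 𝓕 (coordMul k F) :=
  SchwartzMap.lineDerivOp_fourier_eq F (stdVec k)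

lemma norm_coordMul_le (k : Fin 3) (F : 𝓢(E3, E4)) (x : E3) :
    ‖coordMul k F x‖ ≤ 7 * (jap x * ‖F x‖) := by
  have h : (fun x : E3 => inner ℝ x (stdVec k)).HasTemperateGrowth := by fun_prop
  rw [coordMul, smul_apply, SchwartzMap.smulLeftCLM_apply_apply h, norm_smul, norm_smul]
  -- 7 is an integer upper bound for 2π.
  have h1 : ‖-(2 * Real.pi * Complex.I)‖ ≤ 7 := by
    rw [norm_neg, norm_mul, norm_mul, Complex.norm_I, Complex.norm_real,
      Real.norm_of_nonneg Real.pi_pos.le, Complex.norm_ofNat]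
    linarith [Real.pi_lt_d2]
  have h2 : ‖inner ℝ x (stdVec k)‖ ≤ jap x := by
    refine (norm_inner_le_norm _ _).trans ?_
    simpa using norm_le_jap x
  gcongr

lemma bracketNorm_coordMul_le (k : Fin 3) (F : 𝓢(E3, E4)) (l : ℝ) :
    bracketNorm l (coordMul k F) ≤ 7 * bracketNorm (l + 1) F := by
  have h7 : (7 : ℝ≥0∞) = ‖(7 : ℝ)‖ₑ := by
    rw [← ofReal_norm, Real.norm_of_nonneg (by norm_num), ENNReal.ofReal_ofNat]
  unfold bracketNorm
  rw [h7, ← eLpNorm_const_smul]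
  refine eLpNorm_mono_real fun x => ?_
  have h0 := Real.rpow_nonneg (jap_pos x).le l
  rw [Real.norm_of_nonneg (by positivity), Pi.smul_apply, smul_eq_mul, Real.rpow_add (jap_pos x),
    Real.rpow_one]
  calc jap x ^ l * ‖coordMul k F x‖ ≤ jap x ^ l * (7 * (jap x * ‖F x‖)) := by
        gcongr; exact norm_coordMul_le k F x
    _ = _ := by ring

/-- Each derivative in frequency is multiplication by -2πi x_k in space, hence costs 7⟨x⟩; three
coordinates give 21, and two derivatives 21² = 441. -/
lemma eLpNorm_firstNorm_fourier_le (F : 𝓢(E3, E4)) :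
    eLpNorm (firstNorm (𝓕 F)) 2 volume ≤ 21 * bracketNorm 1 F := by
  have h : firstNorm (𝓕 F) = ∑ k : Fin 3, fun ξ => ‖(𝓕 (coordMul k F) : 𝓢(E3, E4)) ξ‖ := by
    funext ξ
    rw [Finset.sum_apply]
    exact Finset.sum_congr rfl fun k _ => by rw [lineDeriv_fourier]
  rw [h]
  refine (eLpNorm_sum_le (fun k _ => (SchwartzMap.continuous _).norm.aestronglyMeasurable)
    one_le_two).trans ?_
  calc ∑ k : Fin 3, eLpNorm (fun ξ => ‖(𝓕 (coordMul k F) : 𝓢(E3, E4)) ξ‖) 2 volume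
      ≤ ∑ _k : Fin 3, 7 * bracketNorm 1 F := by
        refine Finset.sum_le_sum fun k _ => ?_
        rw [eLpNorm_fourier]
        simpa using bracketNorm_coordMul_le k F 0
    _ = 21 * bracketNorm 1 F := by
        rw [Finset.sum_const, Finset.card_univ, Fintype.card_fin, nsmul_eq_mul, ← mul_assoc]
        norm_num

lemma eLpNorm_secondNorm_fourier_le (F : 𝓢(E3, E4)) :
    eLpNorm (secondNorm (𝓕 F)) 2 volume ≤ 441 * bracketNorm 2 F := by
  have h : secondNorm (𝓕 F) = ∑ k : Fin 3, firstNorm (𝓕 (coordMul k F)) := by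
    funext ξ
    rw [Finset.sum_apply]
    exact Finset.sum_congr rfl fun k _ => by rw [lineDeriv_fourier]
  rw [h]
  refine (eLpNorm_sum_le (fun k _ => (continuous_firstNorm _).aestronglyMeasurable)
    one_le_two).trans ?_
  calc ∑ k : Fin 3, eLpNorm (firstNorm (𝓕 (coordMul k F))) 2 volume
      ≤ ∑ _k : Fin 3, 147 * bracketNorm 2 F := by
        refine Finset.sum_le_sum fun k _ => ?_
        refine (eLpNorm_firstNorm_fourier_le _).trans ?_
        refine (mul_le_mul_right (bracketNorm_coordMul_le k F 1) _).trans_eq ?_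
        rw [← mul_assoc]
        norm_num
    _ = 441 * bracketNorm 2 F := by
        rw [Finset.sum_const, Finset.card_univ, Fintype.card_fin, nsmul_eq_mul, ← mul_assoc]
        norm_num

/-- Square integrability of ⟨x⟩^{-N} in dimension 3 is exactly 2N > 3. -/
lemma eLpNorm_jap_lt_top {N : ℝ} (hN : 3 / 2 < N) :
    eLpNorm (fun x : E3 => jap x ^ (-N)) 2 volume < ∞ := by
  refine (MemLp.eLpNorm_lt_top ?_)
  rw [memLp_two_iff_integrable_sq (continuous_jap_rpow _).aestronglyMeasurable]
  have h : (Module.finrank ℝ E3 : ℝ) < 2 * N := by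
    rw [finrank_euclideanSpace_fin]; push_cast; linarith
  refine (integrable_rpow_neg_one_add_norm_sq (μ := volume) h).congr
    (Filter.Eventually.of_forall fun x => ?_)
  simp only
  rw [jap_rpow, ← Real.rpow_natCast ((1 + ‖x‖ ^ 2) ^ (-N / 2)), ← Real.rpow_mul (by positivity)]
  congr 1
  push_cast
  ring

/-- The Fourier transform is bounded by the L¹ norm, and Cauchy-Schwarz puts ⟨x⟩^N on the function
and ⟨x⟩^{-N} on the constant. -/
lemma enorm_fourier_le (F : 𝓢(E3, E4)) (N : ℝ) (ξ : E3) :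
    ‖(𝓕 F : 𝓢(E3, E4)) ξ‖ₑ ≤ eLpNorm (fun x : E3 => jap x ^ (-N)) 2 volume * bracketNorm N F := by
  have h1 : ‖(𝓕 F : 𝓢(E3, E4)) ξ‖ₑ ≤ eLpNorm F 1 volume := by
    have := SchwartzMap.norm_fourier_apply_le_toLp_one F ξ
    rw [SchwartzMap.norm_toLp] at this
    rw [← ofReal_norm, ← ENNReal.ofReal_toReal (F.memLp 1 volume).eLpNorm_ne_top]
    exact ENNReal.ofReal_le_ofReal this
  refine h1.trans ?_
  rw [← eLpNorm_norm]
  have h2 := eLpNorm_smul_le_mul_eLpNorm (p := 2) (q := 2) (r := 1) (μ := volume)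
    (f := fun x => jap x ^ N * ‖F x‖) (φ := fun x : E3 => jap x ^ (-N))
    ((continuous_jap_rpow N).mul F.continuous.norm).aestronglyMeasurable
    (continuous_jap_rpow (-N)).aestronglyMeasurable
  refine le_of_eq_of_le (congrArg (fun f => eLpNorm f 1 volume) ?_) h2
  funext x
  rw [Pi.smul_apply', smul_eq_mul, ← mul_assoc, ← Real.rpow_add (jap_pos x), neg_add_cancel,
    Real.rpow_zero, one_mul]

lemma bracketNorm_lt_top (k : ℝ) (F : 𝓢(E3, E4)) : bracketNorm k F < ∞ := by
  have hg : (fun x : E3 => (1 + ‖x‖ ^ 2) ^ (k / 2)).HasTemperateGrowth := by fun_prop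
  have h := ((SchwartzMap.smulLeftCLM E4 (fun x : E3 => (1 + ‖x‖ ^ 2) ^ (k / 2)) F).memLp
    2 volume).eLpNorm_lt_top
  rw [← eLpNorm_norm] at h
  refine lt_of_eq_of_lt (congrArg (fun f => eLpNorm f 2 volume) ?_) h
  funext x
  rw [SchwartzMap.smulLeftCLM_apply_apply hg, norm_smul, ← jap_rpow,
    Real.norm_of_nonneg (Real.rpow_nonneg (jap_pos x).le _)]

/-- The singular part uses the supremum of the Fourier transform, controlled because N > 3/2. The
regular part, 23 = 2 + 21, uses Plancherel and one power of ⟨x⟩, available since N ≥ 1. -/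
lemma exists_eLpNorm_weightedNorm_fourier_le {N : ℝ} (hN : 3 / 2 < N) :
    ∃ C : ℝ≥0, ∀ F : 𝓢(E3, E4), eLpNorm (weightedNorm (𝓕 F)) 2 volume ≤ C * bracketNorm N F := by
  have hJ := eLpNorm_jap_lt_top hN
  have hS := eLpNorm_singWeightIn_lt_top
  set J := eLpNorm (fun x : E3 => jap x ^ (-N)) 2 volume
  set S := eLpNorm singWeightIn 2 volume
  refine ⟨(J * S + 23).toNNReal, fun F => ?_⟩
  have hfin : J * S + 23 ≠ ∞ := ENNReal.add_ne_top.2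
    ⟨ENNReal.mul_ne_top hJ.ne hS.ne, by simp⟩
  rw [ENNReal.coe_toNNReal hfin]
  have hB := bracketNorm_lt_top N F
  have hsup : ∀ ξ, ‖(𝓕 F : 𝓢(E3, E4)) ξ‖ ≤ (J * bracketNorm N F).toReal := fun ξ => by
    rw [← toReal_enorm]
    exact ENNReal.toReal_mono (ENNReal.mul_ne_top hJ.ne hB.ne) (enorm_fourier_le F N ξ)
  refine (eLpNorm_weightedNorm_le _ hsup).trans ?_
  rw [ENNReal.ofReal_toReal (ENNReal.mul_ne_top hJ.ne hB.ne), eLpNorm_fourier]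
  calc J * bracketNorm N F * S + (2 * bracketNorm 0 F + eLpNorm (firstNorm (𝓕 F)) 2 volume)
      ≤ J * bracketNorm N F * S + (2 * bracketNorm N F + 21 * bracketNorm N F) := by
        gcongr
        · exact bracketNorm_mono (by linarith) _
        · refine (eLpNorm_firstNorm_fourier_le F).trans ?_
          gcongr
          exact bracketNorm_mono (by linarith) _
    _ = (J * S + 23) * bracketNorm N F := by ring

/-- The dispersive estimate with weights in physical space, for Schwartz functions. -/
lemma exists_schwartz_weighted_decay {N : ℝ} (hN : 3 / 2 < N) :
    ∃ C : ℝ, 0 < C ∧ ∀ (F G : 𝓢(E3, E4)) (t : ℝ), 1 ≤ |t| →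
      ‖(inner ℂ (freeGroup t (F.toLp 2)) (G.toLp 2) : ℂ)‖ₑ ≤
        ENNReal.ofReal (C * |t| ^ (-(33 / 32) : ℝ)) * (bracketNorm N F * bracketNorm N G) +
        ENNReal.ofReal (C * |t| ^ (-(7 / 4) : ℝ)) *
          (bracketNorm 2 F * bracketNorm 0 G + bracketNorm 0 F * bracketNorm 2 G) := by
  obtain ⟨C, hC, hmain⟩ := exists_decay_large_time
  obtain ⟨K, hK⟩ := exists_eLpNorm_weightedNorm_fourier_le hN
  refine ⟨C * (K ^ 2 + 441), by positivity, fun F G t ht => ?_⟩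
  have he : (inner ℂ (freeGroup t (F.toLp 2)) (G.toLp 2) : ℂ) =
      ∫ ξ, (inner ℂ (diracExp t ξ ((𝓕 F : 𝓢(E3, E4)) ξ)) ((𝓕 G : 𝓢(E3, E4)) ξ) : ℂ) := by
    have hF : ∀ F : 𝓢(E3, E4), fourierIso (F.toLp 2) = (𝓕 F : 𝓢(E3, E4)).toLp 2 := fun F =>
      SchwartzMap.toLp_fourier_eq F
    rw [← fourierIso.inner_map_map, fourierIso_freeGroup, L2.inner_def, hF, hF]
    refine integral_congr_ae ?_
    filter_upwards [fourierGroup_coeFn t ((𝓕 F : 𝓢(E3, E4)).toLp 2),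
      (𝓕 F : 𝓢(E3, E4)).coeFn_toLp 2, (𝓕 G : 𝓢(E3, E4)).coeFn_toLp 2] with ξ h1 h2 h3
    rw [h1, h2, h3]
  have ht0 : 0 < |t| := by linarith
  rw [he]
  refine (hmain _ _ t ht).trans ?_
  rw [eLpNorm_fourier, eLpNorm_fourier]
  have hpos : ∀ e : ℝ, 0 ≤ C * |t| ^ e := fun e => by positivity
  have hCe : ∀ e : ℝ, C * (K ^ 2 + 441) * |t| ^ e = C * |t| ^ e * (K ^ 2 + 441) := fun e => by ring
  rw [hCe, hCe, ENNReal.ofReal_mul (hpos _), ENNReal.ofReal_mul (hpos _), mul_assoc, mul_assoc]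
  have hKK : ENNReal.ofReal ((K : ℝ) ^ 2 + 441) = (K : ℝ≥0∞) ^ 2 + 441 := by
    rw [ENNReal.ofReal_add (by positivity) (by norm_num), ENNReal.ofReal_pow K.coe_nonneg,
      ENNReal.ofReal_coe_nnreal, ENNReal.ofReal_ofNat]
  rw [hKK]
  refine add_le_add (mul_le_mul_right ?_ _) (mul_le_mul_right ?_ _)
  · calc eLpNorm (weightedNorm (𝓕 F)) 2 volume * eLpNorm (weightedNorm (𝓕 G)) 2 volume
        ≤ (K * bracketNorm N F) * (K * bracketNorm N G) := mul_le_mul' (hK F) (hK G)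
      _ = K ^ 2 * (bracketNorm N F * bracketNorm N G) := by ring
      _ ≤ _ := by gcongr; exact le_self_add
  · calc eLpNorm (secondNorm (𝓕 F)) 2 volume * bracketNorm 0 G +
          bracketNorm 0 F * eLpNorm (secondNorm (𝓕 G)) 2 volume
        ≤ (441 * bracketNorm 2 F) * bracketNorm 0 G + bracketNorm 0 F * (441 * bracketNorm 2 G) := by
          gcongr
          · exact eLpNorm_secondNorm_fourier_le F
          · exact eLpNorm_secondNorm_fourier_le G
      _ = 441 * (bracketNorm 2 F * bracketNorm 0 G + bracketNorm 0 F * bracketNorm 2 G) := by ring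
      _ ≤ _ := by gcongr; exact le_add_self

/-! ### Negative powers of the Japanese bracket as operators -/

lemma bddField_jap (k : ℝ) : BddField (scalarField fun x => jap x ^ (-|k|)) :=
  .scalar (continuous_jap_rpow _).measurable (C := 1) fun x => by
    rw [abs_of_nonneg (Real.rpow_nonneg (jap_pos x).le _)]
    exact Real.rpow_le_one_of_one_le_of_nonpos (one_le_jap x) (neg_nonpos.2 (abs_nonneg k))

/-- Multiplication by `⟨x⟩^{-|k|}`. -/
def japOp (k : ℝ) : L2 →L[ℂ] L2 := pointwiseOp (bddField_jap k)

lemma japOp_coeFn {k : ℝ} (hk : 0 ≤ k) (f : L2) :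
    japOp k f =ᵐ[volume] fun x => jap x ^ (-k) • f x := by
  filter_upwards [pointwiseOp_scalar_coeFn (bddField_jap k) f] with x h
  rw [japOp, h, abs_of_nonneg hk]

lemma norm_japOp_le (k : ℝ) (f : L2) : ‖japOp k f‖ ≤ ‖f‖ := by
  refine (norm_pointwiseOp_le (bddField_jap k) (C := 1) (fun x => ?_) f).trans_eq (one_mul _)
  refine (norm_scalarField_le _ _).trans ?_
  rw [abs_of_nonneg (Real.rpow_nonneg (jap_pos x).le _)]
  exact Real.rpow_le_one_of_one_le_of_nonpos (one_le_jap x) (neg_nonpos.2 (abs_nonneg k))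

lemma japOp_japOp {k l : ℝ} (hk : 0 ≤ k) (hl : 0 ≤ l) (f : L2) :
    japOp k (japOp l f) = japOp (k + l) f := by
  refine Lp.ext ?_
  filter_upwards [japOp_coeFn hk (japOp l f), japOp_coeFn hl f,
    japOp_coeFn (add_nonneg hk hl) f] with x h1 h2 h3
  rw [h1, h2, h3, smul_smul, ← Real.rpow_add (jap_pos x), neg_add]

lemma inner_japOp (k : ℝ) (f g : L2) : inner ℂ (japOp k f) g = inner ℂ f (japOp k g) :=
  inner_pointwiseOp_left _ _ (fun x v w => by
    rw [scalarField_apply, scalarField_apply, RCLike.real_smul_eq_coe_smul (K := ℂ),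
      RCLike.real_smul_eq_coe_smul (K := ℂ), inner_smul_left, inner_smul_right, RCLike.conj_ofReal])
    f g

/-! ### Local decay on `L²` -/

lemma enorm_japOp_toLp {k : ℝ} (hk : 0 ≤ k) (h : 𝓢(E3, E4)) :
    ‖japOp k (h.toLp 2)‖ₑ = bracketNorm (-k) h := by
  rw [Lp.enorm_def]
  refine eLpNorm_congr_norm_ae ?_
  filter_upwards [japOp_coeFn hk (h.toLp 2), h.coeFn_toLp 2] with x h1 h2
  have := Real.rpow_nonneg (jap_pos x).le (-k)
  rw [h1, h2, norm_smul, Real.norm_of_nonneg this, Real.norm_of_nonneg (by positivity)]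

/-- The Schwartz function `⟨x⟩^{-2} h`. -/
def japSchwartz (h : 𝓢(E3, E4)) : 𝓢(E3, E4) :=
  SchwartzMap.smulLeftCLM E4 (fun x : E3 => (1 + ‖x‖ ^ 2) ^ (-1 : ℝ)) h

lemma japSchwartz_apply (h : 𝓢(E3, E4)) (x : E3) : japSchwartz h x = jap x ^ (-2 : ℝ) • h x := by
  rw [japSchwartz, SchwartzMap.smulLeftCLM_apply_apply (by fun_prop), jap_rpow]
  norm_num

lemma toLp_japSchwartz (h : 𝓢(E3, E4)) : (japSchwartz h).toLp 2 = japOp 2 (h.toLp 2) := by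
  refine Lp.ext ?_
  filter_upwards [japOp_coeFn zero_le_two (h.toLp 2), h.coeFn_toLp 2,
    (japSchwartz h).coeFn_toLp 2] with x h1 h2 h3
  rw [h1, h2, h3, japSchwartz_apply]

/-- Writing F = ⟨x⟩^{-2}h replaces the growing weights by bounded operators on h, so that the
dispersive estimate makes sense on all of L². -/
lemma bracketNorm_japSchwartz (h : 𝓢(E3, E4)) {k : ℝ} (hk : k ≤ 2) :
    bracketNorm k (japSchwartz h) = ‖japOp (2 - k) (h.toLp 2)‖ₑ := by
  rw [enorm_japOp_toLp (by linarith)]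
  refine congrArg (fun f => eLpNorm f 2 volume) (funext fun x => ?_)
  rw [japSchwartz_apply, norm_smul, Real.norm_of_nonneg (Real.rpow_nonneg (jap_pos x).le _),
    ← mul_assoc, ← Real.rpow_add (jap_pos x)]
  ring_nf

lemma japOp_zero (f : L2) : japOp 0 f = f := by
  refine Lp.ext ?_
  filter_upwards [japOp_coeFn le_rfl f] with x h
  rw [h, neg_zero, Real.rpow_zero, one_smul]

/-- In terms of h and g both sides are continuous on L² × L², so the inequality extends from
Schwartz functions by density. -/
lemma exists_weighted_decay_aux {N : ℝ} (hN : 3 / 2 < N) (hN2 : N ≤ 2) :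
    ∃ C : ℝ, 0 < C ∧ ∀ (h g : L2) (t : ℝ), 1 ≤ |t| →
      ‖(inner ℂ (freeGroup t (japOp 2 h)) (japOp 2 g) : ℂ)‖ ≤
        C * |t| ^ (-(33 / 32) : ℝ) * (‖japOp (2 - N) h‖ * ‖japOp (2 - N) g‖) +
        C * |t| ^ (-(7 / 4) : ℝ) * (‖h‖ * ‖japOp 2 g‖ + ‖japOp 2 h‖ * ‖g‖) := by
  obtain ⟨C, hC, hmain⟩ := exists_schwartz_weighted_decay hN
  refine ⟨C, hC, fun h g t ht => ?_⟩
  have hd : DenseRange (SchwartzMap.toLpCLM ℂ E4 2 (volume : Measure E3)) :=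
    SchwartzMap.denseRange_toLpCLM ENNReal.ofNat_ne_top
  refine hd.induction_on₂ (p := fun h g : L2 =>
      ‖(inner ℂ (freeGroup t (japOp 2 h)) (japOp 2 g) : ℂ)‖ ≤
        C * |t| ^ (-(33 / 32) : ℝ) * (‖japOp (2 - N) h‖ * ‖japOp (2 - N) g‖) +
        C * |t| ^ (-(7 / 4) : ℝ) * (‖h‖ * ‖japOp 2 g‖ + ‖japOp 2 h‖ * ‖g‖)) ?_ ?_ h g
  · refine isClosed_le ?_ ?_
    · exact (((freeGroup t).continuous.comp ((japOp 2).continuous.comp continuous_fst)).inner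
        ((japOp 2).continuous.comp continuous_snd)).norm
    · have c1 : ∀ k, Continuous fun q : L2 × L2 => ‖japOp k q.1‖ := fun k =>
        ((japOp k).continuous.comp continuous_fst).norm
      have c2 : ∀ k, Continuous fun q : L2 × L2 => ‖japOp k q.2‖ := fun k =>
        ((japOp k).continuous.comp continuous_snd).norm
      exact (continuous_const.mul ((c1 _).mul (c2 _))).add (continuous_const.mul
        ((continuous_fst.norm.mul (c2 2)).add ((c1 2).mul continuous_snd.norm)))
  · intro a b
    have hm := hmain (japSchwartz a) (japSchwartz b) t ht
    rw [toLp_japSchwartz, toLp_japSchwartz, bracketNorm_japSchwartz _ hN2,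
      bracketNorm_japSchwartz _ hN2, bracketNorm_japSchwartz _ le_rfl,
      bracketNorm_japSchwartz _ le_rfl, bracketNorm_japSchwartz _ zero_le_two,
      bracketNorm_japSchwartz _ zero_le_two, sub_zero, sub_self, japOp_zero, japOp_zero] at hm
    simp only [SchwartzMap.toLpCLM_apply]
    simp only [← ofReal_norm] at hm
    have ht0 : 0 < |t| := by linarith
    rw [← ENNReal.ofReal_mul (norm_nonneg _), ← ENNReal.ofReal_mul (norm_nonneg _),
      ← ENNReal.ofReal_mul (norm_nonneg _), ← ENNReal.ofReal_add (by positivity) (by positivity),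
      ← ENNReal.ofReal_mul (by positivity), ← ENNReal.ofReal_mul (by positivity),
      ← ENNReal.ofReal_add (by positivity) (by positivity),
      ENNReal.ofReal_le_ofReal_iff (by positivity)] at hm
    exact hm

/-- The witness is h = 1_{|x| ≤ R}⟨x⟩^{2-N}φ, for which ⟨x⟩^{-2}h is the truncation of ⟨x⟩^{-N}φ to
the ball of radius R. As 3/2 < N ≤ 2, the norm of h grows at most like R^{1/2} and the tail is at
most R^{-3/2}. -/
lemma exists_cutoff {N : ℝ} (hN : 3 / 2 < N) (hN2 : N ≤ 2) (φ : L2) {R : ℝ} (hR : 1 ≤ R) :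
    ∃ h : L2, ‖h‖ ≤ 2 * R ^ (1 / 2 : ℝ) * ‖φ‖ ∧ ‖japOp (2 - N) h‖ ≤ ‖φ‖ ∧ ‖japOp 2 h‖ ≤ ‖φ‖ ∧
      ‖japOp N φ - japOp 2 h‖ ≤ R ^ (-(3 / 2) : ℝ) * ‖φ‖ := by
  have hR0 : 0 < R := by linarith
  set w : E3 → ℝ := (Metric.closedBall (0 : E3) R).indicator fun x => jap x ^ (2 - N) with hw
  have hwm : Measurable w :=
    (continuous_jap_rpow _).measurable.indicator Metric.isClosed_closedBall.measurableSet
  have hjR : ∀ x ∈ Metric.closedBall (0 : E3) R, jap x ≤ 2 * R := fun x hx => by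
    rw [mem_closedBall_zero_iff] at hx
    unfold jap
    rw [Real.sqrt_le_left (by positivity)]
    nlinarith [norm_nonneg x]
  have hin : ∀ x ∈ Metric.closedBall (0 : E3) R, w x = jap x ^ (2 - N) := fun x hx => indicator_of_mem hx _
  have hout : ∀ x ∉ Metric.closedBall (0 : E3) R, w x = 0 := fun x hx => indicator_of_notMem hx _
  have hwb : ∀ x, |w x| ≤ 2 * R ^ (1 / 2 : ℝ) := fun x => by
    by_cases hx : x ∈ Metric.closedBall (0 : E3) R
    · rw [hin x hx, abs_of_nonneg (Real.rpow_nonneg (jap_pos x).le _)]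
      calc jap x ^ (2 - N) ≤ jap x ^ (1 / 2 : ℝ) :=
            Real.rpow_le_rpow_of_exponent_le (one_le_jap x) (by linarith)
        _ ≤ (2 * R) ^ (1 / 2 : ℝ) := Real.rpow_le_rpow (jap_pos x).le (hjR x hx) (by norm_num)
        _ = 2 ^ (1 / 2 : ℝ) * R ^ (1 / 2 : ℝ) := Real.mul_rpow zero_le_two hR0.le
        _ ≤ 2 ^ (1 : ℝ) * R ^ (1 / 2 : ℝ) := by gcongr <;> norm_num
        _ = _ := by rw [Real.rpow_one]
    · rw [hout x hx, abs_zero]; positivity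
  have hB := BddField.scalar hwm hwb
  have hle : ∀ k : ℝ, 2 - N ≤ k → ‖japOp k (pointwiseOp hB φ)‖ ≤ ‖φ‖ := fun k hk => by
    have hk0 : 0 ≤ k := by linarith
    refine (Lp.norm_le_mul_norm_of_ae_le_mul (c := 1) ?_).trans_eq (one_mul _)
    filter_upwards [japOp_coeFn hk0 (pointwiseOp hB φ), pointwiseOp_scalar_coeFn hB φ] with x h1 h2
    rw [h1, h2, smul_smul, norm_smul]
    gcongr
    by_cases hx : x ∈ Metric.closedBall (0 : E3) R
    · rw [hin x hx, ← Real.rpow_add (jap_pos x), Real.norm_of_nonneg (Real.rpow_nonneg (jap_pos x).le _)]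
      exact Real.rpow_le_one_of_one_le_of_nonpos (one_le_jap x) (by linarith)
    · rw [hout x hx]; simp
  refine ⟨pointwiseOp hB φ, ?_, hle _ le_rfl, hle _ (by linarith), ?_⟩
  · exact norm_pointwiseOp_le hB (fun x => (norm_scalarField_le w x).trans (hwb x)) φ
  · refine Lp.norm_le_mul_norm_of_ae_le_mul ?_
    filter_upwards [japOp_coeFn zero_le_two (pointwiseOp hB φ), pointwiseOp_scalar_coeFn hB φ,
      japOp_coeFn (k := N) (by linarith) φ,
      Lp.coeFn_sub (japOp N φ) (japOp 2 (pointwiseOp hB φ))] with x h1 h2 h3 h4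
    rw [h4, Pi.sub_apply, h1, h2, h3, smul_smul, ← sub_smul, norm_smul]
    gcongr
    by_cases hx : x ∈ Metric.closedBall (0 : E3) R
    · rw [hin x hx, ← Real.rpow_add (jap_pos x), show (-2 : ℝ) + (2 - N) = -N by ring, sub_self,
        norm_zero]
      positivity
    · rw [hout x hx, mul_zero, sub_zero, Real.norm_of_nonneg (Real.rpow_nonneg (jap_pos x).le _)]
      rw [mem_closedBall_zero_iff, not_le] at hx
      calc jap x ^ (-N) ≤ jap x ^ (-(3 / 2) : ℝ) :=
            Real.rpow_le_rpow_of_exponent_le (one_le_jap x) (by linarith)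
        _ ≤ R ^ (-(3 / 2) : ℝ) :=
            Real.rpow_le_rpow_of_nonpos hR0 (hx.le.trans (norm_le_jap x)) (by norm_num)

/-- The integrable kernel `(1 + |t|)^{-33/32}` governing local decay. -/
def decayKernel (t : ℝ) : ℝ := (1 + |t|) ^ (-(33 / 32) : ℝ)

lemma decayKernel_nonneg (t : ℝ) : 0 ≤ decayKernel t := Real.rpow_nonneg (by positivity) _

lemma continuous_decayKernel : Continuous decayKernel :=
  (continuous_const.add continuous_abs).rpow_const fun t =>
    Or.inl (show (0 : ℝ) < 1 + |t| by positivity).ne'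

lemma integrable_decayKernel : Integrable decayKernel := by
  have h := integrable_one_add_norm (E := ℝ) (μ := volume) (r := 33 / 32) (by simp; norm_num)
  exact h

/-- For |t| ≤ 1 unitarity suffices. For |t| ≥ 1 both functions are truncated at radius |t|: the
truncated parts satisfy the weighted estimate, with a loss of |t|^{1/2} in its second term, and the
tails decay like |t|^{-3/2}, which is integrable by itself. -/
lemma exists_local_decay_of_le_two {N : ℝ} (hN : 3 / 2 < N) (hN2 : N ≤ 2) :
    ∃ C : ℝ, 0 < C ∧ ∀ (φ ψ : L2) (t : ℝ),
      ‖(inner ℂ (freeGroup t (japOp N φ)) (japOp N ψ) : ℂ)‖ ≤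
        C * decayKernel t * (‖φ‖ * ‖ψ‖) := by
  obtain ⟨C, hC, hmain⟩ := exists_weighted_decay_aux hN hN2
  refine ⟨4 * (5 * C + 3), by positivity, fun φ ψ t => ?_⟩
  have hb : 0 < 1 + |t| := by positivity
  -- Used to replace |t|, or 1 when |t| ≤ 1, by 1 + |t| in the decay rate: 1 + |t| is at most twice
  -- max(1, |t|), and the exponent is above -2.
  have h4 : (1 : ℝ) ≤ 4 * (2 : ℝ) ^ (-(33 / 32) : ℝ) := by
    have : (2 : ℝ) ^ (-2 : ℝ) ≤ (2 : ℝ) ^ (-(33 / 32) : ℝ) :=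
      Real.rpow_le_rpow_of_exponent_le one_le_two (by norm_num)
    rw [Real.rpow_neg zero_le_two, Real.rpow_ofNat] at this
    linarith
  have hsub : ∀ f g : L2, ‖(inner ℂ (freeGroup t f) g : ℂ)‖ ≤ ‖f‖ * ‖g‖ := fun f g => by
    refine (norm_inner_le_norm _ _).trans_eq ?_
    rw [norm_freeGroup]
  rcases le_total |t| 1 with ht | ht
  · have hk : 1 ≤ 4 * decayKernel t := by
      refine h4.trans ?_
      unfold decayKernel
      gcongr ?_ * ?_
      exact Real.rpow_le_rpow_of_nonpos hb (by linarith) (by norm_num)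
    calc ‖(inner ℂ (freeGroup t (japOp N φ)) (japOp N ψ) : ℂ)‖ ≤ ‖japOp N φ‖ * ‖japOp N ψ‖ := hsub _ _
      _ ≤ ‖φ‖ * ‖ψ‖ := by gcongr <;> exact norm_japOp_le _ _
      _ ≤ 4 * (5 * C + 3) * decayKernel t * (‖φ‖ * ‖ψ‖) := by
        refine le_mul_of_one_le_left (by positivity) ?_
        nlinarith [decayKernel_nonneg t]
  · have ht0 : 0 < |t| := by linarith
    have hk : |t| ^ (-(33 / 32) : ℝ) ≤ 4 * decayKernel t := by
      calc |t| ^ (-(33 / 32) : ℝ) ≤ 4 * (2 : ℝ) ^ (-(33 / 32) : ℝ) * |t| ^ (-(33 / 32) : ℝ) :=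
            le_mul_of_one_le_left (by positivity) h4
        _ = 4 * (2 * |t|) ^ (-(33 / 32) : ℝ) := by rw [Real.mul_rpow zero_le_two ht0.le]; ring
        _ ≤ _ := by
          unfold decayKernel
          gcongr ?_ * ?_
          exact Real.rpow_le_rpow_of_nonpos hb (by linarith) (by norm_num)
    obtain ⟨h, a1, a2, a3, a4⟩ := exists_cutoff hN hN2 φ ht
    obtain ⟨g, b1, b2, b3, b4⟩ := exists_cutoff hN hN2 ψ ht
    have hsplit : (inner ℂ (freeGroup t (japOp N φ)) (japOp N ψ) : ℂ) =
        inner ℂ (freeGroup t (japOp 2 h)) (japOp 2 g) +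
        inner ℂ (freeGroup t (japOp N φ - japOp 2 h)) (japOp N ψ) +
        inner ℂ (freeGroup t (japOp 2 h)) (japOp N ψ - japOp 2 g) := by
      rw [map_sub, inner_sub_left, inner_sub_right]; ring
    rw [hsplit]
    have q1 := hmain h g t ht
    have q2 := (hsub (japOp N φ - japOp 2 h) (japOp N ψ)).trans
      (mul_le_mul a4 (norm_japOp_le N ψ) (norm_nonneg _) (by positivity))
    have q3 := (hsub (japOp 2 h) (japOp N ψ - japOp 2 g)).trans
      (mul_le_mul a3 b4 (norm_nonneg _) (norm_nonneg _))
    have r1 := mul_le_mul a2 b2 (norm_nonneg _) (norm_nonneg _)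
    have r2 := mul_le_mul a1 b3 (norm_nonneg _) (by positivity)
    have r3 := mul_le_mul a3 b1 (norm_nonneg _) (norm_nonneg _)
    -- -7/4 + 1/2 = -5/4, still below -33/32.
    have e1 : |t| ^ (-(7 / 4) : ℝ) * |t| ^ (1 / 2 : ℝ) ≤ |t| ^ (-(33 / 32) : ℝ) := by
      rw [← Real.rpow_add ht0]
      exact Real.rpow_le_rpow_of_exponent_le ht (by norm_num)
    have e2 : |t| ^ (-(3 / 2) : ℝ) ≤ |t| ^ (-(33 / 32) : ℝ) :=
      Real.rpow_le_rpow_of_exponent_le ht (by norm_num)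
    have hp : 0 ≤ |t| ^ (-(33 / 32) : ℝ) := Real.rpow_nonneg ht0.le _
    have hA : 0 ≤ |t| ^ (-(7 / 4) : ℝ) := Real.rpow_nonneg ht0.le _
    refine norm_add₃_le.trans ((add_le_add (add_le_add q1 q2) q3).trans ?_)
    have hxy : 0 ≤ ‖φ‖ * ‖ψ‖ := by positivity
    generalize |t| ^ (-(33 / 32) : ℝ) = p at *
    generalize |t| ^ (-(7 / 4) : ℝ) = A at *
    generalize |t| ^ (-(3 / 2) : ℝ) = B at *
    generalize |t| ^ (1 / 2 : ℝ) = D at *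
    generalize ‖japOp (2 - N) h‖ * ‖japOp (2 - N) g‖ = X at *
    generalize ‖h‖ * ‖japOp 2 g‖ = Y at *
    generalize ‖japOp 2 h‖ * ‖g‖ = Z at *
    generalize ‖φ‖ = x at *
    generalize ‖ψ‖ = y at *
    calc C * p * X + C * A * (Y + Z) + B * x * y + x * (B * y)
        ≤ C * p * (x * y) + C * A * (2 * D * x * y + x * (2 * D * y)) + B * x * y + x * (B * y) := by
          gcongr
      _ = C * p * (x * y) + 4 * C * (A * D) * (x * y) + 2 * B * (x * y) := by ring
      _ ≤ C * p * (x * y) + 4 * C * p * (x * y) + 2 * p * (x * y) := by gcongr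
      _ = (5 * C + 2) * p * (x * y) := by ring
      _ ≤ (5 * C + 3) * (4 * decayKernel t) * (x * y) := by gcongr; norm_num
      _ = _ := by ring

/-- Local decay for the free Dirac group. -/
theorem exists_local_decay {N : ℝ} (hN : 3 / 2 < N) :
    ∃ C : ℝ, 0 < C ∧ ∀ (φ ψ : L2) (t : ℝ),
      ‖(inner ℂ (freeGroup t (japOp N φ)) (japOp N ψ) : ℂ)‖ ≤
        C * decayKernel t * (‖φ‖ * ‖ψ‖) := by
  rcases le_total N 2 with h | h
  · exact exists_local_decay_of_le_two hN h
  · obtain ⟨C, hC, hmain⟩ := exists_local_decay_of_le_two (N := 2) (by norm_num) le_rfl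
    refine ⟨C, hC, fun φ ψ t => ?_⟩
    have hs : ∀ f : L2, japOp N f = japOp 2 (japOp (N - 2) f) := fun f => by
      rw [japOp_japOp zero_le_two (by linarith)]; ring_nf
    rw [hs, hs]
    refine (hmain _ _ t).trans ?_
    have := decayKernel_nonneg t
    gcongr <;> exact norm_japOp_le _ _

/-! ### Square integrals of functions of time -/

section Time

variable {μ : Measure ℝ}

lemma sq_eLpNorm_two (g : ℝ → ℝ≥0∞) : eLpNorm g 2 μ ^ 2 = ∫⁻ t, g t ^ 2 ∂μ := by
  rw [eLpNorm_eq_lintegral_rpow_enorm_toReal two_ne_zero ENNReal.ofNat_ne_top,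
    ← ENNReal.rpow_natCast, ← ENNReal.rpow_mul]
  simp

lemma lintegral_mul_le_eLpNorm {f g : ℝ → ℝ≥0∞} (hf : AEMeasurable f μ) (hg : AEMeasurable g μ) :
    ∫⁻ t, f t * g t ∂μ ≤ eLpNorm f 2 μ * eLpNorm g 2 μ := by
  have h := ENNReal.lintegral_mul_le_Lp_mul_Lq μ (p := 2) (q := 2) Real.HolderConjugate.two_two hf hg
  simpa [eLpNorm_eq_lintegral_rpow_enorm_toReal] using h

lemma eLpNorm_const_mul_two {g : ℝ → ℝ≥0∞} (c : ℝ≥0∞) (hg : AEMeasurable g μ) :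
    eLpNorm (fun t => c * g t) 2 μ = c * eLpNorm g 2 μ := by
  refine (ENNReal.pow_right_strictMono two_ne_zero).injective ?_
  simp only [mul_pow, sq_eLpNorm_two]
  rw [lintegral_const_mul'' _ (hg.pow_const 2)]

/-- Cauchy-Schwarz after splitting k = k^{1/2}·k^{1/2}, as in the Schur test; this is the pointwise
half of Young's inequality. -/
lemma sq_lintegral_mul_le {k g : ℝ → ℝ≥0∞} (hk : AEMeasurable k μ) (hg : AEMeasurable g μ) :
    (∫⁻ t, k t * g t ∂μ) ^ 2 ≤ (∫⁻ t, k t ∂μ) * ∫⁻ t, k t * g t ^ 2 ∂μ := by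
  have hs : ∀ x : ℝ≥0∞, x ^ (1 / 2 : ℝ) * x ^ (1 / 2 : ℝ) = x := fun x => by
    rw [← ENNReal.rpow_add_of_nonneg _ _ (by norm_num) (by norm_num)]
    norm_num
  have hk2 : AEMeasurable (fun t => k t ^ (1 / 2 : ℝ)) μ := hk.pow_const _
  have h := lintegral_mul_le_eLpNorm hk2 (hk2.mul hg)
  have h2 := pow_le_pow_left' h 2
  rw [mul_pow, sq_eLpNorm_two, sq_eLpNorm_two] at h2
  simp only [Pi.mul_apply, ← mul_assoc, hs] at h2
  simpa only [mul_pow, sq (_ ^ (1 / 2 : ℝ)), hs] using h2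

lemma aemeasurable_conv [SFinite μ] {k g : ℝ → ℝ≥0∞} (hk : Measurable k) (hg : AEMeasurable g μ) :
    AEMeasurable (fun t => ∫⁻ τ, k (t - τ) * g τ ∂μ) μ := by
  have h1 : AEMeasurable (fun z : ℝ × ℝ => k (z.1 - z.2) * g z.2) (μ.prod μ) :=
    (hk.comp (measurable_fst.sub measurable_snd)).aemeasurable.mul hg.comp_snd
  exact h1.lintegral_prod_right'

/-- Young's inequality for a kernel that is integrable over the line. -/
lemma eLpNorm_conv_le {s : Set ℝ} {k g : ℝ → ℝ≥0∞} (hk : Measurable k)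
    (hg : AEMeasurable g (volume.restrict s)) :
    eLpNorm (fun t => ∫⁻ τ in s, k (t - τ) * g τ) 2 (volume.restrict s) ≤
      (∫⁻ t, k t) * eLpNorm g 2 (volume.restrict s) := by
  refine (ENNReal.pow_le_pow_left_iff two_ne_zero).1 ?_
  rw [mul_pow, sq_eLpNorm_two, sq_eLpNorm_two]
  set κ := ∫⁻ t, k t
  have h1 : ∀ t, ∫⁻ τ in s, k (t - τ) ≤ κ := fun t =>
    (setLIntegral_le_lintegral _ _).trans_eq (lintegral_sub_left_eq_self k t)
  have h2 : ∀ τ, ∫⁻ t in s, k (t - τ) ≤ κ := fun τ =>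
    (setLIntegral_le_lintegral _ _).trans_eq (lintegral_sub_right_eq_self k τ)
  have hm : AEMeasurable (fun z : ℝ × ℝ => k (z.1 - z.2) * g z.2 ^ 2)
      ((volume.restrict s).prod (volume.restrict s)) :=
    (hk.comp (measurable_fst.sub measurable_snd)).aemeasurable.mul (hg.pow_const 2).comp_snd
  calc ∫⁻ t in s, (∫⁻ τ in s, k (t - τ) * g τ) ^ 2
      ≤ ∫⁻ t in s, κ * ∫⁻ τ in s, k (t - τ) * g τ ^ 2 := by
        refine lintegral_mono fun t => ?_
        refine (sq_lintegral_mul_le (hk.comp (measurable_const.sub measurable_id)).aemeasurable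
          hg).trans ?_
        exact mul_le_mul_left (h1 t) _
    _ = κ * ∫⁻ τ in s, ∫⁻ t in s, k (t - τ) * g τ ^ 2 := by
        rw [lintegral_const_mul'' _ hm.lintegral_prod_right', lintegral_lintegral_swap hm]
    _ ≤ κ * ∫⁻ τ in s, κ * g τ ^ 2 := by
        gcongr with τ
        have hm' : Measurable fun t => k (t - τ) := hk.comp (measurable_id.sub measurable_const)
        rw [lintegral_mul_const _ hm']
        exact mul_le_mul_left (h2 τ) _
    _ = κ ^ 2 * ∫⁻ τ in s, g τ ^ 2 := by
        rw [lintegral_const_mul'' _ (hg.pow_const 2), ← mul_assoc, sq]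

end Time

/-! ### Smoothing estimates from local decay -/

/-- The operator `Q` satisfies local decay along the free group, with kernel `k`. -/
structure LocalDecay (Q : L2 →L[ℂ] L2) (k : ℝ → ℝ≥0∞) : Prop where
  symm : ∀ f g : L2, inner ℂ (Q f) g = inner ℂ f (Q g)
  meas : Measurable k
  decay : ∀ (φ ψ : L2) (t : ℝ), ‖(inner ℂ (freeGroup t (Q φ)) (Q ψ) : ℂ)‖ₑ ≤ k t * (‖φ‖ₑ * ‖ψ‖ₑ)

/-- On `s`, the forcing term `F` is of the form `Q z` with `‖z‖ ≤ g`. -/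
def ForcingBound (Q : L2 →L[ℂ] L2) (s : Set ℝ) (F : ℝ → L2) (g : ℝ → ℝ≥0∞) : Prop :=
  ∀ᵐ τ ∂(volume.restrict s), ∃ z : L2, Q z = F τ ∧ ‖z‖ₑ ≤ g τ

lemma ForcingBound.mono {Q : L2 →L[ℂ] L2} {s s' : Set ℝ} {F : ℝ → L2} {g : ℝ → ℝ≥0∞}
    (h : ForcingBound Q s F g) (hs : s' ⊆ s) : ForcingBound Q s' F g :=
  ae_mono (Measure.restrict_mono hs le_rfl) h

section Smoothing

variable {Q : L2 →L[ℂ] L2} {k : ℝ → ℝ≥0∞}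

lemma enorm_inner_self (f : L2) : ‖(inner ℂ f f : ℂ)‖ₑ = ‖f‖ₑ ^ 2 := by
  rw [inner_self_eq_norm_sq_to_K, ← ofReal_norm, norm_pow, RCLike.norm_ofReal, abs_norm,
    ENNReal.ofReal_pow (norm_nonneg _), ofReal_norm]

lemma enorm_inner_le (f g : L2) : ‖(inner ℂ f g : ℂ)‖ₑ ≤ ‖f‖ₑ * ‖g‖ₑ := by
  rw [← ofReal_norm, ← ofReal_norm, ← ofReal_norm, ← ENNReal.ofReal_mul (norm_nonneg _)]
  exact ENNReal.ofReal_le_ofReal (norm_inner_le_norm _ _)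

/-- The `TT*` inequality. -/
lemma LocalDecay.enorm_integral_sq_le (hQ : LocalDecay Q k) {s : Set ℝ} {F : ℝ → L2}
    {g : ℝ → ℝ≥0∞} (hF : ForcingBound Q s F g) (hg : AEMeasurable g (volume.restrict s))
    (hi : IntegrableOn (fun τ => freeGroup (-τ) (F τ)) s) :
    ‖∫ τ in s, freeGroup (-τ) (F τ)‖ₑ ^ 2 ≤
      (∫⁻ t, k t) * eLpNorm g 2 (volume.restrict s) ^ 2 := by
  set J := ∫ τ in s, freeGroup (-τ) (F τ) with hJ
  have h1 : ‖J‖ₑ ^ 2 = ‖(inner ℂ J J : ℂ)‖ₑ := (enorm_inner_self J).symm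
  have h2 : ∀ᵐ τ ∂(volume.restrict s), ‖(inner ℂ J (freeGroup (-τ) (F τ)) : ℂ)‖ₑ ≤
      g τ * ∫⁻ τ' in s, k (τ - τ') * g τ' := by
    filter_upwards [hF] with τ hτ
    obtain ⟨z, hz, hzg⟩ := hτ
    rw [← ofReal_norm, norm_inner_symm, ofReal_norm, hJ, ← integral_inner hi]
    refine (enorm_integral_le_lintegral_enorm _).trans ?_
    have hm' : Measurable fun τ' => k (τ - τ') := hQ.meas.comp (measurable_const.sub measurable_id)
    have hm'' : AEMeasurable (fun τ' => k (τ - τ') * g τ') (volume.restrict s) :=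
      hm'.aemeasurable.mul hg
    rw [← lintegral_const_mul'' _ hm'']
    refine lintegral_mono_ae ?_
    filter_upwards [hF] with τ' hτ'
    obtain ⟨z', hz', hzg'⟩ := hτ'
    -- By unitarity and the group law the two times enter only through their difference, which
    -- produces a convolution kernel.
    have he : (inner ℂ (freeGroup (-τ) (F τ)) (freeGroup (-τ') (F τ')) : ℂ) =
        starRingEnd ℂ (inner ℂ (freeGroup (τ - τ') (Q z')) (Q z)) := by
      rw [inner_conj_symm, hz, hz', sub_eq_add_neg, freeGroup_add, inner_freeGroup, neg_neg]
    rw [he, RCLike.enorm_conj]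
    refine (hQ.decay _ _ _).trans ?_
    calc k (τ - τ') * (‖z'‖ₑ * ‖z‖ₑ) ≤ k (τ - τ') * (g τ' * g τ) := by gcongr
      _ = _ := by ring
  calc ‖J‖ₑ ^ 2 = ‖∫ τ in s, (inner ℂ J (freeGroup (-τ) (F τ)) : ℂ)‖ₑ := by
        rw [h1, integral_inner hi]
    _ ≤ ∫⁻ τ in s, ‖(inner ℂ J (freeGroup (-τ) (F τ)) : ℂ)‖ₑ := enorm_integral_le_lintegral_enorm _
    _ ≤ ∫⁻ τ in s, g τ * ∫⁻ τ' in s, k (τ - τ') * g τ' := lintegral_mono_ae h2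
    _ ≤ eLpNorm g 2 (volume.restrict s) * ((∫⁻ t, k t) * eLpNorm g 2 (volume.restrict s)) := by
        refine (lintegral_mul_le_eLpNorm hg (aemeasurable_conv hQ.meas hg)).trans ?_
        gcongr
        exact eLpNorm_conv_le hQ.meas hg
    _ = _ := by ring

/-- Strong continuity together with the isometry property gives joint continuity. -/
lemma continuous_freeGroup_uncurry : Continuous fun q : ℝ × L2 => freeGroup q.1 q.2 := by
  rw [continuous_iff_continuousAt]
  intro ⟨t, f⟩
  rw [ContinuousAt, tendsto_iff_norm_sub_tendsto_zero]
  have h1 : Filter.Tendsto (fun q : ℝ × L2 => ‖q.2 - f‖ + ‖freeGroup q.1 f - freeGroup t f‖)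
      (𝓝 (t, f)) (𝓝 0) := by
    have hc : Continuous fun q : ℝ × L2 => ‖q.2 - f‖ + ‖freeGroup q.1 f - freeGroup t f‖ :=
      (continuous_snd.sub continuous_const).norm.add
        (((continuous_freeGroup f).comp continuous_fst).sub continuous_const).norm
    simpa using hc.tendsto (t, f)
  refine squeeze_zero (fun _ => norm_nonneg _) (fun q => ?_) h1
  calc ‖freeGroup q.1 q.2 - freeGroup t f‖
      = ‖freeGroup q.1 (q.2 - f) + (freeGroup q.1 f - freeGroup t f)‖ := by
        rw [map_sub]; congr 1; abel
    _ ≤ _ := (norm_add_le _ _).trans_eq (by rw [norm_freeGroup])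

lemma continuousOn_freeGroup_neg {s : Set ℝ} {F : ℝ → L2} (hF : ContinuousOn F s) :
    ContinuousOn (fun τ => freeGroup (-τ) (F τ)) s := by
  have h : ContinuousOn (fun τ : ℝ => (-τ, F τ)) s := continuous_neg.continuousOn.prodMk hF
  have h2 := continuous_freeGroup_uncurry.comp_continuousOn h
  simp only [Function.comp_def] at h2
  exact h2

lemma eLpNorm_ne_top_of_continuousOn {z : ℝ → L2} {a b : ℝ} (hz : ContinuousOn z (Icc a b)) :
    eLpNorm z 2 (volume.restrict (Icc a b)) ≠ ∞ := by
  obtain ⟨B, hB⟩ := isCompact_Icc.exists_bound_of_continuousOn hz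
  have : MemLp z 2 (volume.restrict (Icc a b)) := by
    refine MemLp.of_bound (hz.aestronglyMeasurable measurableSet_Icc) B ?_
    filter_upwards [ae_restrict_mem measurableSet_Icc] with t ht using hB t ht
  exact this.eLpNorm_ne_top

lemma sq_eLpNorm_eq_integral {z : ℝ → L2} {a b : ℝ} (hz : ContinuousOn z (Icc a b)) :
    eLpNorm (fun t => ‖z t‖ₑ) 2 (volume.restrict (Icc a b)) ^ 2 =
      ‖∫ τ in Icc a b, (inner ℂ (z τ) (z τ) : ℂ)‖ₑ := by
  have he : ∀ τ, (inner ℂ (z τ) (z τ) : ℂ) = ((‖z τ‖ ^ 2 : ℝ) : ℂ) := fun τ => by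
    rw [inner_self_eq_norm_sq_to_K]
    push_cast
    rfl
  simp_rw [he]
  have hi : IntegrableOn (fun τ => ‖z τ‖ ^ 2) (Icc a b) := (hz.norm.pow 2).integrableOn_Icc
  rw [integral_complex_ofReal, sq_eLpNorm_two, ← ofReal_norm, Complex.norm_real, Real.norm_of_nonneg
    (integral_nonneg fun _ => by positivity), ofReal_integral_eq_lintegral_ofReal
    hi (Filter.Eventually.of_forall fun _ => by positivity)]
  refine lintegral_congr fun τ => ?_
  rw [ENNReal.ofReal_pow (norm_nonneg _), ofReal_norm]

lemma enorm_sqrt_mul {κ : ℝ≥0∞} (A : ℝ≥0∞) : (κ ^ (1 / 2 : ℝ) * A) ^ 2 = κ * A ^ 2 := by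
  rw [mul_pow, ← ENNReal.rpow_natCast (κ ^ _), ← ENNReal.rpow_mul]
  norm_num

/-- Smoothing for the free group. -/
lemma LocalDecay.eLpNorm_smoothing_le (hQ : LocalDecay Q k) (f : L2) (M : ℝ) :
    eLpNorm (fun t => ‖Q (freeGroup t f)‖ₑ) 2 (volume.restrict (Icc (-M) M)) ≤
      (∫⁻ t, k t) ^ (1 / 2 : ℝ) * ‖f‖ₑ := by
  have hzc : Continuous fun t => Q (freeGroup t f) := Q.continuous.comp (continuous_freeGroup f)
  have hQz : Continuous fun t => Q (Q (freeGroup t f)) := Q.continuous.comp hzc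
  have hi : IntegrableOn (fun τ => freeGroup (-τ) (Q (Q (freeGroup τ f)))) (Icc (-M) M) :=
    (continuousOn_freeGroup_neg hQz.continuousOn).integrableOn_Icc
  have h1 := hQ.enorm_integral_sq_le (s := Icc (-M) M) (F := fun τ => Q (Q (freeGroup τ f)))
    (g := fun t => ‖Q (freeGroup t f)‖ₑ)
    (Filter.Eventually.of_forall fun τ => ⟨Q (freeGroup τ f), rfl, le_rfl⟩)
    hzc.enorm.measurable.aemeasurable hi
  -- Finiteness, available because the time interval is bounded, is what allows division by `A` at
  -- the end.
  have hAfin : eLpNorm (fun t => ‖Q (freeGroup t f)‖ₑ) 2 (volume.restrict (Icc (-M) M)) ≠ ∞ := by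
    rw [eLpNorm_enorm]
    exact eLpNorm_ne_top_of_continuousOn hzc.continuousOn
  -- Duality: the squared smoothing norm is ⟨f, J⟩ with J the dual integral, and the TT* inequality
  -- bounds ‖J‖ by the smoothing norm itself.
  have hAsq : eLpNorm (fun t => ‖Q (freeGroup t f)‖ₑ) 2 (volume.restrict (Icc (-M) M)) ^ 2 =
      ‖(inner ℂ f (∫ τ in Icc (-M) M, freeGroup (-τ) (Q (Q (freeGroup τ f)))) : ℂ)‖ₑ := by
    rw [← integral_inner hi, sq_eLpNorm_eq_integral hzc.continuousOn]
    refine congrArg _ (integral_congr_ae (Filter.Eventually.of_forall fun τ => ?_))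
    simp only
    rw [← inner_freeGroup, hQ.symm]
  generalize eLpNorm (fun t => ‖Q (freeGroup t f)‖ₑ) 2 (volume.restrict (Icc (-M) M)) = A at *
  generalize (∫ τ in Icc (-M) M, freeGroup (-τ) (Q (Q (freeGroup τ f)))) = J at *
  rw [← enorm_sqrt_mul] at h1
  have h2 := (ENNReal.pow_le_pow_left_iff two_ne_zero).1 h1
  generalize (∫⁻ t, k t) ^ (1 / 2 : ℝ) = c at *
  have h3 : A * A ≤ (c * ‖f‖ₑ) * A := by
    calc A * A = A ^ 2 := (sq A).symm
      _ ≤ ‖f‖ₑ * ‖J‖ₑ := hAsq.trans_le (enorm_inner_le _ _)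
      _ ≤ ‖f‖ₑ * (c * A) := by gcongr
      _ = _ := by ring
  by_cases h0 : A = 0
  · rw [h0]; exact bot_le
  · exact (ENNReal.mul_le_mul_iff_left h0 hAfin).1 h3

/-- Smoothing for the Duhamel term. -/
lemma LocalDecay.enorm_duhamel_le (hQ : LocalDecay Q k) {s : Set ℝ} {F : ℝ → L2}
    {g : ℝ → ℝ≥0∞} (hF : ForcingBound Q s F g)
    (hi : IntegrableOn (fun τ => freeGroup (-τ) (F τ)) s) (t : ℝ) :
    ‖Q (freeGroup t (∫ τ in s, freeGroup (-τ) (F τ)))‖ₑ ≤ ∫⁻ τ in s, k (t - τ) * g τ := by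
  set v := freeGroup t (∫ τ in s, freeGroup (-τ) (F τ)) with hv
  by_cases h0 : ‖Q v‖ₑ = 0
  · rw [h0]; exact bot_le
  -- Testing `Q v` against itself moves one `Q` next to the group, where local decay applies; one
  -- factor ‖Qv‖ is divided out at the end.
  have h1 : ‖Q v‖ₑ * ‖Q v‖ₑ = ‖(inner ℂ (Q (Q v)) v : ℂ)‖ₑ := by
    rw [hQ.symm, enorm_inner_self, sq]
  have h2 : ‖Q v‖ₑ * ‖Q v‖ₑ ≤ (∫⁻ τ in s, k (t - τ) * g τ) * ‖Q v‖ₑ := by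
    rw [h1, hv, ← neg_neg t, ← inner_freeGroup, neg_neg, ← integral_inner hi,
      ← lintegral_mul_const' _ _ enorm_ne_top]
    refine (enorm_integral_le_lintegral_enorm _).trans (lintegral_mono_ae ?_)
    filter_upwards [hF] with τ hτ
    obtain ⟨z, hz, hzg⟩ := hτ
    have he : (inner ℂ (freeGroup (-t) (Q (Q v))) (freeGroup (-τ) (F τ)) : ℂ) =
        starRingEnd ℂ (inner ℂ (freeGroup (t - τ) (Q z)) (Q (Q v))) := by
      rw [inner_conj_symm, hz, inner_freeGroup, neg_neg, sub_eq_add_neg, freeGroup_add]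
    rw [← hv, he, RCLike.enorm_conj]
    refine (hQ.decay _ _ _).trans ?_
    rw [mul_assoc]
    gcongr
  exact (ENNReal.mul_le_mul_iff_left h0 enorm_ne_top).1 h2

end Smoothing

/-! ### The time interval -/

lemma isOpen_timeInterval (T : ℝ≥0∞) : IsOpen (timeInterval T) :=
  isOpen_Iio.preimage (ENNReal.continuous_ofReal.comp continuous_abs)

lemma measurableSet_timeInterval (T : ℝ≥0∞) : MeasurableSet (timeInterval T) :=
  (isOpen_timeInterval T).measurableSet

lemma zero_mem_timeInterval {T : ℝ≥0∞} (hT : 0 < T) : (0 : ℝ) ∈ timeInterval T := by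
  simpa [timeInterval] using hT

lemma mem_timeInterval_of_abs_le {T : ℝ≥0∞} {s t : ℝ} (ht : t ∈ timeInterval T) (h : |s| ≤ |t|) :
    s ∈ timeInterval T :=
  lt_of_le_of_lt (ENNReal.ofReal_le_ofReal h) ht

lemma Icc_subset_timeInterval {T : ℝ≥0∞} {M : ℝ} (hM : M ∈ timeInterval T) :
    Icc (-M) M ⊆ timeInterval T := fun _ ht =>
  mem_timeInterval_of_abs_le hM ((abs_le.2 ht).trans (le_abs_self M))

lemma ordConnected_timeInterval (T : ℝ≥0∞) : (timeInterval T).OrdConnected := by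
  refine ⟨fun a ha b hb x hx => ?_⟩
  rcases le_total |a| |b| with h | h
  · exact mem_timeInterval_of_abs_le hb (abs_le.2 ⟨by linarith [neg_abs_le a, hx.1], hx.2.trans (le_abs_self b)⟩)
  · exact mem_timeInterval_of_abs_le ha (abs_le.2 ⟨by linarith [neg_abs_le a, hx.1], by
      linarith [le_abs_self b, hx.2]⟩)

lemma uIcc_subset_timeInterval {T : ℝ≥0∞} {s t : ℝ} (hs : s ∈ timeInterval T)
    (ht : t ∈ timeInterval T) : uIcc s t ⊆ timeInterval T :=
  (ordConnected_timeInterval T).uIcc_subset hs ht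

/-- Monotone convergence along the compact intervals with rational endpoints. It lets absorption
arguments run on compact intervals, where norms are finite, with bounds independent of the interval.
-/
lemma setLIntegral_timeInterval_le {T : ℝ≥0∞} {f : ℝ → ℝ≥0∞} {B : ℝ≥0∞}
    (h : ∀ M, 0 ≤ M → M ∈ timeInterval T → ∫⁻ t in Icc (-M) M, f t ≤ B) :
    ∫⁻ t in timeInterval T, f t ≤ B := by
  let ι := {q : ℚ // (0 : ℝ) ≤ q ∧ (q : ℝ) ∈ timeInterval T}
  let S : ι → Set ℝ := fun q => Icc (-(q.1 : ℝ)) q.1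
  have hd : Directed (· ⊆ ·) S := fun p q => by
    rcases le_total p.1 q.1 with h | h
    · refine ⟨q, Icc_subset_Icc (neg_le_neg ?_) ?_, subset_rfl⟩ <;> exact_mod_cast h
    · refine ⟨p, subset_rfl, Icc_subset_Icc (neg_le_neg ?_) ?_⟩ <;> exact_mod_cast h
  have hU : timeInterval T ⊆ ⋃ q, S q := fun t ht => by
    have ha : |t| ∈ timeInterval T := mem_timeInterval_of_abs_le ht (by rw [abs_abs])
    have hn : timeInterval T ∈ 𝓝 |t| := (isOpen_timeInterval T).mem_nhds ha
    obtain ⟨δ, hδ, hball⟩ := Metric.mem_nhds_iff.1 hn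
    obtain ⟨q, hq1, hq2⟩ := exists_rat_btwn (show |t| < |t| + δ by linarith)
    have hqI : (q : ℝ) ∈ timeInterval T := hball (by
      rw [Metric.mem_ball, Real.dist_eq, abs_lt]; constructor <;> linarith)
    exact mem_iUnion.2 ⟨⟨q, (abs_nonneg t).trans hq1.le, hqI⟩, abs_le.1 hq1.le⟩
  refine (lintegral_mono_set hU).trans ?_
  rw [setLIntegral_iUnion_of_directed f hd]
  exact iSup_le fun q => h q.1 q.2.1 q.2.2

lemma eLpNorm_timeInterval_le {T : ℝ≥0∞} {f : ℝ → ℝ≥0∞} {B : ℝ≥0∞}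
    (h : ∀ M, 0 ≤ M → M ∈ timeInterval T → eLpNorm f 2 (volume.restrict (Icc (-M) M)) ≤ B) :
    eLpNorm f 2 (volume.restrict (timeInterval T)) ≤ B := by
  refine (ENNReal.pow_le_pow_left_iff two_ne_zero).1 ?_
  rw [sq_eLpNorm_two]
  refine setLIntegral_timeInterval_le fun M h0 hM => ?_
  rw [← sq_eLpNorm_two]
  exact pow_le_pow_left' (h M h0 hM) 2

/-! ### Energy estimates for Duhamel's formula -/

/-- `y` is given on `(-T, T)` by Duhamel's formula, with forcing term `G` and data `y₀`. -/
structure IsDuhamel (T : ℝ≥0∞) (G : ℝ → L2) (y₀ : L2) (y : ℝ → L2) : Prop where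
  continuousOn : ContinuousOn y (timeInterval T)
  continuousOn_forcing : ContinuousOn G (timeInterval T)
  formula : ∀ t ∈ timeInterval T,
    y t = freeGroup t (y₀ + Complex.I • ∫ τ in (0 : ℝ)..t, freeGroup (-τ) (G τ))

variable {Q : L2 →L[ℂ] L2} {k : ℝ → ℝ≥0∞} {T : ℝ≥0∞} {G : ℝ → L2} {y₀ : L2} {y : ℝ → L2}

lemma integrableOn_uIoc_freeGroup (hG : ContinuousOn G (timeInterval T)) {s t : ℝ}
    (hs : s ∈ timeInterval T) (ht : t ∈ timeInterval T) :
    IntegrableOn (fun τ => freeGroup (-τ) (G τ)) (uIoc s t) :=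
  (((continuousOn_freeGroup_neg hG).mono (uIcc_subset_timeInterval hs ht)).integrableOn_compact
    isCompact_uIcc).mono_set uIoc_subset_uIcc

lemma LocalDecay.enorm_intervalIntegral_sq_le (hQ : LocalDecay Q k)
    (hG : ContinuousOn G (timeInterval T)) {g : ℝ → ℝ≥0∞} (hF : ForcingBound Q (timeInterval T) G g)
    (hg : AEMeasurable g (volume.restrict (timeInterval T))) {s t : ℝ}
    (hs : s ∈ timeInterval T) (ht : t ∈ timeInterval T) :
    ‖∫ τ in s..t, freeGroup (-τ) (G τ)‖ₑ ^ 2 ≤ (∫⁻ t, k t) * ∫⁻ τ in uIoc s t, g τ ^ 2 := by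
  have hsub : uIoc s t ⊆ timeInterval T := uIoc_subset_uIcc.trans (uIcc_subset_timeInterval hs ht)
  rw [← ofReal_norm, intervalIntegral.norm_intervalIntegral_eq, ofReal_norm, ← sq_eLpNorm_two]
  exact hQ.enorm_integral_sq_le (hF.mono hsub) (hg.mono_measure (Measure.restrict_mono hsub le_rfl))
    (integrableOn_uIoc_freeGroup hG hs ht)

/-- The Duhamel integral over (0,t) is enlarged to the whole interval once absolute values are
inside, so Young's inequality applies without any causality restriction. -/
lemma LocalDecay.enorm_apply_le (hQ : LocalDecay Q k) (hy : IsDuhamel T G y₀ y) {g : ℝ → ℝ≥0∞}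
    (hF : ForcingBound Q (timeInterval T) G g) {M t : ℝ}
    (hM : M ∈ timeInterval T) (ht : t ∈ Icc (-M) M) :
    ‖Q (y t)‖ₑ ≤ ‖Q (freeGroup t y₀)‖ₑ + ∫⁻ τ in Icc (-M) M, k (t - τ) * g τ := by
  have h0M : (0 : ℝ) ∈ Icc (-M) M := ⟨by linarith [ht.1, ht.2], by linarith [ht.1, ht.2]⟩
  have hsub : uIoc 0 t ⊆ Icc (-M) M := uIoc_subset_uIcc.trans (uIcc_subset_Icc h0M ht)
  have hI := Icc_subset_timeInterval hM
  have hc : ‖Q (freeGroup t (Complex.I • ∫ τ in (0 : ℝ)..t, freeGroup (-τ) (G τ)))‖ₑ =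
      ‖Q (freeGroup t (∫ τ in uIoc 0 t, freeGroup (-τ) (G τ)))‖ₑ := by
    rw [map_smul, map_smul, enorm_smul, intervalIntegral.intervalIntegral_eq_integral_uIoc]
    have h1 : ‖Complex.I‖ₑ = 1 := by rw [← ofReal_norm, Complex.norm_I, ENNReal.ofReal_one]
    rw [h1, one_mul]
    split_ifs
    · rw [one_smul]
    · rw [neg_one_smul, map_neg, map_neg, enorm_neg]
  rw [hy.formula t (hI ht), map_add, map_add]
  refine (enorm_add_le _ _).trans (add_le_add_right ?_ _)
  rw [hc]
  refine (hQ.enorm_duhamel_le (hF.mono (hsub.trans hI)) (integrableOn_uIoc_freeGroup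
    hy.continuousOn_forcing (hI h0M) (hI ht)) t).trans ?_
  exact lintegral_mono_set hsub

/-- Global smoothing for Duhamel's formula with a small perturbation. -/
lemma LocalDecay.eLpNorm_le_of_isDuhamel (hQ : LocalDecay Q k) (hy : IsDuhamel T G y₀ y)
    {γ : ℝ → ℝ≥0∞} {c : ℝ≥0∞} (hF : ForcingBound Q (timeInterval T) G
      (fun t => c * ‖Q (y t)‖ₑ + γ t))
    (hγ : AEMeasurable γ (volume.restrict (timeInterval T))) (hc : (∫⁻ t, k t) * c ≤ 2⁻¹) :
    eLpNorm (fun t => ‖Q (y t)‖ₑ) 2 (volume.restrict (timeInterval T)) ≤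
      2 * ((∫⁻ t, k t) ^ (1 / 2 : ℝ) * ‖y₀‖ₑ +
        (∫⁻ t, k t) * eLpNorm γ 2 (volume.restrict (timeInterval T))) := by
  refine eLpNorm_timeInterval_le fun M h0 hM => ?_
  have hI := Icc_subset_timeInterval hM
  have hle : volume.restrict (Icc (-M) M) ≤ volume.restrict (timeInterval T) :=
    Measure.restrict_mono hI le_rfl
  set μ := volume.restrict (Icc (-M) M) with hμ
  have hQy : ContinuousOn (fun t => Q (y t)) (Icc (-M) M) :=
    Q.continuous.comp_continuousOn (hy.continuousOn.mono hI)
  have ha : AEMeasurable (fun t => ‖Q (y t)‖ₑ) μ :=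
    (hQy.aestronglyMeasurable measurableSet_Icc).enorm
  have hfin : eLpNorm (fun t => ‖Q (y t)‖ₑ) 2 μ ≠ ∞ := by
    rw [eLpNorm_enorm]
    exact eLpNorm_ne_top_of_continuousOn hQy
  have hγ' : AEMeasurable γ μ := hγ.mono_measure hle
  have hg : AEMeasurable (fun t => c * ‖Q (y t)‖ₑ + γ t) μ := (ha.const_mul c).add hγ'
  have h1 : eLpNorm (fun t => ‖Q (y t)‖ₑ) 2 μ ≤
      eLpNorm (fun t => ‖Q (freeGroup t y₀)‖ₑ) 2 μ +
      eLpNorm (fun t => ∫⁻ τ in Icc (-M) M, k (t - τ) * (c * ‖Q (y τ)‖ₑ + γ τ)) 2 μ := by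
    have hm1 : AEMeasurable (fun t => ‖Q (freeGroup t y₀)‖ₑ) μ :=
      (Q.continuous.comp (continuous_freeGroup y₀)).enorm.measurable.aemeasurable
    refine le_trans (eLpNorm_mono_enorm_ae ?_) (eLpNorm_add_le hm1.aestronglyMeasurable
      (aemeasurable_conv hQ.meas hg).aestronglyMeasurable one_le_two)
    filter_upwards [ae_restrict_mem measurableSet_Icc] with t ht
    exact hQ.enorm_apply_le hy hF hM ht
  have h2 : eLpNorm (fun t => ∫⁻ τ in Icc (-M) M, k (t - τ) * (c * ‖Q (y τ)‖ₑ + γ τ)) 2 μ ≤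
      (∫⁻ t, k t) * (c * eLpNorm (fun t => ‖Q (y t)‖ₑ) 2 μ + eLpNorm γ 2 μ) := by
    refine (eLpNorm_conv_le hQ.meas hg).trans ?_
    gcongr
    refine (eLpNorm_add_le (ha.const_mul c).aestronglyMeasurable hγ'.aestronglyMeasurable
      one_le_two).trans_eq ?_
    rw [eLpNorm_const_mul_two c ha]
  have h3 : eLpNorm γ 2 μ ≤ eLpNorm γ 2 (volume.restrict (timeInterval T)) :=
    eLpNorm_mono_measure _ hle
  have h4 := hQ.eLpNorm_smoothing_le y₀ M
  rw [← hμ] at h4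
  generalize eLpNorm (fun t => ‖Q (y t)‖ₑ) 2 μ = a at *
  generalize eLpNorm γ 2 (volume.restrict (timeInterval T)) = Γ at *
  generalize (∫⁻ t, k t) ^ (1 / 2 : ℝ) * ‖y₀‖ₑ = D at *
  generalize ∫⁻ t, k t = κ at *
  -- The smallness condition makes the perturbation cost at most half of the left-hand side; as that
  -- is finite it can be subtracted.
  have h5 : a ≤ (D + κ * Γ) + 2⁻¹ * a := by
    calc a ≤ D + κ * (c * a + Γ) := h1.trans (add_le_add h4 (h2.trans (by gcongr)))
      _ = (D + κ * Γ) + κ * c * a := by ring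
      _ ≤ _ := by gcongr
  have h6 : 2⁻¹ * a + 2⁻¹ * a = a := by rw [← add_mul, ENNReal.inv_two_add_inv_two, one_mul]
  have h7 : 2⁻¹ * a ≠ ∞ := ENNReal.mul_ne_top (by simp) hfin
  have h8 : 2⁻¹ * a ≤ D + κ * Γ := by
    rw [← h6] at h5
    conv at h5 => rhs; rw [h6]
    exact (ENNReal.add_le_add_iff_right h7).1 h5
  calc a = 2 * (2⁻¹ * a) := by rw [two_mul, h6]
    _ ≤ _ := by gcongr

/-! ### Strichartz estimates for functions of bounded quadratic variation -/

/-- Minkowski for partial sums, then monotone convergence. -/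
lemma eLpNorm_tsum_le {p : ℝ≥0∞} (hp1 : 1 ≤ p) (hp : p ≠ ∞) {μ : Measure ℝ} {h : ℕ → ℝ → ℝ≥0∞}
    (hm : ∀ j, Measurable (h j)) :
    eLpNorm (fun t => ∑' j, h j t) p μ ≤ ∑' j, eLpNorm (h j) p μ := by
  have hp0 : p ≠ 0 := (zero_lt_one.trans_le hp1).ne'
  have hq : 0 < p.toReal := ENNReal.toReal_pos hp0 hp
  have hB : ∀ J, ∫⁻ t, (∑ j ∈ Finset.range J, h j t) ^ p.toReal ∂μ ≤
      (∑' j, eLpNorm (h j) p μ) ^ p.toReal := fun J => by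
    have h1 : eLpNorm (∑ j ∈ Finset.range J, h j) p μ ≤ ∑' j, eLpNorm (h j) p μ :=
      (eLpNorm_sum_le (fun j _ => (hm j).aestronglyMeasurable) hp1).trans (ENNReal.sum_le_tsum _)
    have h2 := ENNReal.rpow_le_rpow h1 hq.le
    rw [eLpNorm_eq_lintegral_rpow_enorm_toReal hp0 hp, ← ENNReal.rpow_mul,
      one_div_mul_cancel hq.ne', ENNReal.rpow_one] at h2
    simpa using h2
  rw [eLpNorm_eq_lintegral_rpow_enorm_toReal hp0 hp, one_div, ENNReal.rpow_inv_le_iff hq]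
  have hsup : ∀ t, ‖∑' j, h j t‖ₑ ^ p.toReal =
      ⨆ J, (∑ j ∈ Finset.range J, h j t) ^ p.toReal := fun t => by
    rw [enorm_eq_self, ENNReal.tsum_eq_iSup_nat]
    exact (ENNReal.orderIsoRpow _ hq).map_iSup _
  simp_rw [hsup]
  rw [lintegral_iSup]
  · exact iSup_le hB
  · exact fun J => (Finset.measurable_fun_sum _ fun j _ => hm j).pow_const _
  · exact fun J J' hJ t => ENNReal.rpow_le_rpow
      (Finset.sum_le_sum_of_subset (Finset.range_subset_range.2 hJ)) hq.le

/-- A family of lower semicontinuous seminorms on `L²` which satisfies a Strichartz estimate. -/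
structure StrichartzFamily (p : ℝ≥0∞) (ν : ℝ → L2 → ℝ≥0∞) (C : ℝ≥0) : Prop where
  lsc : ∀ t, LowerSemicontinuous (ν t)
  lsc_time : ∀ f, LowerSemicontinuous fun t => ν t f
  zero : ∀ t, ν t 0 = 0
  add_le : ∀ t f g, ν t (f + g) ≤ ν t f + ν t g
  bound : ∀ f, eLpNorm (fun t => ν t f) p volume ≤ C * ‖f‖ₑ

variable {p : ℝ≥0∞} {ν : ℝ → L2 → ℝ≥0∞} {C : ℝ≥0}

lemma StrichartzFamily.sum_le (h : StrichartzFamily p ν C) (t : ℝ) (s : Finset ℕ) (f : ℕ → L2) :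
    ν t (∑ j ∈ s, f j) ≤ ∑ j ∈ s, ν t (f j) :=
  Finset.le_sum_of_subadditive (ν t) (h.zero t).le (h.add_le t) s f

/-- The exceptional set is null, and open by lower semicontinuity in time, hence empty. When p = ∞
the estimate therefore holds at each time, and f may depend on time. -/
lemma StrichartzFamily.le_of_top (h : StrichartzFamily ∞ ν C) (t : ℝ) (f : L2) :
    ν t f ≤ C * ‖f‖ₑ := by
  have h1 : ∀ᵐ t, ν t f ≤ C * ‖f‖ₑ := by
    filter_upwards [enorm_ae_le_eLpNormEssSup (fun t => ν t f) volume] with t ht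
    rw [enorm_eq_self] at ht
    refine ht.trans ?_
    rw [← eLpNorm_exponent_top]
    exact h.bound f
  have hc : IsClosed {t | ν t f ≤ C * ‖f‖ₑ} :=
    lowerSemicontinuous_iff_isClosed_preimage.1 (h.lsc_time f) _
  have hU : {t | ν t f ≤ C * ‖f‖ₑ}ᶜ = ∅ := (hc.isOpen_compl.measure_eq_zero_iff volume).1 h1
  have ht : t ∈ {t | ν t f ≤ C * ‖f‖ₑ} := by rw [compl_empty_iff.1 hU]; trivial
  exact ht

/-- The dyadic approximations of a function of bounded quadratic variation. -/
lemma exists_dyadic_approx {I : Set ℝ} {Φ : ℝ → L2} {m : ℝ → ℝ} {M : ℝ} (hM : 0 < M)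
    (hm0 : ∀ t ∈ I, 0 ≤ m t) (hmM : ∀ t ∈ I, m t ≤ M)
    (hΦ : ∀ s ∈ I, ∀ t ∈ I, ‖Φ s - Φ t‖ ^ 2 ≤ |m s - m t|) (hΦ0 : ∀ t ∈ I, ‖Φ t‖ ^ 2 ≤ M) :
    ∃ (d : ℕ → ℕ → L2) (n : ℕ → ℝ → ℕ), (∀ j i, ‖d j i‖ ≤ 2 * Real.sqrt (M / 2 ^ j)) ∧
      (∀ j, ∀ t ∈ I, n j t ≤ 2 ^ (j + 1)) ∧
      ∀ t ∈ I, ∀ J, ‖Φ t - ∑ j ∈ Finset.range J, d j (n j t)‖ ≤ Real.sqrt (M / 2 ^ J) := by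
  classical
  -- Generation j sorts times by the value of m into cells of length M/2^j; on a cell Φ oscillates
  -- by at most √(M/2^j). The map `R` picks one time in each nonempty cell.
  let n : ℕ → ℝ → ℕ := fun j t => ⌊2 ^ j * (m t / M)⌋₊
  let R : ℕ → ℕ → ℝ := fun j i => if h : ∃ t ∈ I, n j t = i then h.choose else 0
  have hR : ∀ j, ∀ t ∈ I, R j (n j t) ∈ I ∧ n j (R j (n j t)) = n j t := fun j t ht => by
    have h : ∃ t' ∈ I, n j t' = n j t := ⟨t, ht, rfl⟩
    simp only [R, dif_pos h]
    exact h.choose_spec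
  -- The zeroth approximation is 0 rather than a value of Φ, so that the increments sum to Φ itself;
  -- this is where ‖Φ‖² ≤ M is needed.
  let c : ℕ → ℕ → L2 := fun j i => if j = 0 then 0 else Φ (R j i)
  have hc : ∀ j, ∀ t ∈ I, ‖Φ t - c j (n j t)‖ ≤ Real.sqrt (M / 2 ^ j) := fun j t ht => by
    refine Real.le_sqrt_of_sq_le ?_
    by_cases hj : j = 0
    · simpa [c, hj] using hΦ0 t ht
    · simp only [c, if_neg hj]
      obtain ⟨h1, h2⟩ := hR j t ht
      refine (hΦ t ht _ h1).trans ?_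
      have p1 : (0 : ℝ) ≤ 2 ^ j * (m t / M) := by have := hm0 t ht; positivity
      have p2 : (0 : ℝ) ≤ 2 ^ j * (m (R j (n j t)) / M) := by have := hm0 _ h1; positivity
      have f1 := Nat.floor_le p1
      have f2 := Nat.lt_floor_add_one (2 ^ j * (m t / M))
      have f3 := Nat.floor_le p2
      have f4 := Nat.lt_floor_add_one (2 ^ j * (m (R j (n j t)) / M))
      have h2' : ⌊2 ^ j * (m (R j (n j t)) / M)⌋₊ = ⌊2 ^ j * (m t / M)⌋₊ := h2
      rw [h2'] at f3 f4
      have h3 : |2 ^ j * (m t / M) - 2 ^ j * (m (R j (n j t)) / M)| ≤ 1 := by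
        rw [abs_le]; constructor <;> linarith
      have h4 : m t - m (R j (n j t)) = (2 ^ j * (m t / M) - 2 ^ j * (m (R j (n j t)) / M)) * (M / 2 ^ j) := by
        field_simp
      rw [h4, abs_mul, abs_of_pos (show 0 < M / 2 ^ j by positivity)]
      exact mul_le_of_le_one_left (by positivity) h3
  -- Cells are nested: the parent of cell i is i / 2. Thus the increment from generation j to j + 1
  -- depends only on the cell of generation j + 1.
  have hhalf : ∀ j t, n j t = n (j + 1) t / 2 := fun j t => by
    simp only [n]
    rw [← Nat.floor_div_ofNat, pow_succ]
    congr 1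
    ring
  let d : ℕ → ℕ → L2 := fun j i => if ∃ t ∈ I, n (j + 1) t = i then c (j + 1) i - c j (i / 2) else 0
  have hd : ∀ j, ∀ t ∈ I, d j (n (j + 1) t) = c (j + 1) (n (j + 1) t) - c j (n j t) := fun j t ht => by
    have h : ∃ t' ∈ I, n (j + 1) t' = n (j + 1) t := ⟨t, ht, rfl⟩
    simp only [d, if_pos h, ← hhalf]
  refine ⟨d, fun j => n (j + 1), fun j i => ?_, fun j t ht => ?_, fun t ht J => ?_⟩
  · by_cases h : ∃ t ∈ I, n (j + 1) t = i
    · obtain ⟨t, ht, rfl⟩ := h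
      rw [hd j t ht]
      have h1 : Real.sqrt (M / 2 ^ (j + 1)) ≤ Real.sqrt (M / 2 ^ j) := by
        refine Real.sqrt_le_sqrt (div_le_div_of_nonneg_left hM.le (by positivity) ?_)
        exact pow_le_pow_right₀ one_le_two (Nat.le_succ j)
      calc ‖c (j + 1) (n (j + 1) t) - c j (n j t)‖
          = ‖(Φ t - c j (n j t)) - (Φ t - c (j + 1) (n (j + 1) t))‖ := by congr 1; abel
        _ ≤ Real.sqrt (M / 2 ^ j) + Real.sqrt (M / 2 ^ (j + 1)) :=
            (norm_sub_le _ _).trans (add_le_add (hc _ t ht) (hc _ t ht))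
        _ ≤ _ := by linarith
    · simp only [d, if_neg h, norm_zero]
      positivity
  · refine Nat.floor_le_of_le ?_
    push_cast
    refine mul_le_of_le_one_right (by positivity) ?_
    rw [div_le_one hM]
    exact hmM t ht
  · have : ∑ j ∈ Finset.range J, d j (n (j + 1) t) = c J (n J t) := by
      rw [Finset.sum_congr rfl fun j _ => hd j t ht, Finset.sum_range_sub (fun j => c j (n j t))]
      simp [c]
    rw [this]
    exact hc J t ht

/-- A time-dependent choice among n vectors is dominated by the ℓ^p sum over all of them, whose L^p
norm is computed term by term. The price is n^{1/p}. -/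
lemma eLpNorm_level_le (hp1 : 1 ≤ p) (hp : p ≠ ∞) (hν : StrichartzFamily p ν C) (n : ℕ)
    {d : ℕ → L2} {D : ℝ≥0∞} (hd : ∀ i, ‖d i‖ₑ ≤ D) :
    eLpNorm (fun t => (∑ i ∈ Finset.range n, ν t (d i) ^ p.toReal) ^ (1 / p.toReal)) p volume ≤
      (n : ℝ≥0∞) ^ (1 / p.toReal) * (C * D) := by
  have hp0 : p ≠ 0 := (zero_lt_one.trans_le hp1).ne'
  have hq : 0 < p.toReal := ENNReal.toReal_pos hp0 hp
  rw [eLpNorm_eq_lintegral_rpow_enorm_toReal hp0 hp]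
  have h1 : ∀ i, ∫⁻ t, ν t (d i) ^ p.toReal ≤ (C * D) ^ p.toReal := fun i => by
    have h := (hν.bound (d i)).trans (mul_le_mul_right (hd i) _)
    rw [eLpNorm_eq_lintegral_rpow_enorm_toReal hp0 hp, one_div, ENNReal.rpow_inv_le_iff hq] at h
    simpa using h
  have h2 : ∀ i, Measurable fun t => ν t (d i) ^ p.toReal := fun i =>
    (hν.lsc_time (d i)).measurable.pow_const _
  have h3 : ∫⁻ t, ‖(∑ i ∈ Finset.range n, ν t (d i) ^ p.toReal) ^ (1 / p.toReal)‖ₑ ^ p.toReal ≤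
      n * (C * D) ^ p.toReal := by
    calc _ = ∫⁻ t, ∑ i ∈ Finset.range n, ν t (d i) ^ p.toReal := by
          refine lintegral_congr fun t => ?_
          rw [enorm_eq_self, ← ENNReal.rpow_mul, one_div_mul_cancel hq.ne', ENNReal.rpow_one]
      _ = ∑ i ∈ Finset.range n, ∫⁻ t, ν t (d i) ^ p.toReal := lintegral_finsetSum _ fun i _ => h2 i
      _ ≤ ∑ _i ∈ Finset.range n, (C * D) ^ p.toReal := Finset.sum_le_sum fun i _ => h1 i
      _ = _ := by rw [Finset.sum_const, Finset.card_range, nsmul_eq_mul]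
  refine (ENNReal.rpow_le_rpow h3 (by positivity)).trans_eq ?_
  rw [ENNReal.mul_rpow_of_nonneg _ _ (by positivity), ← ENNReal.rpow_mul,
    mul_one_div_cancel hq.ne', ENNReal.rpow_one]

/-- Strichartz estimates for functions of bounded quadratic variation. -/
theorem exists_quadratic_variation_strichartz (hp : 2 < p) :
    ∃ K : ℝ≥0, ∀ (ν : ℝ → L2 → ℝ≥0∞) (C : ℝ≥0), StrichartzFamily p ν C →
      ∀ (I : Set ℝ) (Φ : ℝ → L2) (m : ℝ → ℝ) (M : ℝ), MeasurableSet I → 0 < M →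
        (∀ t ∈ I, 0 ≤ m t) → (∀ t ∈ I, m t ≤ M) →
        (∀ s ∈ I, ∀ t ∈ I, ‖Φ s - Φ t‖ ^ 2 ≤ |m s - m t|) → (∀ t ∈ I, ‖Φ t‖ ^ 2 ≤ M) →
        eLpNorm (fun t => ν t (Φ t)) p (volume.restrict I) ≤
          K * C * ENNReal.ofReal (Real.sqrt M) := by
  by_cases hpt : p = ∞
  · subst hpt
    refine ⟨1, fun ν C hν I Φ m M hI hM hm0 hmM hΦ hΦ0 => ?_⟩
    rw [eLpNorm_exponent_top]
    refine eLpNormEssSup_le_of_ae_enorm_bound ?_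
    filter_upwards [ae_restrict_mem hI] with t ht
    rw [enorm_eq_self, ENNReal.coe_one, one_mul]
    refine (hν.le_of_top t (Φ t)).trans ?_
    gcongr
    rw [← ofReal_norm]
    exact ENNReal.ofReal_le_ofReal (Real.le_sqrt_of_sq_le (hΦ0 t ht))
  have hp1 : 1 ≤ p := one_le_two.trans hp.le
  have hp0 : p ≠ 0 := (zero_lt_one.trans_le hp1).ne'
  have hq : 2 < p.toReal := by
    rw [← ENNReal.toReal_ofNat]
    exact (ENNReal.toReal_lt_toReal ENNReal.ofNat_ne_top hpt).2 hp
  set q := p.toReal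
  -- Level j has about 2^j increments of size 2^{-j/2}√M, hence contributes 2^{j/p}·2^{-j/2}√M. The
  -- ratio of this geometric series is below 1 precisely because p > 2.
  set ρ : ℝ≥0∞ := 2 ^ (1 / q - 1 / 2) with hρ
  have hρ1 : ρ < 1 := ENNReal.rpow_lt_one_of_one_lt_of_neg ENNReal.one_lt_two (by
    rw [sub_neg]
    exact one_div_lt_one_div_of_lt two_pos hq)
  set K : ℝ≥0∞ := 4 ^ (1 / q) * 2 * (1 - ρ)⁻¹ with hK
  have hKfin : K ≠ ∞ := by
    refine ENNReal.mul_ne_top (ENNReal.mul_ne_top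
      (ENNReal.rpow_ne_top_of_nonneg (by positivity) ENNReal.ofNat_ne_top) ENNReal.ofNat_ne_top) ?_
    exact ENNReal.inv_ne_top.2 (tsub_pos_of_lt hρ1).ne'
  refine ⟨K.toNNReal, fun ν C hν I Φ m M hI hM hm0 hmM hΦ hΦ0 => ?_⟩
  rw [ENNReal.coe_toNNReal hKfin]
  obtain ⟨d, n, hd, hn, happ⟩ := exists_dyadic_approx hM hm0 hmM hΦ hΦ0
  -- Cell indices on level j run from 0 to 2^{j+1} inclusive, whence the + 1 in the range.
  set h : ℕ → ℝ → ℝ≥0∞ := fun j t =>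
    (∑ i ∈ Finset.range (2 ^ (j + 1) + 1), ν t (d j i) ^ q) ^ (1 / q) with hh
  have hmeas : ∀ j, Measurable (h j) := fun j =>
    (Finset.measurable_fun_sum _ fun i _ => (hν.lsc_time (d j i)).measurable.pow_const _).pow_const _
  have hle : ∀ t ∈ I, ∀ j, ν t (d j (n j t)) ≤ h j t := fun t ht j => by
    rw [hh]
    simp only
    rw [one_div, ENNReal.le_rpow_inv_iff (by linarith)]
    exact Finset.single_le_sum (f := fun i => ν t (d j i) ^ q) (fun _ _ => bot_le)
      (Finset.mem_range.2 (Nat.lt_succ_of_le (hn j t ht)))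
  -- Lower semicontinuity in f passes the subadditive bound on the finite dyadic sums to their limit
  -- Φ(t).
  have hptw : ∀ t ∈ I, ν t (Φ t) ≤ ∑' j, h j t := fun t ht => by
    have hcl : IsClosed {f | ν t f ≤ ∑' j, h j t} :=
      lowerSemicontinuous_iff_isClosed_preimage.1 (hν.lsc t) _
    have hlim : Filter.Tendsto (fun J => ∑ j ∈ Finset.range J, d j (n j t)) Filter.atTop (𝓝 (Φ t)) := by
      rw [tendsto_iff_norm_sub_tendsto_zero]
      refine squeeze_zero (fun _ => norm_nonneg _) (fun J => ?_)
        (g := fun J : ℕ => Real.sqrt (M * (1 / 2) ^ J)) ?_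
      · rw [norm_sub_rev]
        refine (happ t ht J).trans_eq ?_
        rw [one_div, inv_pow, div_eq_mul_inv]
      · have h1 : Filter.Tendsto (fun J : ℕ => M * (1 / 2 : ℝ) ^ J) Filter.atTop (𝓝 (M * 0)) :=
          (tendsto_pow_atTop_nhds_zero_of_lt_one (by norm_num) (by norm_num)).const_mul M
        have h2 := h1.sqrt
        rwa [mul_zero, Real.sqrt_zero] at h2
    refine hcl.mem_of_tendsto hlim (Filter.Eventually.of_forall fun J => ?_)
    exact (hν.sum_le t _ _).trans ((Finset.sum_le_sum fun j _ => hle t ht j).trans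
      (ENNReal.sum_le_tsum _))
  have hlev : ∀ j, eLpNorm (h j) p (volume.restrict I) ≤
      (4 ^ (1 / q) * 2 * (C * ENNReal.ofReal (Real.sqrt M))) * ρ ^ j := fun j => by
    have hD : ∀ i, ‖d j i‖ₑ ≤ 2 * (ENNReal.ofReal (Real.sqrt M) * (2 : ℝ≥0∞) ^ (-(1 / 2) * j : ℝ)) := fun i => by
      rw [← ofReal_norm]
      refine (ENNReal.ofReal_le_ofReal (hd j i)).trans_eq ?_
      have e1 : Real.sqrt (M / 2 ^ j) = Real.sqrt M * (2 : ℝ) ^ (-(1 / 2) * j : ℝ) := by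
        rw [Real.sqrt_div' _ (by positivity), div_eq_mul_inv, neg_mul, Real.rpow_neg zero_le_two,
          Real.sqrt_eq_rpow (2 ^ j), ← Real.rpow_natCast, ← Real.rpow_mul zero_le_two, mul_comm (j : ℝ)]
      rw [ENNReal.ofReal_mul zero_le_two, ENNReal.ofReal_ofNat, e1,
        ENNReal.ofReal_mul (Real.sqrt_nonneg M), ← ENNReal.ofReal_rpow_of_pos two_pos,
        ENNReal.ofReal_ofNat]
    have h1 := (eLpNorm_mono_measure (h j) (Measure.restrict_le_self (s := I))).trans
      (eLpNorm_level_le (C := C) hp1 hpt hν (2 ^ (j + 1) + 1) hD)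
    refine h1.trans ?_
    have h2 : ((2 ^ (j + 1) + 1 : ℕ) : ℝ≥0∞) ^ (1 / q) ≤ 4 ^ (1 / q) * 2 ^ (1 / q * j) := by
      rw [mul_comm (1 / q) (j : ℝ), ENNReal.rpow_mul, ENNReal.rpow_natCast,
        ← ENNReal.mul_rpow_of_nonneg _ _ (by positivity)]
      refine ENNReal.rpow_le_rpow ?_ (by positivity)
      have : 2 ^ (j + 1) + 1 ≤ 4 * 2 ^ j := by
        rw [pow_succ]; linarith [Nat.one_le_two_pow (n := j)]
      exact_mod_cast this
    have h3 : ρ ^ j = 2 ^ (1 / q * j) * 2 ^ (-(1 / 2) * j : ℝ) := by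
      rw [hρ, ← ENNReal.rpow_natCast, ← ENNReal.rpow_mul, sub_mul, sub_eq_add_neg, ← neg_mul,
        ENNReal.rpow_add _ _ two_ne_zero ENNReal.ofNat_ne_top]
    rw [h3]
    refine (mul_le_mul_left h2 _).trans_eq ?_
    ring
  calc eLpNorm (fun t => ν t (Φ t)) p (volume.restrict I)
      ≤ eLpNorm (fun t => ∑' j, h j t) p (volume.restrict I) := by
        refine eLpNorm_mono_enorm_ae ?_
        filter_upwards [ae_restrict_mem hI] with t ht using hptw t ht
    _ ≤ ∑' j, eLpNorm (h j) p (volume.restrict I) := eLpNorm_tsum_le hp1 hpt hmeas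
    _ ≤ ∑' j, (4 ^ (1 / q) * 2 * (C * ENNReal.ofReal (Real.sqrt M))) * ρ ^ j :=
        ENNReal.tsum_le_tsum hlev
    _ = K * C * ENNReal.ofReal (Real.sqrt M) := by
        rw [ENNReal.tsum_mul_left, ENNReal.tsum_geometric, hK]
        ring

/-! ### The family of norms attached to an admissible triple -/

/-- Fatou's lemma along an almost everywhere convergent subsequence. -/
lemma lowerSemicontinuous_eLpNorm (r : ℝ≥0∞) :
    LowerSemicontinuous fun f : L2 => eLpNorm f r volume := by
  rw [lowerSemicontinuous_iff_isClosed_preimage]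
  refine fun a => IsSeqClosed.isClosed fun f g hf hfg => ?_
  obtain ⟨ns, -, hae⟩ := (tendstoInMeasure_of_tendsto_Lp hfg).exists_seq_tendsto_ae
  refine (Lp.eLpNorm_lim_le_liminf_eLpNorm (fun i => Lp.aestronglyMeasurable (f (ns i))) g hae).trans ?_
  refine (Filter.liminf_le_liminf (v := fun _ => a) (Filter.Eventually.of_forall fun i => hf (ns i))).trans_eq ?_
  exact Filter.liminf_const a

/-! ### Existence of solutions of Duhamel's equation -/

lemma exists_gt_mem_timeInterval {T : ℝ≥0∞} {t : ℝ} (ht : t ∈ timeInterval T) :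
    ∃ M, |t| < M ∧ M ∈ timeInterval T := by
  have ha : |t| ∈ timeInterval T := mem_timeInterval_of_abs_le ht (by rw [abs_abs])
  obtain ⟨δ, hδ, hball⟩ := Metric.mem_nhds_iff.1 ((isOpen_timeInterval T).mem_nhds ha)
  refine ⟨|t| + δ / 2, by linarith, hball ?_⟩
  rw [Metric.mem_ball, Real.dist_eq, abs_lt]
  constructor <;> linarith

lemma hasDerivAt_primitive {T : ℝ≥0∞} {f : ℝ → L2} (hf : ContinuousOn f (timeInterval T)) {t : ℝ}
    (ht : t ∈ timeInterval T) : HasDerivAt (fun s => ∫ τ in (0 : ℝ)..s, f τ) (f t) t := by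
  have hn := (isOpen_timeInterval T).mem_nhds ht
  have h0 : (0 : ℝ) ∈ timeInterval T := mem_timeInterval_of_abs_le ht (by simp)
  exact intervalIntegral.integral_hasDerivAt_right
    ((hf.mono (uIcc_subset_timeInterval h0 ht)).intervalIntegrable)
    (hf.stronglyMeasurableAtFilter (isOpen_timeInterval T) t ht) (hf.continuousAt hn)

/-- The generator of the interaction picture. -/
def interaction (W : ℝ → L2 →L[ℂ] L2) (t : ℝ) : L2 →L[ℂ] L2 :=
  Complex.I • (freeGroup (-t) ∘L W t ∘L freeGroup t)

lemma interaction_apply (W : ℝ → L2 →L[ℂ] L2) (t : ℝ) (f : L2) :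
    interaction W t f = Complex.I • freeGroup (-t) (W t (freeGroup t f)) := rfl

lemma norm_interaction_le {W : ℝ → L2 →L[ℂ] L2} {ε t : ℝ} (h : ‖W t‖ ≤ ε) (f : L2) :
    ‖interaction W t f‖ ≤ ε * ‖f‖ := by
  rw [interaction_apply, norm_smul, Complex.norm_I, one_mul, norm_freeGroup]
  refine ((W t).le_of_opNorm_le h _).trans_eq ?_
  rw [norm_freeGroup]

lemma continuousOn_freeGroup {s : Set ℝ} {F : ℝ → L2} (hF : ContinuousOn F s) :
    ContinuousOn (fun τ => freeGroup τ (F τ)) s := by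
  have h : ContinuousOn (fun τ : ℝ => (τ, F τ)) s := continuousOn_id.prodMk hF
  have h2 := continuous_freeGroup_uncurry.comp_continuousOn h
  simp only [Function.comp_def] at h2
  exact h2

lemma continuousOn_interaction {W : ℝ → L2 →L[ℂ] L2} {s : Set ℝ} (hW : ContinuousOn W s)
    {v : ℝ → L2} (hv : ContinuousOn v s) : ContinuousOn (fun t => interaction W t (v t)) s :=
  (continuousOn_freeGroup_neg (hW.clm_apply (continuousOn_freeGroup hv))).const_smul Complex.I

/-- The Picard iterates of the equation `v' = i S(-t) W(t) S(t) v`. -/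
def picardTerm (W : ℝ → L2 →L[ℂ] L2) (y₀ : L2) : ℕ → ℝ → L2
  | 0 => fun _ => y₀
  | n + 1 => fun t => ∫ τ in (0 : ℝ)..t, interaction W τ (picardTerm W y₀ n τ)

section Picard

variable {T : ℝ≥0∞} {W : ℝ → L2 →L[ℂ] L2} {ε : ℝ} (y₀ : L2)

lemma continuousOn_picardTerm (hW : ContinuousOn W (timeInterval T)) (n : ℕ) :
    ContinuousOn (picardTerm W y₀ n) (timeInterval T) := by
  induction n with
  | zero => exact continuousOn_const
  | succ n ih => exact fun t ht =>
      (hasDerivAt_primitive (continuousOn_interaction hW ih) ht).continuousAt.continuousWithinAt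

/-- Unitarity makes the interaction generator as small as W, so the iterated integrals obey the
exponential series bound. -/
lemma norm_picardTerm_le (hW : ContinuousOn W (timeInterval T)) (hε : 0 ≤ ε)
    (hWε : ∀ t ∈ timeInterval T, ‖W t‖ ≤ ε) (n : ℕ) :
    ∀ t ∈ timeInterval T, ‖picardTerm W y₀ n t‖ ≤ ‖y₀‖ * ((ε * |t|) ^ n / n.factorial) := by
  induction n with
  | zero => intro t _; simp [picardTerm]
  | succ n ih =>
    intro t ht
    have h0 : (0 : ℝ) ∈ timeInterval T := mem_timeInterval_of_abs_le ht (by simp)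
    have hsub : uIoc 0 t ⊆ timeInterval T := uIoc_subset_uIcc.trans (uIcc_subset_timeInterval h0 ht)
    have hc := continuousOn_interaction hW (continuousOn_picardTerm y₀ hW n)
    have hi : IntegrableOn (fun τ => interaction W τ (picardTerm W y₀ n τ)) (uIoc 0 t) :=
      ((hc.mono (uIcc_subset_timeInterval h0 ht)).integrableOn_compact isCompact_uIcc).mono_set
        uIoc_subset_uIcc
    have hg : Continuous fun τ : ℝ => ε * (‖y₀‖ * (ε ^ n / n.factorial)) * |τ - 0| ^ n := by fun_prop
    calc ‖picardTerm W y₀ (n + 1) t‖ ≤ ∫ τ in uIoc 0 t, ‖interaction W τ (picardTerm W y₀ n τ)‖ :=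
          intervalIntegral.norm_integral_le_integral_norm_uIoc
      _ ≤ ∫ τ in uIoc 0 t, ε * (‖y₀‖ * (ε ^ n / n.factorial)) * |τ - 0| ^ n := by
          refine setIntegral_mono_on hi.norm ?_ measurableSet_uIoc fun τ hτ => ?_
          · exact (hg.continuousOn.integrableOn_compact isCompact_uIcc).mono_set uIoc_subset_uIcc
          · refine (norm_interaction_le (hWε τ (hsub hτ)) _).trans ?_
            refine (mul_le_mul_of_nonneg_left (ih τ (hsub hτ)) hε).trans_eq ?_
            rw [mul_pow, sub_zero]
            ring
      _ = ‖y₀‖ * ((ε * |t|) ^ (n + 1) / (n + 1).factorial) := by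
          rw [integral_const_mul, integral_pow_abs_sub_uIoc, sub_zero, Nat.factorial_succ, mul_pow]
          push_cast
          field_simp
          ring

lemma summable_picard_bound (c a : ℝ) :
    Summable fun n : ℕ => c * (a ^ n / n.factorial) :=
  (Real.summable_pow_div_factorial a).mul_left c

lemma norm_picardTerm_le_of_mem (hW : ContinuousOn W (timeInterval T)) (hε : 0 ≤ ε)
    (hWε : ∀ t ∈ timeInterval T, ‖W t‖ ≤ ε) {M : ℝ} (hM : M ∈ timeInterval T) (n : ℕ) {t : ℝ}
    (ht : t ∈ Icc (-M) M) : ‖picardTerm W y₀ n t‖ ≤ ‖y₀‖ * ((ε * M) ^ n / n.factorial) := by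
  refine (norm_picardTerm_le y₀ hW hε hWε n t (Icc_subset_timeInterval hM ht)).trans ?_
  gcongr
  exact abs_le.2 ht

/-- The Dyson series of the interaction picture converges uniformly on compact subintervals, and
dominated convergence lets it be integrated term by term. -/
theorem exists_isDuhamel (hW : ContinuousOn W (timeInterval T)) (hε : 0 ≤ ε)
    (hWε : ∀ t ∈ timeInterval T, ‖W t‖ ≤ ε) :
    ∃ y, IsDuhamel T (fun t => W t (y t)) y₀ y := by
  set v : ℝ → L2 := fun t => ∑' n, picardTerm W y₀ n t with hv
  have hsum : ∀ t ∈ timeInterval T, HasSum (fun n => picardTerm W y₀ n t) (v t) := fun t ht =>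
    (Summable.of_norm_bounded (summable_picard_bound ‖y₀‖ (ε * |t|))
      fun n => norm_picardTerm_le y₀ hW hε hWε n t ht).hasSum
  have hvc : ContinuousOn v (timeInterval T) := fun t ht => by
    obtain ⟨M, htM, hM⟩ := exists_gt_mem_timeInterval ht
    have hc : ContinuousOn v (Icc (-M) M) := continuousOn_tsum
      (fun n => (continuousOn_picardTerm y₀ hW n).mono (Icc_subset_timeInterval hM))
      (summable_picard_bound ‖y₀‖ (ε * M))
      fun n t ht => norm_picardTerm_le_of_mem y₀ hW hε hWε hM n ht
    obtain ⟨h1, h2⟩ := abs_lt.1 htM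
    exact (hc.continuousAt (Icc_mem_nhds h1 h2)).continuousWithinAt
  have heq : ∀ t ∈ timeInterval T, v t = y₀ + ∫ τ in (0 : ℝ)..t, interaction W τ (v τ) := fun t ht => by
    have h0 : (0 : ℝ) ∈ timeInterval T := mem_timeInterval_of_abs_le ht (by simp)
    have hsub : uIoc 0 t ⊆ timeInterval T := uIoc_subset_uIcc.trans (uIcc_subset_timeInterval h0 ht)
    have hM : |t| ∈ timeInterval T := mem_timeInterval_of_abs_le ht (by rw [abs_abs])
    have h0t : uIoc 0 t ⊆ Icc (-|t|) |t| := uIoc_subset_uIcc.trans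
      (uIcc_subset_Icc ⟨by simp, by simp⟩ ⟨neg_abs_le t, le_abs_self t⟩)
    have hint : HasSum (fun n => picardTerm W y₀ (n + 1) t)
        (∫ τ in (0 : ℝ)..t, interaction W τ (v τ)) := by
      refine intervalIntegral.hasSum_integral_of_dominated_convergence
        (fun n _ => ε * (‖y₀‖ * ((ε * |t|) ^ n / n.factorial))) (fun n => ?_) (fun n => ?_)
        (Filter.Eventually.of_forall fun τ _ => (summable_picard_bound _ _).mul_left ε)
        intervalIntegrable_const (Filter.Eventually.of_forall fun τ hτ => ?_)
      · exact ((continuousOn_interaction hW (continuousOn_picardTerm y₀ hW n)).mono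
          hsub).aestronglyMeasurable measurableSet_uIoc
      · refine Filter.Eventually.of_forall fun τ hτ => ?_
        refine (norm_interaction_le (hWε τ (hsub hτ)) _).trans ?_
        exact mul_le_mul_of_nonneg_left (norm_picardTerm_le_of_mem y₀ hW hε hWε hM n (h0t hτ)) hε
      · exact (hsum τ (hsub hτ)).mapL (interaction W τ)
    have h1 := (hasSum_nat_add_iff' (f := fun n => picardTerm W y₀ n t) 1).2 (hsum t ht)
    rw [Finset.sum_range_one] at h1
    rw [← h1.unique hint]
    simp [picardTerm]
  refine ⟨fun t => freeGroup t (v t), continuousOn_freeGroup hvc,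
    hW.clm_apply (continuousOn_freeGroup hvc), fun t ht => ?_⟩
  simp only
  rw [heq t ht, ← intervalIntegral.integral_smul]
  rfl

end Picard

/-! ### Pairings with test functions -/

/-- The pairing `f ↦ ∫ h f` with a Schwartz function. -/
def schwartzPairing (h : 𝓢(E3, ℂ)) : L2 →L[ℂ] E4 :=
  (PointwiseConvergenceCLM.evalCLM (RingHom.id ℂ) E4 h) ∘L
    (Lp.toTemperedDistributionCLM E4 (volume : Measure E3) 2)

lemma schwartzPairing_eq_integral (h : 𝓢(E3, ℂ)) (f : L2) :
    schwartzPairing h f = ∫ ξ, h ξ • f ξ := Lp.toTemperedDistribution_apply f h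

lemma eq_of_schwartzPairing_eq {f g : L2} (h : ∀ ψ, schwartzPairing ψ f = schwartzPairing ψ g) :
    f = g := by
  have hinj : Function.Injective (Lp.toTemperedDistributionCLM E4 (volume : Measure E3) 2) :=
    LinearMap.ker_eq_bot.1 Lp.ker_toTemperedDistributionCLM_eq_bot
  exact hinj (ContinuousLinearMap.ext h)

lemma pairing_fourier (f : L2) (ψ : 𝓢(E3, ℂ)) :
    (f : 𝓢'(E3, E4)) (𝓕 ψ) = schwartzPairing ψ (fourierIso f) := by
  rw [← TemperedDistribution.fourier_apply, Lp.fourier_toTemperedDistribution_eq]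
  rfl

lemma lineDeriv_pairing_fourier (k : Fin 3) (f : L2) (ψ : 𝓢(E3, ℂ)) :
    (∂_{EuclideanSpace.single k (1 : ℝ)} (f : 𝓢'(E3, E4))) (𝓕 ψ) =
      (2 * Real.pi * Complex.I) • ∫ ξ, (((ξ k : ℝ) : ℂ) * ψ ξ) • fourierIso f ξ := by
  rw [← TemperedDistribution.fourier_apply, TemperedDistribution.fourier_lineDerivOp_eq,
    Lp.fourier_toTemperedDistribution_eq]
  simp only [smul_apply, TemperedDistribution.smulLeftCLM_apply_apply]
  rw [Lp.toTemperedDistribution_apply]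
  congr 1
  refine integral_congr_ae (Filter.Eventually.of_forall fun ξ => ?_)
  have hg : (fun x : E3 => ((inner ℝ x (EuclideanSpace.single k 1) : ℝ) : ℂ)).HasTemperateGrowth := by
    fun_prop
  simp only
  rw [SchwartzMap.smulLeftCLM_apply_apply hg, EuclideanSpace.inner_single_right, smul_eq_mul]
  simp
  rfl

lemma exists_norm_diracSymbol_le_jap : ∃ C : ℝ, 0 ≤ C ∧ ∀ ξ, ‖diracSymbol ξ‖ ≤ C * jap ξ := by
  refine ⟨2 * Real.pi * ∑ k, ‖alpha k‖ + ‖beta‖, by positivity, fun ξ => ?_⟩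
  have h1 := one_le_jap ξ
  have hk : ∀ k : Fin 3, ‖((2 * Real.pi * ξ k : ℝ) : ℂ) • alpha k‖ ≤ 2 * Real.pi * jap ξ * ‖alpha k‖ := fun k => by
    rw [norm_smul, Complex.norm_real, norm_mul, Real.norm_of_nonneg (by positivity)]
    gcongr
    exact (PiLp.norm_apply_le ξ k).trans (norm_le_jap ξ)
  calc ‖diracSymbol ξ‖ ≤ (∑ k, ‖((2 * Real.pi * ξ k : ℝ) : ℂ) • alpha k‖) + ‖beta‖ :=
        (norm_add_le _ _).trans (add_le_add (norm_sum_le _ _) le_rfl)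
    _ ≤ (∑ k, 2 * Real.pi * jap ξ * ‖alpha k‖) + ‖beta‖ * jap ξ :=
        add_le_add (Finset.sum_le_sum fun k _ => hk k) (le_mul_of_one_le_right (norm_nonneg _) h1)
    _ = _ := by rw [← Finset.mul_sum]; ring

/-- The field `⟨ξ⟩^{-2} (∑ 2π ξ_k α_k + β)`. -/
def diracJapField (ξ : E3) : E4 →L[ℂ] E4 := ((jap ξ ^ (-2 : ℝ) : ℝ) : ℂ) • diracSymbol ξ

lemma bddField_diracJap : BddField diracJapField := by
  obtain ⟨C, hC0, hC⟩ := exists_norm_diracSymbol_le_jap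
  have hc : Continuous diracJapField :=
    (Complex.continuous_ofReal.comp (continuous_jap_rpow _)).smul continuous_diracSymbol
  refine BddField.of_continuous hc (C := C) fun ξ => ?_
  have hj := Real.rpow_nonneg (jap_pos ξ).le (-2)
  rw [diracJapField, norm_smul, Complex.norm_real, Real.norm_of_nonneg hj]
  calc jap ξ ^ (-2 : ℝ) * ‖diracSymbol ξ‖ ≤ jap ξ ^ (-2 : ℝ) * (C * jap ξ) := by gcongr; exact hC ξ
    _ = C * jap ξ ^ (-1 : ℝ) := by
      rw [show (-1 : ℝ) = -2 + 1 by norm_num, Real.rpow_add (jap_pos ξ), Real.rpow_one]; ring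
    _ ≤ C * 1 := by
      gcongr
      exact Real.rpow_le_one_of_one_le_of_nonpos (one_le_jap ξ) (by norm_num)
    _ = C := mul_one C

/-- Multiplication by `⟨ξ⟩^{-2} (∑ 2π ξ_k α_k + β)`. -/
def diracJapOp : L2 →L[ℂ] L2 := pointwiseOp bddField_diracJap

lemma diracJapOp_coeFn (f : L2) :
    diracJapOp f =ᵐ[volume] fun ξ => ((jap ξ ^ (-2 : ℝ) : ℝ) : ℂ) • diracSymbol ξ (f ξ) :=
  pointwiseOp_coeFn bddField_diracJap f

/-- `⟨ξ⟩^{-2} h` for a scalar Schwartz function `h`. -/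
def scalarJap (k : ℝ) (h : 𝓢(E3, ℂ)) : 𝓢(E3, ℂ) :=
  SchwartzMap.smulLeftCLM ℂ (fun x : E3 => (1 + ‖x‖ ^ 2) ^ (k / 2)) h

lemma scalarJap_apply (k : ℝ) (h : 𝓢(E3, ℂ)) (ξ : E3) :
    scalarJap k h ξ = ((jap ξ ^ k : ℝ) : ℂ) * h ξ := by
  rw [scalarJap, SchwartzMap.smulLeftCLM_apply_apply (by fun_prop), ← jap_rpow, Complex.real_smul]

/-- Any test function carries a factor ⟨ξ⟩^{-2} in frequency. Shifting this factor onto the solution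
makes the Dirac operator bounded. -/
lemma exists_eq_fourier_scalarJap (φ : 𝓢(E3, ℂ)) : ∃ h, φ = 𝓕 (scalarJap (-2) h) := by
  refine ⟨scalarJap 2 (𝓕⁻ φ), ?_⟩
  have : scalarJap (-2) (scalarJap 2 (𝓕⁻ φ)) = 𝓕⁻ φ := by
    ext ξ
    rw [scalarJap_apply, scalarJap_apply, ← mul_assoc, ← Complex.ofReal_mul,
      ← Real.rpow_add (jap_pos ξ), neg_add_cancel, Real.rpow_zero, Complex.ofReal_one, one_mul]
  rw [this, FourierTransform.fourier_fourierInv_eq]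

lemma pairing_fourier_scalarJap (f : L2) (h : 𝓢(E3, ℂ)) :
    (f : 𝓢'(E3, E4)) (𝓕 (scalarJap (-2) h)) = schwartzPairing h (japOp 2 (fourierIso f)) := by
  rw [pairing_fourier, schwartzPairing_eq_integral, schwartzPairing_eq_integral]
  refine integral_congr_ae ?_
  filter_upwards [japOp_coeFn zero_le_two (fourierIso f)] with ξ hξ
  rw [hξ, scalarJap_apply, mul_comm, mul_smul]
  rfl

lemma integrable_schwartz_smul (h : 𝓢(E3, ℂ)) (f : L2) : Integrable fun ξ => h ξ • f ξ :=
  memLp_one_iff_integrable.1 ((Lp.memLp f).smul (h.memLp 2 volume))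

/-- In frequency -i∂_k becomes -i·2πiξ_k = 2πξ_k. With the weight ⟨ξ⟩^{-2} the distribution 𝓓f is
represented by a bounded multiplier acting on the transform of f. -/
lemma diracPairing_fourier_scalarJap (f : L2) (h : 𝓢(E3, ℂ)) :
    diracPairing (f : 𝓢'(E3, E4)) (𝓕 (scalarJap (-2) h)) =
      schwartzPairing h (diracJapOp (fourierIso f)) := by
  have hk : ∀ k : Fin 3, Integrable fun ξ : E3 =>
      (((ξ k : ℝ) : ℂ) * scalarJap (-2) h ξ) • fourierIso f ξ := fun k => by
    have hg : (fun x : E3 => ((inner ℝ x (EuclideanSpace.single k 1) : ℝ) : ℂ)).HasTemperateGrowth := by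
      fun_prop
    refine (integrable_schwartz_smul (SchwartzMap.smulLeftCLM ℂ
      (fun x : E3 => ((inner ℝ x (EuclideanSpace.single k 1) : ℝ) : ℂ)) (scalarJap (-2) h))
      (fourierIso f)).congr (Filter.Eventually.of_forall fun ξ => ?_)
    simp only
    rw [SchwartzMap.smulLeftCLM_apply_apply hg, EuclideanSpace.inner_single_right, smul_eq_mul]
    simp
  have h0 := integrable_schwartz_smul (scalarJap (-2) h) (fourierIso f)
  have hk2 : ∀ k : Fin 3, Integrable fun ξ : E3 => ((2 * Real.pi : ℝ) : ℂ) •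
      alpha k ((((ξ k : ℝ) : ℂ) * scalarJap (-2) h ξ) • fourierIso f ξ) := fun k => by
    have h := ((alpha k).integrable_comp (hk k)).smul ((2 * Real.pi : ℝ) : ℂ)
    exact h
  have hk3 : Integrable fun ξ : E3 => ∑ k : Fin 3, ((2 * Real.pi : ℝ) : ℂ) •
      alpha k ((((ξ k : ℝ) : ℂ) * scalarJap (-2) h ξ) • fourierIso f ξ) :=
    integrable_finsetSum _ fun k _ => hk2 k
  rw [diracPairing, pairing_fourier, schwartzPairing_eq_integral, schwartzPairing_eq_integral,
    ← ContinuousLinearMap.integral_comp_comm beta h0]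
  have hsum : -Complex.I • ∑ k : Fin 3, alpha k ((∂_{EuclideanSpace.single k (1 : ℝ)}
      (f : 𝓢'(E3, E4))) (𝓕 (scalarJap (-2) h))) = ∫ ξ, ∑ k : Fin 3, ((2 * Real.pi : ℝ) : ℂ) •
        alpha k ((((ξ k : ℝ) : ℂ) * scalarJap (-2) h ξ) • fourierIso f ξ) := by
    rw [integral_finsetSum _ fun k _ => hk2 k, Finset.smul_sum]
    refine Finset.sum_congr rfl fun k _ => ?_
    rw [lineDeriv_pairing_fourier, map_smul, smul_smul, integral_smul,
      ContinuousLinearMap.integral_comp_comm (alpha k) (hk k)]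
    congr 1
    push_cast
    linear_combination (-(2 * Real.pi) : ℂ) * Complex.I_mul_I
  rw [hsum, ← integral_add hk3 (beta.integrable_comp h0)]
  refine integral_congr_ae ?_
  filter_upwards [diracJapOp_coeFn (fourierIso f)] with ξ hξ
  rw [hξ]
  simp only [diracSymbol, add_apply, sum_apply, smul_apply, map_smul, smul_add, Finset.smul_sum,
    smul_smul, scalarJap_apply]
  congr 1
  · refine Finset.sum_congr rfl fun k _ => ?_
    congr 1
    push_cast
    ring
  · rw [mul_comm]

/-! ### Differentiability of the regularized free group -/

lemma norm_diracExp_sub_le (ξ : E3) (v : E4) (s : ℝ) :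
    ‖diracExp s ξ v - v‖ ≤ ‖diracSymbol ξ‖ * ‖v‖ * |s| := by
  have hd : ∀ τ : ℝ, HasDerivAt (fun τ : ℝ => diracExp τ ξ v)
      ((Complex.I • diracSymbol ξ * diracExp τ ξ) v) τ := fun τ => by
    have h := ((ContinuousLinearMap.apply ℂ E4 v).restrictScalars ℝ).hasFDerivAt.comp_hasDerivAt τ
      (hasDerivAt_diracExp τ ξ)
    exact h
  have h := Convex.norm_image_sub_le_of_norm_hasDerivWithin_le (s := univ) (x := 0) (y := s)
    (C := ‖diracSymbol ξ‖ * ‖v‖) (fun τ _ => (hd τ).hasDerivWithinAt) (fun τ _ => ?_) convex_univ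
    trivial trivial
  · simpa [diracExp_zero] using h
  · change ‖Complex.I • diracSymbol ξ (diracExp τ ξ v)‖ ≤ _
    rw [norm_smul, Complex.norm_I, one_mul]
    refine ((diracSymbol ξ).le_opNorm _).trans ?_
    rw [norm_diracExp_apply]

/-- Second-order Taylor remainder by the mean value inequality. Its factor ‖symbol‖² is exactly what
⟨ξ⟩^{-2} compensates. -/
lemma norm_diracExp_sub_sub_le (ξ : E3) (v : E4) (s : ℝ) :
    ‖diracExp s ξ v - v - s • (Complex.I • diracSymbol ξ v)‖ ≤ ‖diracSymbol ξ‖ ^ 2 * ‖v‖ * |s| ^ 2 := by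
  have hd : ∀ τ : ℝ, HasDerivAt
      (fun τ : ℝ => diracExp τ ξ v - v - τ • (Complex.I • diracSymbol ξ v))
      (Complex.I • diracSymbol ξ (diracExp τ ξ v - v)) τ := fun τ => by
    have h := ((ContinuousLinearMap.apply ℂ E4 v).restrictScalars ℝ).hasFDerivAt.comp_hasDerivAt τ
      (hasDerivAt_diracExp τ ξ)
    have h2 := (h.sub_const v).sub ((hasDerivAt_id τ).smul_const (Complex.I • diracSymbol ξ v))
    refine h2.congr_deriv ?_
    change Complex.I • diracSymbol ξ (diracExp τ ξ v) - (1 : ℝ) • _ = _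
    rw [one_smul, map_sub, smul_sub]
  have h := Convex.norm_image_sub_le_of_norm_hasDerivWithin_le (s := uIcc 0 s) (x := 0) (y := s)
    (C := ‖diracSymbol ξ‖ ^ 2 * ‖v‖ * |s|) (fun τ _ => (hd τ).hasDerivWithinAt) (fun τ hτ => ?_)
    (convex_uIcc 0 s) left_mem_uIcc right_mem_uIcc
  · refine (le_of_eq ?_).trans (h.trans (le_of_eq ?_))
    · simp [diracExp_zero]
    · rw [sub_zero, Real.norm_eq_abs]; ring
  · rw [norm_smul, Complex.norm_I, one_mul]
    have hτ' : |τ| ≤ |s| := by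
      have := abs_sub_left_of_mem_uIcc hτ
      simpa using this
    calc ‖diracSymbol ξ (diracExp τ ξ v - v)‖ ≤ ‖diracSymbol ξ‖ * (‖diracSymbol ξ‖ * ‖v‖ * |τ|) :=
          ((diracSymbol ξ).le_opNorm _).trans (by gcongr; exact norm_diracExp_sub_le ξ v τ)
      _ ≤ ‖diracSymbol ξ‖ * (‖diracSymbol ξ‖ * ‖v‖ * |s|) := by gcongr
      _ = _ := by ring

lemma fourierGroup_japOp (t : ℝ) (f : L2) : fourierGroup t (japOp 2 f) = japOp 2 (fourierGroup t f) := by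
  refine Lp.ext ?_
  filter_upwards [fourierGroup_coeFn t (japOp 2 f), japOp_coeFn zero_le_two f,
    japOp_coeFn zero_le_two (fourierGroup t f), fourierGroup_coeFn t f] with ξ h1 h2 h3 h4
  rw [h1, h2, h3, h4]
  exact ((diracExp t ξ).restrictScalars ℝ).map_smul _ _

lemma japOp_diracJapOp (f : L2) : japOp 2 (diracJapOp f) = diracJapOp (japOp 2 f) := by
  refine Lp.ext ?_
  filter_upwards [japOp_coeFn zero_le_two (diracJapOp f), diracJapOp_coeFn f,
    japOp_coeFn zero_le_two f, diracJapOp_coeFn (japOp 2 f)] with ξ h1 h2 h3 h4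
  rw [h1, h2, h4, h3]
  congr 1
  have := ((diracSymbol ξ).restrictScalars ℝ).map_smul (jap ξ ^ (-2 : ℝ)) (f ξ)
  exact this.symm

lemma diracExp_diracSymbol (t : ℝ) (ξ : E3) (v : E4) :
    diracExp t ξ (diracSymbol ξ v) = diracSymbol ξ (diracExp t ξ v) := by
  have h := (hasDerivAt_diracExp t ξ).unique (hasDerivAt_diracExp' t ξ)
  have h2 := DFunLike.congr_fun h v
  change Complex.I • diracSymbol ξ (diracExp t ξ v) = diracExp t ξ (Complex.I • diracSymbol ξ v) at h2
  rw [map_smul] at h2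
  exact (smul_right_injective _ Complex.I_ne_zero h2).symm

lemma fourierGroup_diracJapOp (t : ℝ) (f : L2) :
    fourierGroup t (diracJapOp f) = diracJapOp (fourierGroup t f) := by
  refine Lp.ext ?_
  filter_upwards [fourierGroup_coeFn t (diracJapOp f), diracJapOp_coeFn f,
    diracJapOp_coeFn (fourierGroup t f), fourierGroup_coeFn t f] with ξ h1 h2 h3 h4
  rw [h1, h2, h3, h4, map_smul, diracExp_diracSymbol]

lemma japOp_injective : Function.Injective (japOp 2) := by
  intro f g h
  refine Lp.ext ?_
  filter_upwards [japOp_coeFn zero_le_two f, japOp_coeFn zero_le_two g] with ξ h1 h2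
  rw [h] at h1
  exact smul_right_injective E4 (Real.rpow_pos_of_pos (jap_pos ξ) (-2)).ne' (h1.symm.trans h2)

/-- The regularized group is differentiable in the operator norm. -/
lemma hasDerivAt_japOp_fourierGroup (t : ℝ) :
    HasDerivAt (fun τ => japOp 2 ∘L fourierGroup τ)
      (Complex.I • (diracJapOp ∘L fourierGroup t)) t := by
  obtain ⟨C, hC0, hC⟩ := exists_norm_diracSymbol_le_jap
  rw [hasDerivAt_iff_isLittleO_nhds_zero]
  refine Asymptotics.IsBigO.trans_isLittleO (g := fun h : ℝ => h ^ 2) ?_ ?_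
  · refine Asymptotics.IsBigO.of_bound (C ^ 2) (Filter.Eventually.of_forall fun s => ?_)
    rw [Real.norm_of_nonneg (by positivity)]
    refine ContinuousLinearMap.opNorm_le_bound _ (by positivity) fun f => ?_
    rw [← norm_fourierGroup t f]
    have he : (japOp 2 ∘L fourierGroup (t + s) - japOp 2 ∘L fourierGroup t -
        s • Complex.I • (diracJapOp ∘L fourierGroup t)) f =
        japOp 2 (fourierGroup s (fourierGroup t f)) - japOp 2 (fourierGroup t f) -
        s • Complex.I • diracJapOp (fourierGroup t f) := by
      rw [← fourierGroup_add, add_comm s t]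
      rfl
    rw [he]
    generalize fourierGroup t f = g
    refine Lp.norm_le_mul_norm_of_ae_le_mul ?_
    filter_upwards [Lp.coeFn_sub (japOp 2 (fourierGroup s g) - japOp 2 g)
        (s • Complex.I • diracJapOp g), Lp.coeFn_sub (japOp 2 (fourierGroup s g)) (japOp 2 g),
      Lp.coeFn_smul s (Complex.I • diracJapOp g), Lp.coeFn_smul Complex.I (diracJapOp g),
      japOp_coeFn zero_le_two (fourierGroup s g), japOp_coeFn zero_le_two g, diracJapOp_coeFn g,
      fourierGroup_coeFn s g] with ξ h1 h2 h3 h4 h5 h6 h7 h8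
    rw [h1, Pi.sub_apply, h2, h3, Pi.sub_apply, Pi.smul_apply, h4, Pi.smul_apply, h5, h6, h7, h8]
    have hj := Real.rpow_nonneg (jap_pos ξ).le (-2)
    have he2 : jap ξ ^ (-2 : ℝ) • diracExp s ξ (g ξ) - jap ξ ^ (-2 : ℝ) • g ξ -
        s • Complex.I • ((jap ξ ^ (-2 : ℝ) : ℝ) : ℂ) • diracSymbol ξ (g ξ) =
        jap ξ ^ (-2 : ℝ) • (diracExp s ξ (g ξ) - g ξ - s • (Complex.I • diracSymbol ξ (g ξ))) := by
      rw [smul_sub, smul_sub, Complex.coe_smul, smul_comm Complex.I (jap ξ ^ (-2 : ℝ)) (diracSymbol ξ (g ξ)),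
        smul_comm s (jap ξ ^ (-2 : ℝ))]
    rw [he2, norm_smul, Real.norm_of_nonneg hj]
    calc jap ξ ^ (-2 : ℝ) * ‖diracExp s ξ (g ξ) - g ξ - s • (Complex.I • diracSymbol ξ (g ξ))‖
        ≤ jap ξ ^ (-2 : ℝ) * ((C * jap ξ) ^ 2 * ‖g ξ‖ * |s| ^ 2) := by
          refine mul_le_mul_of_nonneg_left ((norm_diracExp_sub_sub_le ξ (g ξ) s).trans ?_) hj
          gcongr
          exact hC ξ
      _ = (jap ξ ^ (-2 : ℝ) * jap ξ ^ (2 : ℝ)) * (C ^ 2 * s ^ 2 * ‖g ξ‖) := by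
          rw [sq_abs, Real.rpow_two]; ring
      _ = C ^ 2 * s ^ 2 * ‖g ξ‖ := by
          rw [← Real.rpow_add (jap_pos ξ), neg_add_cancel, Real.rpow_zero, one_mul]
  · exact Asymptotics.isLittleO_pow_id one_lt_two

lemma HasDerivAt.clm_apply_complex {A : ℝ → L2 →L[ℂ] L2} {A' : L2 →L[ℂ] L2} {x : ℝ → L2} {x' : L2}
    {t : ℝ} (hA : HasDerivAt A A' t) (hx : HasDerivAt x x' t) :
    HasDerivAt (fun τ => A τ (x τ)) (A' (x t) + A t x') t := by
  have h1 := (ContinuousLinearMap.restrictScalarsL ℂ L2 L2 ℝ ℝ).hasFDerivAt.comp_hasDerivAt t hA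
  exact h1.clm_apply hx

/-! ### The equation in the sense of distributions and Duhamel's formula -/

lemma eqOn_of_hasDerivAt {E : Type*} [NormedAddCommGroup E] [NormedSpace ℝ E] {T : ℝ≥0∞}
    {f g f' : ℝ → E} (hf : ∀ t ∈ timeInterval T, HasDerivAt f (f' t) t)
    (hg : ∀ t ∈ timeInterval T, HasDerivAt g (f' t) t) (h0 : f 0 = g 0) :
    EqOn f g (timeInterval T) := fun t ht => by
  have hz : (0 : ℝ) ∈ timeInterval T := mem_timeInterval_of_abs_le ht (by simp)
  exact (isOpen_timeInterval T).eqOn_of_deriv_eq (ordConnected_timeInterval T).isPreconnected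
    (fun s hs => (hf s hs).differentiableAt.differentiableWithinAt)
    (fun s hs => (hg s hs).differentiableAt.differentiableWithinAt)
    (fun s hs => (hf s hs).deriv.trans (hg s hs).deriv.symm) hz h0 ht

variable {T : ℝ≥0∞} {U G : ℝ → L2}

/-- `U` solves `i ∂ₜ U + 𝓓 U + G = 0` on `(-T, T)` in the sense of tempered distributions. -/
def IsWeakSolution (T : ℝ≥0∞) (U G : ℝ → L2) : Prop :=
  ∀ t ∈ timeInterval T, ∀ φ : 𝓢(E3, ℂ), ∃ w : E4,
    HasDerivAt (fun τ => (U τ : 𝓢'(E3, E4)) φ) w t ∧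
      Complex.I • w + diracPairing (U t : 𝓢'(E3, E4)) φ + (G t : 𝓢'(E3, E4)) φ = 0

lemma continuousOn_fourierIso (hU : ContinuousOn U (timeInterval T)) :
    ContinuousOn (fun t => fourierIso (U t)) (timeInterval T) :=
  fourierIso.continuous.comp_continuousOn hU

/-- The right-hand side of the regularized equation on the Fourier side. -/
def regularizedRhs (U G : ℝ → L2) (t : ℝ) : L2 :=
  Complex.I • (diracJapOp (fourierIso (U t)) + japOp 2 (fourierIso (G t)))

lemma continuousOn_regularizedRhs (hU : ContinuousOn U (timeInterval T))
    (hG : ContinuousOn G (timeInterval T)) : ContinuousOn (regularizedRhs U G) (timeInterval T) :=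
  ((diracJapOp.continuous.comp_continuousOn (continuousOn_fourierIso hU)).add
    ((japOp 2).continuous.comp_continuousOn (continuousOn_fourierIso hG))).const_smul Complex.I

/-- Tested against each Schwartz function, the regularized solution and the primitive of its
continuous right-hand side have the same derivative and the same value at 0. Schwartz functions
separate L², so the two curves coincide and differentiability in norm follows. -/
lemma IsWeakSolution.hasDerivAt (h : IsWeakSolution T U G) (hU : ContinuousOn U (timeInterval T))
    (hG : ContinuousOn G (timeInterval T)) {t : ℝ} (ht : t ∈ timeInterval T) :
    HasDerivAt (fun τ => japOp 2 (fourierIso (U τ))) (regularizedRhs U G t) t := by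
  have hZ := continuousOn_regularizedRhs hU hG
  have hprim : ∀ s ∈ timeInterval T, HasDerivAt
      (fun τ => japOp 2 (fourierIso (U 0)) + ∫ σ in (0 : ℝ)..τ, regularizedRhs U G σ)
      (regularizedRhs U G s) s := fun s hs => (hasDerivAt_primitive hZ hs).const_add _
  have heq : EqOn (fun τ => japOp 2 (fourierIso (U τ)))
      (fun τ => japOp 2 (fourierIso (U 0)) + ∫ σ in (0 : ℝ)..τ, regularizedRhs U G σ)
      (timeInterval T) := by
    intro s hs
    refine eq_of_schwartzPairing_eq fun ψ => ?_
    refine eqOn_of_hasDerivAt (T := T) (f := fun τ => schwartzPairing ψ (japOp 2 (fourierIso (U τ))))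
      (g := fun τ => schwartzPairing ψ (japOp 2 (fourierIso (U 0)) +
        ∫ σ in (0 : ℝ)..τ, regularizedRhs U G σ))
      (f' := fun τ => schwartzPairing ψ (regularizedRhs U G τ)) (fun τ hτ => ?_) (fun τ hτ => ?_) ?_ hs
    · obtain ⟨w, hw, he⟩ := h τ hτ (𝓕 (scalarJap (-2) ψ))
      simp only [pairing_fourier_scalarJap] at hw
      rw [pairing_fourier_scalarJap, diracPairing_fourier_scalarJap] at he
      refine hw.congr_deriv ?_
      rw [regularizedRhs, map_smul, map_add]
      rw [add_assoc] at he
      have he2 := eq_neg_of_add_eq_zero_right he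
      rw [he2, smul_neg, smul_smul, Complex.I_mul_I, neg_one_smul, neg_neg]
    · exact ((schwartzPairing ψ).restrictScalars ℝ).hasFDerivAt.comp_hasDerivAt τ (hprim τ hτ)
    · simp
  exact (hprim t ht).congr_of_eventuallyEq
    (Filter.eventuallyEq_of_mem ((isOpen_timeInterval T).mem_nhds ht) heq)

lemma fourierIso_intervalIntegral (hG : ContinuousOn G (timeInterval T)) {t : ℝ}
    (ht : t ∈ timeInterval T) :
    fourierIso (∫ τ in (0 : ℝ)..t, freeGroup (-τ) (G τ)) =
      ∫ τ in (0 : ℝ)..t, fourierGroup (-τ) (fourierIso (G τ)) := by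
  have h0 : (0 : ℝ) ∈ timeInterval T := mem_timeInterval_of_abs_le ht (by simp)
  have hi : IntervalIntegrable (fun τ => freeGroup (-τ) (G τ)) volume 0 t :=
    ((continuousOn_freeGroup_neg hG).mono (uIcc_subset_timeInterval h0 ht)).intervalIntegrable
  have h := ContinuousLinearMap.intervalIntegral_comp_comm
    (fourierIso.toContinuousLinearEquiv : L2 →L[ℂ] L2) hi
  refine h.symm.trans ?_
  congr 1
  funext τ
  exact fourierIso_freeGroup _ _

lemma continuousOn_fourierGroup_neg (hG : ContinuousOn G (timeInterval T)) :
    ContinuousOn (fun τ => fourierGroup (-τ) (fourierIso (G τ))) (timeInterval T) := by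
  have h := fourierIso.continuous.comp_continuousOn (continuousOn_freeGroup_neg hG)
  refine h.congr fun τ _ => (fourierIso_freeGroup _ _).symm

/-- Solutions in the sense of distributions satisfy Duhamel's formula. -/
theorem IsWeakSolution.isDuhamel (h : IsWeakSolution T U G) (hU : ContinuousOn U (timeInterval T))
    (hG : ContinuousOn G (timeInterval T)) : IsDuhamel T G (U 0) U := by
  refine ⟨hU, hG, fun t ht => ?_⟩
  -- Two weights are used, one to differentiate the group in operator norm and one to differentiate
  -- the solution. The Dirac terms cancel, leaving only the forcing.
  have hder : ∀ s ∈ timeInterval T, HasDerivAt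
      (fun τ => japOp 2 (fourierGroup (-τ) (japOp 2 (fourierIso (U τ)))))
      (japOp 2 (japOp 2 (Complex.I • fourierGroup (-s) (fourierIso (G s))))) s := fun s hs => by
    have hA : HasDerivAt (fun τ => japOp 2 ∘L fourierGroup (-τ))
        (-(Complex.I • (diracJapOp ∘L fourierGroup (-s)))) s := by
      have h1 := (hasDerivAt_japOp_fourierGroup (-s)).scomp s (hasDerivAt_neg s)
      refine h1.congr_deriv ?_
      rw [neg_one_smul]
    refine (HasDerivAt.clm_apply_complex hA (h.hasDerivAt hU hG hs)).congr_deriv ?_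
    change -(Complex.I • diracJapOp (fourierGroup (-s) (japOp 2 (fourierIso (U s))))) +
      japOp 2 (fourierGroup (-s) (Complex.I •
        (diracJapOp (fourierIso (U s)) + japOp 2 (fourierIso (G s))))) = _
    rw [fourierGroup_japOp, ← japOp_diracJapOp, map_smul, map_smul, map_add, map_add,
      fourierGroup_diracJapOp, fourierGroup_japOp, smul_add, neg_add_cancel_left, map_smul, map_smul]
  have hprim : ∀ s ∈ timeInterval T, HasDerivAt
      (fun τ => japOp 2 (japOp 2 (fourierIso (U 0) +
        Complex.I • ∫ σ in (0 : ℝ)..τ, fourierGroup (-σ) (fourierIso (G σ)))))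
      (japOp 2 (japOp 2 (Complex.I • fourierGroup (-s) (fourierIso (G s))))) s := fun s hs => by
    have h1 := ((hasDerivAt_primitive (continuousOn_fourierGroup_neg hG) hs).const_smul
      Complex.I).const_add (fourierIso (U 0))
    exact ((japOp 2 ∘L japOp 2).restrictScalars ℝ).hasFDerivAt.comp_hasDerivAt s h1
  have heq := eqOn_of_hasDerivAt hder hprim (by
    simp only [neg_zero, fourierGroup_zero, intervalIntegral.integral_same, smul_zero, add_zero]) ht
  simp only at heq
  rw [fourierGroup_japOp] at heq
  have h2 := japOp_injective (japOp_injective heq)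
  rw [← fourierIso_intervalIntegral hG ht, ← map_smul, ← map_add, ← fourierIso_freeGroup] at h2
  rw [← fourierIso.injective h2, ← freeGroup_add, add_neg_cancel, freeGroup_zero]

/-- Duhamel's formula provides solutions in the sense of distributions. -/
theorem IsDuhamel.isWeakSolution {U₀ : L2} (h : IsDuhamel T G U₀ U) : IsWeakSolution T U G := by
  have hG := h.continuousOn_forcing
  have hder : ∀ t ∈ timeInterval T,
      HasDerivAt (fun τ => japOp 2 (fourierIso (U τ))) (regularizedRhs U G t) t := fun t ht => by
    set v : ℝ → L2 := fun τ => fourierIso U₀ +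
      Complex.I • ∫ σ in (0 : ℝ)..τ, fourierGroup (-σ) (fourierIso (G σ)) with hv
    have hUv : ∀ τ ∈ timeInterval T, fourierIso (U τ) = fourierGroup τ (v τ) := fun τ hτ => by
      rw [h.formula τ hτ, fourierIso_freeGroup, map_add, map_smul, fourierIso_intervalIntegral hG hτ]
    have hv' : HasDerivAt v (Complex.I • fourierGroup (-t) (fourierIso (G t))) t :=
      ((hasDerivAt_primitive (continuousOn_fourierGroup_neg hG) ht).const_smul
        Complex.I).const_add (fourierIso U₀)
    have h1 := HasDerivAt.clm_apply_complex (hasDerivAt_japOp_fourierGroup t) hv'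
    have h2 : HasDerivAt (fun τ => japOp 2 (fourierIso (U τ))) _ t := h1.congr_of_eventuallyEq
      (Filter.eventuallyEq_of_mem ((isOpen_timeInterval T).mem_nhds ht) fun τ hτ =>
        congrArg (japOp 2) (hUv τ hτ))
    refine h2.congr_deriv ?_
    change Complex.I • diracJapOp (fourierGroup t (v t)) +
      japOp 2 (fourierGroup t (Complex.I • fourierGroup (-t) (fourierIso (G t)))) = _
    rw [map_smul, ← fourierGroup_add, add_neg_cancel, fourierGroup_zero, map_smul, ← smul_add,
      ← hUv t ht, regularizedRhs]
  intro t ht φ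
  obtain ⟨ψ, rfl⟩ := exists_eq_fourier_scalarJap φ
  refine ⟨schwartzPairing ψ (regularizedRhs U G t), ?_, ?_⟩
  · simp only [pairing_fourier_scalarJap]
    exact ((schwartzPairing ψ).restrictScalars ℝ).hasFDerivAt.comp_hasDerivAt t (hder t ht)
  · rw [pairing_fourier_scalarJap, diracPairing_fourier_scalarJap, regularizedRhs, map_smul,
      smul_smul, Complex.I_mul_I, neg_one_smul, map_add]
    abel

/-! ### Conjugation with the Bessel potential -/

section Bessel

variable {s : ℝ≥0}

/-- `(1 - Δ)^{s/2}` as an isometry from `H^s` onto `L²`. -/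
def besselIso (s : ℝ≥0) : Hs s ≃ₗᵢ[ℂ] L2 := ⟨besselEquiv s, fun _ => rfl⟩

lemma enorm_besselIso (f : Hs s) : ‖besselIso s f‖ₑ = ‖f‖ₑ := by
  rw [← ofReal_norm, ← ofReal_norm, LinearIsometryEquiv.norm_map]

lemma toL2_injective : Function.Injective (toL2 : Hs s → L2) := Subtype.val_injective

lemma bddField_bessel (s : ℝ≥0) :
    BddField (scalarField fun ξ => jap ((2 * Real.pi) • ξ) ^ (-(s : ℝ))) := by
  have hc : Continuous fun ξ : E3 => jap ((2 * Real.pi) • ξ) ^ (-(s : ℝ)) :=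
    (continuous_jap_rpow _).comp (by fun_prop : Continuous fun ξ : E3 => (2 * Real.pi) • ξ)
  refine .scalar hc.measurable (C := 1) fun ξ => ?_
  rw [abs_of_nonneg (Real.rpow_nonneg (jap_pos _).le _)]
  exact Real.rpow_le_one_of_one_le_of_nonpos (one_le_jap _) (neg_nonpos.2 s.2)

/-- The operator `(1 - Δ)^{-s/2}` on `L²`. -/
def smoothOp (s : ℝ≥0) : L2 →L[ℂ] L2 :=
  (fourierIso.symm.toContinuousLinearEquiv : L2 →L[ℂ] L2) ∘L pointwiseOp (bddField_bessel s) ∘L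
    (fourierIso.toContinuousLinearEquiv : L2 →L[ℂ] L2)

lemma smoothOp_apply (f : L2) :
    smoothOp s f = fourierIso.symm (pointwiseOp (bddField_bessel s) (fourierIso f)) := rfl

lemma smoothOp_besselIso (f : Hs s) : smoothOp s (besselIso s f) = toL2 f := by
  have h1 : fourierIso (besselIso s f) = (memLp_besselFourier f).toLp _ :=
    fourierIso.apply_symm_apply _
  rw [smoothOp_apply, h1]
  refine (LinearIsometryEquiv.symm_apply_eq _).2 (pointwiseOp_ext _ ?_)
  filter_upwards [(memLp_besselFourier f).coeFn_toLp] with ξ hξ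
  rw [hξ, scalarField_apply, besselFourier, smul_smul, ← Real.rpow_add (jap_pos _), neg_add_cancel,
    Real.rpow_zero, one_smul]
  rfl

lemma smoothOp_eq (y : L2) : smoothOp s y = toL2 ((besselIso s).symm y) := by
  rw [← smoothOp_besselIso, LinearIsometryEquiv.apply_symm_apply]

lemma smoothOp_injective : Function.Injective (smoothOp s) := fun y y' h => by
  rw [smoothOp_eq, smoothOp_eq] at h
  exact (besselIso s).symm.injective (toL2_injective h)

lemma freeGroup_smoothOp (t : ℝ) (f : L2) :
    freeGroup t (smoothOp s f) = smoothOp s (freeGroup t f) := by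
  refine fourierIso.injective ?_
  rw [fourierIso_freeGroup, smoothOp_apply, smoothOp_apply, LinearIsometryEquiv.apply_symm_apply,
    LinearIsometryEquiv.apply_symm_apply, fourierIso_freeGroup]
  refine Lp.ext ?_
  filter_upwards [fourierGroup_coeFn t (pointwiseOp (bddField_bessel s) (fourierIso f)),
    pointwiseOp_scalar_coeFn (bddField_bessel s) (fourierIso f),
    pointwiseOp_scalar_coeFn (bddField_bessel s) (fourierGroup t (fourierIso f)),
    fourierGroup_coeFn t (fourierIso f)] with ξ h1 h2 h3 h4
  rw [h1, h2, h3, h4]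
  exact ((diracExp t ξ).restrictScalars ℝ).map_smul _ _

lemma continuous_toL2 : Continuous (toL2 : Hs s → L2) := by
  have h := (smoothOp s).continuous.comp (besselIso s).continuous
  refine h.congr fun f => ?_
  exact smoothOp_besselIso f

/-- The conjugate `(1 - Δ)^{s/2} A (1 - Δ)^{-s/2}` of an operator on `H^s`. -/
def conjOp (A : Hs s →L[ℂ] Hs s) : L2 →L[ℂ] L2 :=
  ((besselIso s).toContinuousLinearEquiv : Hs s →L[ℂ] L2) ∘L A ∘L
    ((besselIso s).symm.toContinuousLinearEquiv : L2 →L[ℂ] Hs s)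

lemma conjOp_apply (A : Hs s →L[ℂ] Hs s) (y : L2) :
    conjOp A y = besselIso s (A ((besselIso s).symm y)) := rfl

lemma conjOp_sub (A B : Hs s →L[ℂ] Hs s) (y : L2) : conjOp (A - B) y = conjOp A y - conjOp B y := by
  rw [conjOp_apply, sub_apply, map_sub]
  rfl

lemma continuousOn_conjOp {V : ℝ → Hs s →L[ℂ] Hs s} {I : Set ℝ} (hV : ContinuousOn V I) :
    ContinuousOn (fun t => conjOp (V t)) I :=
  continuousOn_const.clm_comp (hV.clm_comp continuousOn_const)

lemma IsDuhamel.map {T : ℝ≥0∞} {G : ℝ → L2} {y₀ : L2} {y : ℝ → L2} (h : IsDuhamel T G y₀ y)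
    {A : L2 →L[ℂ] L2} (hA : ∀ t f, freeGroup t (A f) = A (freeGroup t f)) :
    IsDuhamel T (fun t => A (G t)) (A y₀) (fun t => A (y t)) := by
  refine ⟨A.continuous.comp_continuousOn h.continuousOn,
    A.continuous.comp_continuousOn h.continuousOn_forcing, fun t ht => ?_⟩
  have h0 : (0 : ℝ) ∈ timeInterval T := mem_timeInterval_of_abs_le ht (by simp)
  have hi : IntervalIntegrable (fun τ => freeGroup (-τ) (G τ)) volume 0 t :=
    ((continuousOn_freeGroup_neg h.continuousOn_forcing).mono
      (uIcc_subset_timeInterval h0 ht)).intervalIntegrable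
  have h1 := A.intervalIntegral_comp_comm hi
  simp only [hA]
  rw [h1, ← map_smul, ← map_add, hA, h.formula t ht]

/-- Used with A = (1-Δ)^{-s/2}: Duhamel's formula known in L² for u is lifted to (1-Δ)^{s/2}u by
injectivity, given that the lifted curves are continuous. -/
lemma IsDuhamel.of_map {T : ℝ≥0∞} {G : ℝ → L2} {y₀ : L2} {y : ℝ → L2} {A : L2 →L[ℂ] L2}
    (h : IsDuhamel T (fun t => A (G t)) (A y₀) (fun t => A (y t)))
    (hy : ContinuousOn y (timeInterval T)) (hG : ContinuousOn G (timeInterval T))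
    (hA : ∀ t f, freeGroup t (A f) = A (freeGroup t f)) (hinj : Function.Injective A) :
    IsDuhamel T G y₀ y := by
  refine ⟨hy, hG, fun t ht => hinj ?_⟩
  have h0 : (0 : ℝ) ∈ timeInterval T := mem_timeInterval_of_abs_le ht (by simp)
  have hi : IntervalIntegrable (fun τ => freeGroup (-τ) (G τ)) volume 0 t :=
    ((continuousOn_freeGroup_neg hG).mono (uIcc_subset_timeInterval h0 ht)).intervalIntegrable
  have h1 := A.intervalIntegral_comp_comm hi
  have h2 := h.formula t ht
  simp only [hA] at h2
  rw [h2, h1, ← map_smul, ← map_add, hA]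

end Bessel

/-! ### The weighted operator norm -/

section Weighted

variable {s : ℝ≥0} {N : ℝ}

lemma japOp_eq_of_coeFn (hN : 0 ≤ N) {f y : L2} (hf : MemLp (fun x => (jap x ^ N) • f x) 2 volume)
    (hy : hf.toLp _ = y) : japOp N y = f := by
  refine Lp.ext ?_
  filter_upwards [japOp_coeFn hN y, hf.coeFn_toLp] with x h1 h2
  rw [hy] at h2
  rw [h1, h2, smul_smul, ← Real.rpow_add (jap_pos x), neg_add_cancel, Real.rpow_zero, one_smul]

lemma memLp_jap_smul_japOp (hN : 0 ≤ N) (y : L2) :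
    (fun x => (jap x ^ N) • japOp N y x) =ᵐ[volume] y := by
  filter_upwards [japOp_coeFn hN y] with x h1
  rw [h1, smul_smul, ← Real.rpow_add (jap_pos x), add_neg_cancel, Real.rpow_zero, one_smul]

/-- Substituting f = ⟨x⟩^{-N}y removes the domain condition, since every y in L² arises this way. It
also shows that the infimum defining the norm is attained. -/
lemma weightedOpNorm_le_iff (hN : 0 ≤ N) (A : Hs s →L[ℂ] Hs s) {c : ℝ≥0∞} :
    weightedOpNorm N A ≤ c ↔ ∀ y : L2,
      eLpNorm (fun x => (jap x ^ N) • conjOp A y x) 2 volume ≤ c * ‖japOp N y‖ₑ := by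
  have key : ∀ c : ℝ≥0∞, (∀ (f : L2) (hf : MemLp (fun x => (jap x ^ N) • f x) 2 volume),
      eLpNorm (fun x => (jap x ^ N) • bessel s (A ((besselEquiv s).symm (hf.toLp _))) x) 2 volume
      ≤ c * ‖f‖ₑ) ↔ ∀ y : L2,
      eLpNorm (fun x => (jap x ^ N) • conjOp A y x) 2 volume ≤ c * ‖japOp N y‖ₑ := fun c => by
    constructor
    · intro h y
      have hf : MemLp (fun x => (jap x ^ N) • japOp N y x) 2 volume :=
        (memLp_congr_ae (memLp_jap_smul_japOp hN y)).2 (Lp.memLp y)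
      have hy : hf.toLp _ = y := Lp.ext (hf.coeFn_toLp.trans (memLp_jap_smul_japOp hN y))
      have := h (japOp N y) hf
      rwa [hy] at this
    · intro h f hf
      have := h (hf.toLp _)
      rwa [japOp_eq_of_coeFn hN hf rfl] at this
  constructor
  · intro hc y
    -- The case y = 0 is separated because the infimum is reached by dividing by ‖⟨x⟩^{-N}y‖.
    by_cases h0 : ‖japOp N y‖ₑ = 0
    · have h1 : y =ᵐ[volume] (0 : E3 → E4) := by
        rw [enorm_eq_zero] at h0
        filter_upwards [memLp_jap_smul_japOp hN y, Lp.coeFn_zero E4 2 (volume : Measure E3)] with x hx h2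
        rw [h0, h2] at hx
        simpa using hx.symm
      have h2 : y = 0 := (Lp.eq_zero_iff_ae_eq_zero).2 h1
      rw [h2, map_zero]
      have h3 : (fun x => (jap x ^ N) • (0 : L2) x) =ᵐ[volume] (0 : E3 → E4) := by
        filter_upwards [Lp.coeFn_zero E4 2 (volume : Measure E3)] with x hx
        rw [hx]; simp
      rw [eLpNorm_congr_ae h3, eLpNorm_zero]
      exact bot_le
    · rw [← ENNReal.div_le_iff h0 enorm_ne_top]
      refine le_trans (le_sInf fun c' hc' => ?_) hc
      rw [ENNReal.div_le_iff h0 enorm_ne_top]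
      exact (key c').1 hc' y
  · intro h
    exact sInf_le ((key c).2 h)

/-- The form in which the potential norm is used: the conjugated potential gains a weight ⟨x⟩^{-N}
on each side. -/
lemma exists_japOp_eq (hN : 0 ≤ N) {A : Hs s →L[ℂ] Hs s} {c : ℝ≥0∞} (hc : c ≠ ∞)
    (h : weightedOpNorm N A ≤ c) (y : L2) :
    ∃ z : L2, japOp N z = conjOp A y ∧ ‖z‖ₑ ≤ c * ‖japOp N y‖ₑ := by
  have h1 := (weightedOpNorm_le_iff hN A).1 h y
  have hm : MemLp (fun x => (jap x ^ N) • conjOp A y x) 2 volume :=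
    ⟨(continuous_jap_rpow N).aestronglyMeasurable.smul (Lp.aestronglyMeasurable _),
      h1.trans_lt (ENNReal.mul_lt_top hc.lt_top enorm_lt_top)⟩
  refine ⟨hm.toLp _, japOp_eq_of_coeFn hN hm rfl, ?_⟩
  rwa [Lp.enorm_def, eLpNorm_congr_ae hm.coeFn_toLp]

lemma weightedOpNorm_sub_le (hN : 0 ≤ N) (A B : Hs s →L[ℂ] Hs s) :
    weightedOpNorm N (A - B) ≤ weightedOpNorm N A + weightedOpNorm N B := by
  refine (weightedOpNorm_le_iff hN _).2 fun y => ?_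
  have hA := (weightedOpNorm_le_iff hN A).1 le_rfl y
  have hB := (weightedOpNorm_le_iff hN B).1 le_rfl y
  have he : (fun x => (jap x ^ N) • conjOp (A - B) y x) =ᵐ[volume]
      (fun x => (jap x ^ N) • conjOp A y x) - fun x => (jap x ^ N) • conjOp B y x := by
    rw [conjOp_sub]
    filter_upwards [Lp.coeFn_sub (conjOp A y) (conjOp B y)] with x hx
    rw [hx, Pi.sub_apply, Pi.sub_apply, smul_sub]
  rw [eLpNorm_congr_ae he, add_mul]
  refine (eLpNorm_sub_le ?_ ?_ one_le_two).trans (add_le_add hA hB) <;>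
  exact (continuous_jap_rpow N).aestronglyMeasurable.smul (Lp.aestronglyMeasurable _)

variable {T : ℝ≥0∞} {V : ℝ → Hs s →L[ℂ] Hs s}

lemma ae_weightedOpNorm_le (T : ℝ≥0∞) (N : ℝ) (V : ℝ → Hs s →L[ℂ] Hs s) :
    ∀ᵐ t ∂(volume.restrict (timeInterval T)), weightedOpNorm N (V t) ≤ potentialNorm T N V :=
  ENNReal.ae_le_essSup _

lemma potentialNorm_sub_le (hN : 0 ≤ N) (V₁ V₂ : ℝ → Hs s →L[ℂ] Hs s) :
    potentialNorm T N (fun t => V₁ t - V₂ t) ≤ potentialNorm T N V₁ + potentialNorm T N V₂ := by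
  refine essSup_le_of_ae_le _ ?_
  filter_upwards [ae_weightedOpNorm_le T N V₁, ae_weightedOpNorm_le T N V₂] with t h1 h2
  exact (weightedOpNorm_sub_le hN _ _).trans (add_le_add h1 h2)

/-- The potential norm gives the bound for almost every t. The set where it fails is open by
continuity of V, and null, hence empty. -/
lemma norm_conjOp_le (hN : 0 ≤ N) {ε : ℝ≥0} (hV : ContinuousOn V (timeInterval T))
    (h : potentialNorm T N V ≤ ε) : ∀ t ∈ timeInterval T, ‖conjOp (V t)‖ ≤ ε := by
  have hae : ∀ᵐ t ∂(volume.restrict (timeInterval T)), ‖conjOp (V t)‖ ≤ ε := by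
    filter_upwards [ae_weightedOpNorm_le T N V] with t ht
    refine ContinuousLinearMap.opNorm_le_bound _ ε.coe_nonneg fun y => ?_
    obtain ⟨z, hz, hzy⟩ := exists_japOp_eq hN ENNReal.coe_ne_top (ht.trans h) y
    rw [← hz]
    refine (norm_japOp_le N z).trans ?_
    have h1 : ‖z‖ₑ ≤ ENNReal.ofReal (ε * ‖japOp N y‖) := by
      rw [ENNReal.ofReal_mul ε.coe_nonneg, ofReal_norm, ENNReal.ofReal_coe_nnreal]
      exact hzy
    rw [← ofReal_norm, ENNReal.ofReal_le_ofReal_iff (mul_nonneg ε.coe_nonneg (norm_nonneg _))] at h1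
    exact h1.trans (mul_le_mul_of_nonneg_left (norm_japOp_le N y) ε.coe_nonneg)
  have hopen : IsOpen (timeInterval T ∩ (fun t => ‖conjOp (V t)‖) ⁻¹' Ioi (ε : ℝ)) :=
    (continuousOn_conjOp hV).norm.isOpen_inter_preimage (isOpen_timeInterval T) isOpen_Ioi
  have hnull : volume (timeInterval T ∩ (fun t => ‖conjOp (V t)‖) ⁻¹' Ioi (ε : ℝ)) = 0 := by
    have := (ae_restrict_iff' (measurableSet_timeInterval T)).1 hae
    refine measure_mono_null (fun t ht => ?_) this
    simp only [mem_compl_iff, mem_ofPred_eq, not_forall, not_le]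
    exact ⟨ht.1, ht.2⟩
  have hempty := (hopen.measure_eq_zero_iff volume).1 hnull
  intro t ht
  by_contra hc
  exact (hempty ▸ (⟨ht, not_le.1 hc⟩ : t ∈ timeInterval T ∩ (fun t => ‖conjOp (V t)‖) ⁻¹' Ioi (ε : ℝ)) :
    t ∈ (∅ : Set ℝ))

end Weighted

/-! ### Solutions and Duhamel's formula -/

section Flow

variable {s : ℝ≥0} {T : ℝ≥0∞} {V : ℝ → Hs s →L[ℂ] Hs s} {u₀ : Hs s} {u : ℝ → Hs s}

lemma IsDiracFlow.isDuhamel (h : IsDiracFlow T V u₀ u) (hV : ContinuousOn V (timeInterval T)) :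
    IsDuhamel T (fun t => conjOp (V t) (besselIso s (u t))) (besselIso s u₀)
      (fun t => besselIso s (u t)) := by
  have hVu : ContinuousOn (fun t => V t (u t)) (timeInterval T) := hV.clm_apply h.continuousOn
  have hw : IsWeakSolution T (fun t => toL2 (u t)) (fun t => toL2 (V t (u t))) := h.equation
  have hd := hw.isDuhamel (continuous_toL2.comp_continuousOn h.continuousOn)
    (continuous_toL2.comp_continuousOn hVu)
  have he : ∀ t, conjOp (V t) (besselIso s (u t)) = besselIso s (V t (u t)) := fun t => by
    rw [conjOp_apply, LinearIsometryEquiv.symm_apply_apply]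
  simp only [he]
  refine IsDuhamel.of_map (A := smoothOp s) ?_
    ((besselIso s).continuous.comp_continuousOn h.continuousOn)
    ((besselIso s).continuous.comp_continuousOn hVu) freeGroup_smoothOp smoothOp_injective
  simp only [smoothOp_besselIso]
  rwa [h.initial] at hd

lemma IsDuhamel.isDiracFlow (hT : 0 < T) {y : ℝ → L2}
    (h : IsDuhamel T (fun t => conjOp (V t) (y t)) (besselIso s u₀) y) :
    IsDiracFlow T V u₀ (fun t => (besselIso s).symm (y t)) := by
  refine ⟨(besselIso s).symm.continuous.comp_continuousOn h.continuousOn, ?_, ?_⟩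
  · rw [h.formula 0 (zero_mem_timeInterval hT), intervalIntegral.integral_same, smul_zero, add_zero,
      freeGroup_zero, LinearIsometryEquiv.symm_apply_apply]
  · have h1 := (h.map (A := smoothOp s) freeGroup_smoothOp).isWeakSolution
    intro t ht φ
    have h2 := h1 t ht φ
    simp only [smoothOp_eq, conjOp_apply, LinearIsometryEquiv.symm_apply_apply] at h2
    exact h2

lemma exists_isDiracFlow {N : ℝ} (hN : 0 ≤ N) (hT : 0 < T) {ε : ℝ≥0}
    (hV : ContinuousOn V (timeInterval T)) (h : potentialNorm T N V ≤ ε) (u₀ : Hs s) :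
    ∃ u, IsDiracFlow T V u₀ u := by
  obtain ⟨y, hy⟩ := exists_isDuhamel (besselIso s u₀) (continuousOn_conjOp hV) ε.2
    (norm_conjOp_le hN hV h)
  exact ⟨_, hy.isDiracFlow hT⟩

end Flow

/-! ### Local decay and Strichartz estimates for the free Dirac group -/

lemma exists_localDecay_japOp {N : ℝ} (hN : 3 / 2 < N) :
    ∃ k : ℝ → ℝ≥0∞, LocalDecay (japOp N) k ∧ (∫⁻ t, k t) ≠ ∞ := by
  obtain ⟨C, hC, h⟩ := exists_local_decay hN
  refine ⟨fun t => ENNReal.ofReal (C * decayKernel t), ⟨inner_japOp N, ?_, fun φ ψ t => ?_⟩, ?_⟩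
  · exact (continuous_const.mul continuous_decayKernel).measurable.ennreal_ofReal
  · have h1 := ENNReal.ofReal_le_ofReal (h φ ψ t)
    rw [ofReal_norm, ENNReal.ofReal_mul (mul_nonneg hC.le (decayKernel_nonneg t)),
      ENNReal.ofReal_mul (norm_nonneg _), ofReal_norm, ofReal_norm] at h1
    exact h1
  · have hi : Integrable fun t => C * decayKernel t := integrable_decayKernel.const_mul C
    rw [← ofReal_integral_eq_lintegral_ofReal hi
      (Filter.Eventually.of_forall fun t => mul_nonneg hC.le (decayKernel_nonneg t))]
    exact ENNReal.ofReal_ne_top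

lemma timeInterval_top : timeInterval ⊤ = univ :=
  eq_univ_of_forall fun _ => ENNReal.ofReal_lt_top

/-- Admissibility on H^s becomes an estimate on L² through the isometry (1-Δ)^{s/2}, which commutes
with the group. The condition r ≥ 1 gives the triangle inequality. -/
lemma DiracAdmissible.exists_strichartzFamily {p r : ℝ≥0∞} {s : ℝ≥0} (hr : 1 ≤ r)
    (h : DiracAdmissible p r s) :
    ∃ C : ℝ≥0, StrichartzFamily p (fun t f => eLpNorm (smoothOp s (freeGroup t f)) r volume) C := by
  obtain ⟨C, hC⟩ := h
  refine ⟨C, fun t => ?_, fun f => ?_, fun t => ?_, fun t f g => ?_, fun f => ?_⟩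
  · have h1 : Continuous fun f : L2 => smoothOp s (freeGroup t f) :=
      (smoothOp s ∘L freeGroup t).continuous
    exact (lowerSemicontinuous_eLpNorm r).comp h1
  · have h1 : Continuous fun t : ℝ => smoothOp s (freeGroup t f) := by
      have h2 := (smoothOp s).continuous.comp (continuous_freeGroup f)
      simp only [Function.comp_def] at h2
      exact h2
    exact (lowerSemicontinuous_eLpNorm r).comp h1
  · simp only [map_zero]
    rw [eLpNorm_congr_ae (Lp.coeFn_zero E4 2 (volume : Measure E3)), eLpNorm_zero]
  · simp only [map_add]
    rw [eLpNorm_congr_ae (Lp.coeFn_add _ _)]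
    exact eLpNorm_add_le (Lp.aestronglyMeasurable _) (Lp.aestronglyMeasurable _) hr
  · have h1 := hC ((besselIso s).symm f)
    rw [mixedNorm, timeInterval_top, Measure.restrict_univ, ← enorm_besselIso,
      LinearIsometryEquiv.apply_symm_apply] at h1
    have he : ∀ t, smoothOp s (freeGroup t f) = diracGroup t (toL2 ((besselIso s).symm f)) :=
      fun t => by rw [← freeGroup_smoothOp, smoothOp_eq, freeGroup_eq_diracGroup]
    simp only [he]
    exact h1

lemma eLpNorm_two_add_le {μ : Measure ℝ} {a b : ℝ → ℝ≥0∞} (ha : AEMeasurable a μ)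
    (hb : AEMeasurable b μ) (c d : ℝ≥0∞) :
    eLpNorm (fun t => c * a t + d * b t) 2 μ ≤ c * eLpNorm a 2 μ + d * eLpNorm b 2 μ := by
  rw [← eLpNorm_const_mul_two c ha, ← eLpNorm_const_mul_two d hb]
  exact eLpNorm_add_le (f := fun t => c * a t) (g := fun t => d * b t)
    (ha.const_mul c).aestronglyMeasurable (hb.const_mul d).aestronglyMeasurable one_le_two

/-! ### Estimates for the difference of two solutions -/

section Difference

variable {Q : L2 →L[ℂ] L2} {k : ℝ → ℝ≥0∞} {T : ℝ≥0∞} {G : ℝ → L2} {y : ℝ → L2}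

lemma IsDuhamel.sub {G₁ G₂ : ℝ → L2} {y₀ z₀ : L2} {y z : ℝ → L2} (hy : IsDuhamel T G₁ y₀ y)
    (hz : IsDuhamel T G₂ z₀ z) :
    IsDuhamel T (fun t => G₁ t - G₂ t) (y₀ - z₀) (fun t => y t - z t) := by
  refine ⟨hy.continuousOn.sub hz.continuousOn,
    hy.continuousOn_forcing.sub hz.continuousOn_forcing, fun t ht => ?_⟩
  have h0 : (0 : ℝ) ∈ timeInterval T := mem_timeInterval_of_abs_le ht (by simp)
  have hi : ∀ {G : ℝ → L2}, ContinuousOn G (timeInterval T) →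
      IntervalIntegrable (fun τ => freeGroup (-τ) (G τ)) volume 0 t := fun hG =>
    ((continuousOn_freeGroup_neg hG).mono (uIcc_subset_timeInterval h0 ht)).intervalIntegrable
  simp only [map_sub]
  rw [intervalIntegral.integral_sub (hi hy.continuousOn_forcing) (hi hz.continuousOn_forcing),
    hy.formula t ht, hz.formula t ht, ← map_sub, smul_sub]
  congr 1
  abel

lemma IsDuhamel.interaction_sub {y₀ : L2} (hy : IsDuhamel T G y₀ y) {s t : ℝ}
    (hs : s ∈ timeInterval T) (ht : t ∈ timeInterval T) :
    freeGroup (-t) (y t) - freeGroup (-s) (y s) =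
      Complex.I • ∫ τ in s..t, freeGroup (-τ) (G τ) := by
  have h0 : (0 : ℝ) ∈ timeInterval T := mem_timeInterval_of_abs_le ht (by simp)
  have hi : ∀ {t : ℝ}, t ∈ timeInterval T →
      IntervalIntegrable (fun τ => freeGroup (-τ) (G τ)) volume 0 t := fun ht =>
    ((continuousOn_freeGroup_neg hy.continuousOn_forcing).mono
      (uIcc_subset_timeInterval h0 ht)).intervalIntegrable
  rw [hy.formula t ht, hy.formula s hs, ← freeGroup_add, ← freeGroup_add, neg_add_cancel,
    neg_add_cancel, freeGroup_zero, freeGroup_zero, add_sub_add_left_eq_sub, ← smul_sub,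
    intervalIntegral.integral_interval_sub_left (hi ht) (hi hs)]

/-- In the interaction picture the solution has bounded quadratic variation, controlled by the
measure ‖k‖₁ g² dτ. -/
lemma LocalDecay.enorm_interaction_sub_sq_le (hQ : LocalDecay Q k) {y₀ : L2}
    (hy : IsDuhamel T G y₀ y) {g : ℝ → ℝ≥0∞} (hF : ForcingBound Q (timeInterval T) G g)
    (hg : AEMeasurable g (volume.restrict (timeInterval T))) {s t : ℝ}
    (hs : s ∈ timeInterval T) (ht : t ∈ timeInterval T) :
    ‖freeGroup (-t) (y t) - freeGroup (-s) (y s)‖ₑ ^ 2 ≤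
      (∫⁻ t, k t) * ∫⁻ τ in uIoc s t, g τ ^ 2 := by
  rw [hy.interaction_sub hs ht, enorm_smul]
  have h1 : ‖Complex.I‖ₑ = 1 := by rw [← ofReal_norm, Complex.norm_I, ENNReal.ofReal_one]
  rw [h1, one_mul]
  exact hQ.enorm_intervalIntegral_sq_le hy.continuousOn_forcing hF hg hs ht

lemma LocalDecay.enorm_le_of_isDuhamel_zero (hQ : LocalDecay Q k) (hy : IsDuhamel T G 0 y)
    {g : ℝ → ℝ≥0∞} (hF : ForcingBound Q (timeInterval T) G g)
    (hg : AEMeasurable g (volume.restrict (timeInterval T))) {X : ℝ≥0}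
    (hX : (∫⁻ t, k t) * ∫⁻ τ in timeInterval T, g τ ^ 2 ≤ (X : ℝ≥0∞) ^ 2) {t : ℝ}
    (ht : t ∈ timeInterval T) : ‖y t‖ₑ ≤ X := by
  have h0 : (0 : ℝ) ∈ timeInterval T := mem_timeInterval_of_abs_le ht (by simp)
  have h1 := hQ.enorm_interaction_sub_sq_le hy hF hg h0 ht
  have h2 : y 0 = 0 := by
    rw [hy.formula 0 h0, intervalIntegral.integral_same, smul_zero, add_zero, map_zero]
  rw [h2, map_zero, sub_zero, ← ofReal_norm, norm_freeGroup, ofReal_norm] at h1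
  refine (ENNReal.pow_le_pow_left_iff two_ne_zero).1 (h1.trans (le_trans ?_ hX))
  gcongr
  exact uIoc_subset_uIcc.trans (uIcc_subset_timeInterval h0 ht)

/-- Applies the quadratic variation estimate to e^{-it𝓓}y(t), measuring time by the mass of ‖k‖₁ g²
accumulated up to t. -/
lemma exists_strichartz_duhamel {p : ℝ≥0∞} (hp : 2 < p) :
    ∃ K : ℝ≥0, ∀ (ν : ℝ → L2 → ℝ≥0∞) (C : ℝ≥0), StrichartzFamily p ν C →
      ∀ {Q : L2 →L[ℂ] L2} {k : ℝ → ℝ≥0∞} {T : ℝ≥0∞} {G : ℝ → L2} {y : ℝ → L2} {g : ℝ → ℝ≥0∞}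
        {X : ℝ≥0}, LocalDecay Q k → (∫⁻ t, k t) ≠ ∞ → IsDuhamel T G 0 y →
        ForcingBound Q (timeInterval T) G g →
        AEMeasurable g (volume.restrict (timeInterval T)) →
        (∫⁻ t, k t) * ∫⁻ τ in timeInterval T, g τ ^ 2 ≤ (X : ℝ≥0∞) ^ 2 →
        eLpNorm (fun t => ν t (freeGroup (-t) (y t))) p (volume.restrict (timeInterval T)) ≤
          K * C * X := by
  obtain ⟨K, hK⟩ := exists_quadratic_variation_strichartz hp
  refine ⟨K, fun ν C hν Q k T G y g X hQ hk hy hF hg hX => ?_⟩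
  set I := timeInterval T with hI
  set κ := ∫⁻ t, k t
  let a : ℝ → ℝ≥0∞ := fun t => κ * ∫⁻ τ in I ∩ Iic t, g τ ^ 2
  have haX : ∀ t, a t ≤ (X : ℝ≥0∞) ^ 2 := fun t => by
    refine le_trans ?_ hX
    simp only [a]
    gcongr
    exact inter_subset_left
  have haf : ∀ t, a t ≠ ∞ := fun t => ((haX t).trans_lt (by finiteness)).ne
  have hadd : ∀ s t, s ≤ t → s ∈ I → t ∈ I → a t = a s + κ * ∫⁻ τ in uIoc s t, g τ ^ 2 := by
    intro s t hst hs ht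
    have hsub : Ioc s t ⊆ I := Ioc_subset_Icc_self.trans ((ordConnected_timeInterval T).out hs ht)
    have hset : I ∩ Iic t = (I ∩ Iic s) ∪ Ioc s t := by
      ext τ
      constructor
      · rintro ⟨h1, h2⟩
        rcases le_or_gt τ s with h | h
        · exact Or.inl ⟨h1, h⟩
        · exact Or.inr ⟨h, h2⟩
      · rintro (⟨h1, h2⟩ | h)
        · exact ⟨h1, le_trans h2 hst⟩
        · exact ⟨hsub h, h.2⟩
    have hdisj : Disjoint (I ∩ Iic s) (Ioc s t) :=
      Set.disjoint_left.2 fun τ h1 h2 => not_lt_of_ge h1.2 h2.1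
    simp only [a]
    rw [hset, lintegral_union measurableSet_Ioc hdisj, mul_add, uIoc_of_le hst]
  have hosc : ∀ s t, s ≤ t → s ∈ I → t ∈ I →
      ‖freeGroup (-t) (y t) - freeGroup (-s) (y s)‖ ^ 2 ≤ (a t).toReal - (a s).toReal := by
    intro s t hst hs ht
    have h1 := hQ.enorm_interaction_sub_sq_le hy hF hg hs ht
    have h2 := hadd s t hst hs ht
    generalize κ * ∫⁻ τ in uIoc s t, g τ ^ 2 = b at h1 h2
    have hb : b ≠ ∞ := fun hb => haf t (by rw [h2, hb, add_top])
    have h3 := ENNReal.toReal_mono hb h1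
    rw [ENNReal.toReal_pow, toReal_enorm] at h3
    rw [h2, ENNReal.toReal_add (haf s) hb]
    linarith
  refine ENNReal.le_of_forall_pos_le_add fun δ hδ _ => ?_
  -- The total mass must be positive for the dyadic argument, so X is enlarged by η at a cost of at
  -- most the arbitrary δ; the + 1 avoids dividing by zero.
  set η : ℝ≥0 := δ / (K * C + 1) with hη
  have hη0 : 0 < η := by positivity
  have hm : (0 : ℝ) < (X + η : ℝ) ^ 2 := by
    have : (0 : ℝ) < η := hη0
    positivity
  have hXm : (X : ℝ) ^ 2 ≤ (X + η : ℝ) ^ 2 := by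
    have := η.coe_nonneg
    gcongr
    linarith
  have h := hK ν C hν I (fun t => freeGroup (-t) (y t)) (fun t => (a t).toReal) ((X + η : ℝ) ^ 2)
    (measurableSet_timeInterval T) hm (fun _ _ => ENNReal.toReal_nonneg)
    (fun t _ => by
      refine le_trans ?_ hXm
      have := ENNReal.toReal_mono (by finiteness) (haX t)
      simpa using this)
    (fun s hs t ht => by
      rcases le_total s t with hst | hst
      · rw [norm_sub_rev, abs_sub_comm]
        exact (hosc s t hst hs ht).trans (le_abs_self _)
      · exact (hosc t s hst ht hs).trans (le_abs_self _))
    (fun t ht => by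
      refine le_trans ?_ hXm
      rw [norm_freeGroup]
      have h1 := ENNReal.toReal_mono ENNReal.coe_ne_top
        (hQ.enorm_le_of_isDuhamel_zero hy hF hg hX ht)
      rw [toReal_enorm, ENNReal.coe_toReal] at h1
      gcongr)
  refine h.trans ?_
  rw [Real.sqrt_sq (by positivity), ← NNReal.coe_add, ENNReal.ofReal_coe_nnreal]
  have h2 : K * C * (X + η) ≤ K * C * X + δ := by
    rw [mul_add]
    gcongr
    rw [hη, mul_div_assoc', div_le_iff₀ (by positivity), mul_comm]
    gcongr
    exact le_self_add
  exact_mod_cast h2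

variable {s : ℝ≥0} {N : ℝ}

lemma forcingBound_conjOp (hN : 0 ≤ N) {V : ℝ → Hs s →L[ℂ] Hs s} {ε : ℝ≥0∞} (hε : ε ≠ ∞)
    (hV : potentialNorm T N V ≤ ε) (y : ℝ → L2) :
    ForcingBound (japOp N) (timeInterval T) (fun t => conjOp (V t) (y t))
      (fun t => ε * ‖japOp N (y t)‖ₑ) := by
  filter_upwards [ae_weightedOpNorm_le T N V] with t ht
  exact exists_japOp_eq hN hε (ht.trans hV) (y t)

lemma ForcingBound.add {I : Set ℝ} {F G : ℝ → L2} {f g : ℝ → ℝ≥0∞} (hF : ForcingBound Q I F f)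
    (hG : ForcingBound Q I G g) : ForcingBound Q I (fun t => F t + G t) (fun t => f t + g t) := by
  filter_upwards [hF, hG] with t ⟨z, hz, hzf⟩ ⟨w, hw, hwg⟩
  exact ⟨z + w, by rw [map_add, hz, hw], (enorm_add_le _ _).trans (add_le_add hzf hwg)⟩

/-- The difference of two solutions with the same data is driven by a forcing term which is
controlled by the difference of the potentials. -/
lemma exists_forcingBound_sub (hN : 0 ≤ N) (hQ : LocalDecay (japOp N) k)
    {ε : ℝ≥0} (hε : (∫⁻ t, k t) * ε ≤ 2⁻¹)
    {V₁ V₂ : ℝ → Hs s →L[ℂ] Hs s} (hV₁ : potentialNorm T N V₁ ≤ ε)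
    (hV₂ : potentialNorm T N V₂ ≤ ε) {y₀ : L2} {y₁ y₂ : ℝ → L2}
    (h₁ : IsDuhamel T (fun t => conjOp (V₁ t) (y₁ t)) y₀ y₁)
    (h₂ : IsDuhamel T (fun t => conjOp (V₂ t) (y₂ t)) y₀ y₂) :
    ∃ g : ℝ → ℝ≥0∞, AEMeasurable g (volume.restrict (timeInterval T)) ∧
      ForcingBound (japOp N) (timeInterval T)
        (fun t => conjOp (V₁ t) (y₁ t) - conjOp (V₂ t) (y₂ t)) g ∧
      (∫⁻ t, k t) * ∫⁻ t in timeInterval T, g t ^ 2 ≤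
        (4 * (∫⁻ t, k t) * potentialNorm T N (fun t => V₁ t - V₂ t) * ‖y₀‖ₑ) ^ 2 := by
  set κ := ∫⁻ t, k t with hκ
  set δ := potentialNorm T N (fun t => V₁ t - V₂ t) with hδ
  set μ := volume.restrict (timeInterval T) with hμ
  have hδf : δ ≠ ∞ := ((potentialNorm_sub_le hN V₁ V₂).trans_lt
    (ENNReal.add_lt_top.2 ⟨hV₁.trans_lt ENNReal.coe_lt_top, hV₂.trans_lt ENNReal.coe_lt_top⟩)).ne
  have hd := h₁.sub h₂
  rw [sub_self] at hd
  have hmeas : ∀ {y : ℝ → L2}, ContinuousOn y (timeInterval T) →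
      AEMeasurable (fun t => ‖japOp N (y t)‖ₑ) μ := fun hy =>
    (((japOp N).continuous.comp_continuousOn hy).aestronglyMeasurable
      (measurableSet_timeInterval T)).enorm
  have hm2 := hmeas h₂.continuousOn
  have hmd := hmeas hd.continuousOn
  have hm2' : AEMeasurable (fun t => δ * ‖japOp N (y₂ t)‖ₑ) μ := hm2.const_mul δ
  have hmd' : AEMeasurable (fun t => (ε : ℝ≥0∞) * ‖japOp N (y₁ t - y₂ t)‖ₑ) μ := hmd.const_mul _
  -- Smoothing for the second solution: its whole forcing is the absorbed potential term, so γ = 0.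
  have hA : eLpNorm (fun t => ‖japOp N (y₂ t)‖ₑ) 2 μ ≤ 2 * (κ ^ (1 / 2 : ℝ) * ‖y₀‖ₑ) := by
    have h := hQ.eLpNorm_le_of_isDuhamel h₂ (γ := fun _ => 0) (c := ε)
      (by simpa using forcingBound_conjOp hN ENNReal.coe_ne_top hV₂ y₂) aemeasurable_const hε
    simpa using h
  have hF : ForcingBound (japOp N) (timeInterval T)
      (fun t => conjOp (V₁ t) (y₁ t) - conjOp (V₂ t) (y₂ t))
      (fun t => (ε : ℝ≥0∞) * ‖japOp N (y₁ t - y₂ t)‖ₑ + δ * ‖japOp N (y₂ t)‖ₑ) := by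
    have h := (forcingBound_conjOp hN ENNReal.coe_ne_top hV₁ (fun t => y₁ t - y₂ t)).add
      (forcingBound_conjOp hN hδf hδ.ge y₂)
    -- W₁y₁ - W₂y₂ = W₁(y₁ - y₂) + (W₁ - W₂)y₂: the first term is absorbed by smallness, the second
    -- is the source.
    have he : ∀ t, conjOp (V₁ t) (y₁ t - y₂ t) + conjOp (V₁ t - V₂ t) (y₂ t) =
        conjOp (V₁ t) (y₁ t) - conjOp (V₂ t) (y₂ t) := fun t => by
      rw [conjOp_sub, map_sub]; abel
    simpa only [he] using h
  have hB := hQ.eLpNorm_le_of_isDuhamel hd hF hm2' hε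
  rw [← hμ, eLpNorm_const_mul_two δ hm2, ← hκ] at hB
  simp only [enorm_zero, mul_zero, zero_add] at hB
  refine ⟨fun t => (ε : ℝ≥0∞) * ‖japOp N (y₁ t - y₂ t)‖ₑ + δ * ‖japOp N (y₂ t)‖ₑ,
    hmd'.add hm2', hF, ?_⟩
  have hg : eLpNorm (fun t => (ε : ℝ≥0∞) * ‖japOp N (y₁ t - y₂ t)‖ₑ + δ * ‖japOp N (y₂ t)‖ₑ) 2 μ ≤
      ε * eLpNorm (fun t => ‖japOp N (y₁ t - y₂ t)‖ₑ) 2 μ +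
        δ * eLpNorm (fun t => ‖japOp N (y₂ t)‖ₑ) 2 μ := by
    exact eLpNorm_two_add_le hmd hm2 _ _
  beta_reduce
  rw [← sq_eLpNorm_two, ← enorm_sqrt_mul]
  refine pow_le_pow_left' ?_ 2
  have hκs : κ ^ (1 / 2 : ℝ) * κ ^ (1 / 2 : ℝ) = κ := by
    rw [← ENNReal.rpow_add_of_nonneg _ _ (by norm_num) (by norm_num)]
    norm_num
  generalize eLpNorm (fun t => (ε : ℝ≥0∞) * ‖japOp N (y₁ t - y₂ t)‖ₑ + δ * ‖japOp N (y₂ t)‖ₑ) 2 μ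
    = Γ at *
  generalize eLpNorm (fun t => ‖japOp N (y₁ t - y₂ t)‖ₑ) 2 μ = B at *
  generalize eLpNorm (fun t => ‖japOp N (y₂ t)‖ₑ) 2 μ = A at *
  clear_value κ δ
  generalize κ ^ (1 / 2 : ℝ) = q at *
  generalize ‖y₀‖ₑ = Y at *
  -- Inserting the smoothing bound for the difference, the absorbed term contributes no more than
  -- the source.
  have h1 : Γ ≤ 2 * (δ * A) := by
    calc Γ ≤ ε * (2 * (κ * (δ * A))) + δ * A := hg.trans (by gcongr)
      _ = 2 * (κ * ε) * (δ * A) + δ * A := by ring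
      _ ≤ 2 * 2⁻¹ * (δ * A) + δ * A := by gcongr
      _ = 2 * (δ * A) := by
        rw [ENNReal.mul_inv_cancel two_ne_zero ENNReal.ofNat_ne_top, one_mul, two_mul]
  calc q * Γ ≤ q * (2 * (δ * (2 * (q * Y)))) := by gcongr; exact h1.trans (by gcongr)
    _ = 4 * (q * q) * δ * Y := by ring
    _ = _ := by rw [hκs]

end Difference

end DiracFlow

end

/-! ### Conclusion: existence and the two difference estimates -/

theorem proposition2p4 (p r : ℝ≥0∞) (s : ℝ≥0) (hp : 2 < p) (hr : 1 ≤ r)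
    (hadm : DiracFlow.DiracAdmissible p r s) (N : ℝ) (hN : 3 / 2 < N) :
    ∃ ε : ℝ≥0, 0 < ε ∧ ∃ C : ℝ≥0, ∀ T : ℝ≥0∞, 0 < T →
      ∀ V₁ V₂ : ℝ → (DiracFlow.Hs s →L[ℂ] DiracFlow.Hs s),
        ContinuousOn V₁ (DiracFlow.timeInterval T) →
        ContinuousOn V₂ (DiracFlow.timeInterval T) →
        DiracFlow.potentialNorm T N V₁ ≤ ε →
        DiracFlow.potentialNorm T N V₂ ≤ ε →
        ∀ u₀ : DiracFlow.Hs s,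
          (∃ u, DiracFlow.IsDiracFlow T V₁ u₀ u) ∧
          (∃ u, DiracFlow.IsDiracFlow T V₂ u₀ u) ∧
          ∀ u₁ u₂ : ℝ → DiracFlow.Hs s,
            DiracFlow.IsDiracFlow T V₁ u₀ u₁ → DiracFlow.IsDiracFlow T V₂ u₀ u₂ →
              DiracFlow.mixedNorm T p r (fun t => DiracFlow.toL2 (u₁ t) - DiracFlow.toL2 (u₂ t))
                  ≤ C * DiracFlow.potentialNorm T N (fun t => V₁ t - V₂ t) * ‖u₀‖ₑ ∧
              eLpNorm (fun t => u₁ t - u₂ t) ∞ (volume.restrict (DiracFlow.timeInterval T))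
                  ≤ C * DiracFlow.potentialNorm T N (fun t => V₁ t - V₂ t) * ‖u₀‖ₑ := by
  have hN0 : 0 ≤ N := by linarith
  obtain ⟨k, hQ, hk⟩ := DiracFlow.exists_localDecay_japOp hN
  obtain ⟨B, hB⟩ := hadm.exists_strichartzFamily hr
  obtain ⟨K, hK⟩ := DiracFlow.exists_strichartz_duhamel hp
  obtain ⟨κ, hκ⟩ : ∃ κ : ℝ≥0, (κ : ℝ≥0∞) = ∫⁻ t, k t := ⟨_, ENNReal.coe_toNNReal hk⟩
  -- Ensures κε ≤ 1/2, the absorption condition; the + 1 covers κ = 0.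
  set ε : ℝ≥0 := (2 * (κ + 1))⁻¹ with hεdef
  have hε0 : 0 < ε := by positivity
  have hε : (∫⁻ t, k t) * ε ≤ 2⁻¹ := by
    rw [← hκ]
    have h : κ * ε ≤ 2⁻¹ := by
      rw [hεdef, mul_inv, mul_comm, mul_assoc]
      refine mul_le_of_le_one_right (by positivity) ?_
      rw [inv_mul_le_iff₀ (by positivity), mul_one]
      exact le_self_add
    have h' := ENNReal.coe_le_coe.2 h
    rwa [ENNReal.coe_mul, ENNReal.coe_inv two_ne_zero, ENNReal.coe_ofNat] at h'
  -- 4κ is the forcing constant, K·B comes from the Strichartz bound, and 1 from the uniform bound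
  -- in H^s.
  refine ⟨ε, hε0, (K * B + 1) * (4 * κ), fun T hT V₁ V₂ hc₁ hc₂ hV₁ hV₂ u₀ =>
    ⟨DiracFlow.exists_isDiracFlow hN0 hT hc₁ hV₁ u₀,
      DiracFlow.exists_isDiracFlow hN0 hT hc₂ hV₂ u₀, fun u₁ u₂ h₁ h₂ => ?_⟩⟩
  have hy₁ := h₁.isDuhamel hc₁
  have hy₂ := h₂.isDuhamel hc₂
  obtain ⟨g, hgm, hF, hg⟩ := DiracFlow.exists_forcingBound_sub hN0 hQ hε hV₁ hV₂ hy₁ hy₂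
  have hd := hy₁.sub hy₂
  rw [sub_self] at hd
  have hδf : DiracFlow.potentialNorm T N (fun t => V₁ t - V₂ t) ≠ ∞ :=
    ((DiracFlow.potentialNorm_sub_le hN0 V₁ V₂).trans_lt (ENNReal.add_lt_top.2
      ⟨hV₁.trans_lt ENNReal.coe_lt_top, hV₂.trans_lt ENNReal.coe_lt_top⟩)).ne
  rw [DiracFlow.enorm_besselIso] at hg
  generalize DiracFlow.potentialNorm T N (fun t => V₁ t - V₂ t) = δ at *
  obtain ⟨X, hX⟩ : ∃ X : ℝ≥0, (X : ℝ≥0∞) = 4 * (∫⁻ t, k t) * δ * ‖u₀‖ₑ :=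
    ⟨_, ENNReal.coe_toNNReal (by finiteness)⟩
  rw [← hX] at hg
  have hXe : ∀ c : ℝ≥0, (c : ℝ≥0∞) * X = (c * (4 * κ) : ℝ≥0) * δ * ‖u₀‖ₑ := fun c => by
    rw [hX, ← hκ]; push_cast; ring
  constructor
  · have h := hK _ B hB hQ hk hd hF hgm hg
    have he : ∀ t, DiracFlow.smoothOp s (DiracFlow.freeGroup t (DiracFlow.freeGroup (-t)
        (DiracFlow.besselIso s (u₁ t) - DiracFlow.besselIso s (u₂ t)))) =
        DiracFlow.toL2 (u₁ t) - DiracFlow.toL2 (u₂ t) := fun t => by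
      rw [← DiracFlow.freeGroup_add, add_neg_cancel, DiracFlow.freeGroup_zero, map_sub,
        DiracFlow.smoothOp_besselIso, DiracFlow.smoothOp_besselIso]
    simp only [he] at h
    refine h.trans ?_
    rw [← hXe]
    push_cast
    gcongr
    exact le_self_add
  · rw [eLpNorm_exponent_top]
    refine eLpNormEssSup_le_of_ae_enorm_bound ?_
    filter_upwards [ae_restrict_mem (DiracFlow.measurableSet_timeInterval T)] with t ht
    have h := hQ.enorm_le_of_isDuhamel_zero hd hF hgm hg ht
    rw [← map_sub, DiracFlow.enorm_besselIso] at h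
    refine h.trans ?_
    rw [← hXe]
    push_cast
    exact le_mul_of_one_le_left bot_le le_add_self
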